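/- Let $n\ge 1$ and let $(M^n,g)$ be a smooth Riemannian manifold with (possibly empty) smooth boundary which is locally convex, i.e. the second fundamental form of $\partial M$ with respect to the inner unit normal is $\ge 0$. On the Riemannian product $M\times\mathbb R$, with vertical unit field $\xi=(0,1)$, consider a product weight $e^{\psi(p,t)}=e^{h(p)}e^{v(t)}$ with $h\in C^\infty(M)$, $v\in C^\infty(\mathbb R)$. For a weight $e^f$ write $\mathrm{Ric}_f=\mathrm{Ric}-\nabla^2 f$ (the Bakry–Émery–Ricci tensor), and suppose that there is $c\in\mathbb R$ with $\mathrm{Ric}_v\le c\le \mathrm{Ric}_h$, i.e. $\mathrm{Ric}_v(w,w)\le c|w|^2$ for all tangent vectors $w$ of $\mathbb R$ and $\mathrm{Ric}_h(w,w)\ge c|w|^2$ for all tangent vectors $w$ of $M$. Let $\Sigma$ be a connected two-sided smooth (immersed) hypersurface, possibly with boundary, in $M\times\mathbb R$, with smooth unit normal $N$ and angle function $\theta=\langle\xi,N\rangle$, such that: - $\Sigma$ is a horizontal multigraph: $\theta\le 0$ on $\Sigma$; - $\Sigma$ is $\psi$-parabolic: for the induced metric, every $u\in C^2(\Sigma)$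 that is bounded from above and satisfies $\Delta_{\Sigma,\psi}u=\Delta_\Sigma u+\langle\nabla_\Sigma\psi,\nabla_\Sigma u\rangle\ge 0$ on $\Sigma\setminus\partial\Sigma$ and $\partial u/\partial\nu\ge 0$ along $\partial\Sigma$ is constant, where $\nu$ is the inner unit normal of $\partial\Sigma$ in $\Sigma$; - $\Sigma$ has constant $\psi$-mean curvature: $H_\psi=-(\mathrm{div}_\Sigma N+\langle\nabla\psi,N\rangle)$ is constant on $\Sigma$; - $\Sigma$ has free boundary in $\partial M\times\mathbb R$: if $\partial\Sigma\ne\emptyset$, then $\partial\Sigma=\Sigma\cap(\partial M\times\mathbb R)$ and $\Sigma$ is orthogonal to $\partial M\times\mathbb R$ along $\partial\Sigma$. Then $\theta$ is constant, and at least one of the following holds: (i) $\Sigma$ is a vertical cylinder, i.e. $\theta=0$ on $\Sigma$; (ii) $\Sigma$ is contained in a horizontal slice $M\times\{s\}$ for some $s\in\mathbb R$; (iii) $\Sigma$ is totally geodesic, $\mathrm{Ric}_\psi(N,N)=\mathrm{Ric}_\psi(\xi,\xi)=c$ on $\Sigma$, and $\mathrm{II}(N,N)=0$ along $\partial\Sigma$,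 where $\mathrm{II}$ is the second fundamental form of $\partial M\times\mathbb R$ with respect to the inner unit normal. -/

import Mathlib

open scoped Manifold ContDiff Topology

noncomputable section

namespace WeightedGeom

/-! ### Riemannian geometry in an open piece of a vector space

`G : E → E →L[ℝ] E →L[ℝ] ℝ` is a metric given in coordinates and `s` the set on which all
derivatives are taken (the range of a chart model: the whole space or a half-space). -/

section Coordinates

variable {E : Type*} [NormedAddCommGroup E] [NormedSpace ℝ E]

/-- Cyclic permutation of the arguments of a trilinear form: `(u, v, w) ↦ D (w, u, v)`. -/
def cycleForm (D : E →L[ℝ] E →L[ℝ] E →L[ℝ] ℝ) : E →L[ℝ] E →L[ℝ] E →L[ℝ] ℝ :=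
  ContinuousLinearMap.comp
    ((ContinuousLinearMap.flipₗᵢ ℝ E E ℝ).toContinuousLinearEquiv.toContinuousLinearMap) D.flip

/-- Christoffel symbols of the first kind:
`Γ♭(u, v, w) = (∂_u G (v, w) + ∂_v G (u, w) - ∂_w G (u, v)) / 2`. -/
def christoffelLow (G : E → E →L[ℝ] E →L[ℝ] ℝ) (s : Set E) (y : E) : E →L[ℝ] E →L[ℝ] E →L[ℝ] ℝ :=
  (1 / 2 : ℝ) • (fderivWithin ℝ G s y + (fderivWithin ℝ G s y).flip
    + (-1 : ℝ) • cycleForm (fderivWithin ℝ G s y))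

theorem christoffelLow_apply (G : E → E →L[ℝ] E →L[ℝ] ℝ) (s : Set E) (y u v w : E) :
    christoffelLow G s y u v w = (1 / 2 : ℝ) * (fderivWithin ℝ G s y u v w
      + fderivWithin ℝ G s y v u w - fderivWithin ℝ G s y w u v) := by
  have : christoffelLow G s y u v w = (1 / 2 : ℝ) * (fderivWithin ℝ G s y u v w
      + fderivWithin ℝ G s y v u w + (-1 : ℝ) * fderivWithin ℝ G s y w u v) := rfl
  rw [this]
  ring

/-- Christoffel symbols of the Levi-Civita connection: `G (Γ(u, v), w) = Γ♭(u, v, w)`, so that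
`D_u V = ∂_u V + Γ(u, V)` for a vector field `V` in coordinates. -/
def christoffel (G : E → E →L[ℝ] E →L[ℝ] ℝ) (s : Set E) (y : E) : E →L[ℝ] E →L[ℝ] E :=
  (ContinuousLinearMap.compL ℝ E (E →L[ℝ] ℝ) E (G y).inverse) ∘L christoffelLow G s y

theorem christoffel_apply (G : E → E →L[ℝ] E →L[ℝ] ℝ) (s : Set E) (y u v : E) :
    christoffel G s y u v = (G y).inverse (christoffelLow G s y u v) := rfl

/-- The endomorphism `u ↦ R(u, v) w`, where `R(u, v) w = D_u D_v w - D_v D_u w` for constant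
coordinate fields `u`, `v`, `w`. -/
def curvatureEnd (G : E → E →L[ℝ] E →L[ℝ] ℝ) (s : Set E) (y v w : E) : E →L[ℝ] E :=
  ((fderivWithin ℝ (christoffel G s) s y).flip v).flip w
    - (fderivWithin ℝ (christoffel G s) s y v).flip w
    + (christoffel G s y).flip (christoffel G s y v w)
    - (christoffel G s y v) ∘L (christoffel G s y).flip w

theorem curvatureEnd_apply (G : E → E →L[ℝ] E →L[ℝ] ℝ) (s : Set E) (y u v w : E) :
    curvatureEnd G s y v w u =
      fderivWithin ℝ (christoffel G s) s y u v w - fderivWithin ℝ (christoffel G s) s y v u w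
        + christoffel G s y u (christoffel G s y v w)
        - christoffel G s y v (christoffel G s y u w) := rfl

/-- The Ricci tensor `Ric(v, w) = trace (u ↦ R(u, v) w)`. -/
def coordRicci (G : E → E →L[ℝ] E →L[ℝ] ℝ) (s : Set E) (y v w : E) : ℝ :=
  LinearMap.trace ℝ E (curvatureEnd G s y v w).toLinearMap

/-- The Hessian `∇²f(v, w) = ∂_v ∂_w f - df(Γ(v, w))`. -/
def coordHessian (G : E → E →L[ℝ] E →L[ℝ] ℝ) (s : Set E) (f : E → ℝ) (y v w : E) : ℝ :=
  fderivWithin ℝ (fderivWithin ℝ f s) s y v w - fderivWithin ℝ f s y (christoffel G s y v w)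

/-- The gradient: `G (∇f, w) = df(w)`. -/
def coordGrad (G : E → E →L[ℝ] E →L[ℝ] ℝ) (s : Set E) (f : E → ℝ) (y : E) : E :=
  (G y).inverse (fderivWithin ℝ f s y)

/-- The divergence `div X = trace (u ↦ D_u X)`. -/
def coordDiv (G : E → E →L[ℝ] E →L[ℝ] ℝ) (s : Set E) (X : E → E) (y : E) : ℝ :=
  LinearMap.trace ℝ E
    (fderivWithin ℝ X s y + (christoffel G s y).flip (X y)).toLinearMap

end Coordinates

/-! ### Riemannian manifolds with boundary

Tensors at `x` are computed in the preferred chart at `x`, through which Mathlib identifies the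
tangent space at `x` with the model vector space. -/

section Manifold

variable {E : Type*} [NormedAddCommGroup E] [NormedSpace ℝ E]
  {H : Type*} [TopologicalSpace H] (I : ModelWithCorners ℝ E H)
  {M : Type*} [TopologicalSpace M] [ChartedSpace H M]

variable (M) in
/-- Fields of bilinear forms on the tangent spaces (Riemannian metrics are among them). -/
abbrev BilinField := ∀ x : M, TangentSpace I x →L[ℝ] TangentSpace I x →L[ℝ] ℝ

variable {I}

/-- The pull-back of a bilinear form by a linear map: `(u, v) ↦ B (A u, A v)`. -/
def pullForm {V W : Type*} [AddCommGroup V] [Module ℝ V] [TopologicalSpace V]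
    [IsTopologicalAddGroup V] [ContinuousSMul ℝ V]
    [AddCommGroup W] [Module ℝ W] [TopologicalSpace W]
    [IsTopologicalAddGroup W] [ContinuousSMul ℝ W]
    (B : W →L[ℝ] W →L[ℝ] ℝ) (A : V →L[ℝ] W) : V →L[ℝ] V →L[ℝ] ℝ :=
  (ContinuousLinearMap.precomp ℝ A) ∘L B ∘L A

theorem pullForm_apply {V W : Type*} [AddCommGroup V] [Module ℝ V] [TopologicalSpace V]
    [IsTopologicalAddGroup V] [ContinuousSMul ℝ V]
    [AddCommGroup W] [Module ℝ W] [TopologicalSpace W]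
    [IsTopologicalAddGroup W] [ContinuousSMul ℝ W]
    (B : W →L[ℝ] W →L[ℝ] ℝ) (A : V →L[ℝ] W) (u v : V) :
    pullForm B A u v = B (A u) (A v) := rfl

/-- The coordinate expression of `g` in the chart at `x₀`. -/
def chartForm (g : BilinField I M) (x₀ : M) (y : E) : E →L[ℝ] E →L[ℝ] ℝ :=
  pullForm (V := TangentSpace 𝓘(ℝ, E) y) (g ((extChartAt I x₀).symm y))
    (mfderivWithin 𝓘(ℝ, E) I (extChartAt I x₀).symm (Set.range I) y)

theorem chartForm_apply (g : BilinField I M) (x₀ : M) (y u v : E) :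
    chartForm g x₀ y u v = g ((extChartAt I x₀).symm y)
      (mfderivWithin 𝓘(ℝ, E) I (extChartAt I x₀).symm (Set.range I) y u)
      (mfderivWithin 𝓘(ℝ, E) I (extChartAt I x₀).symm (Set.range I) y v) := rfl

/-- The coordinate expression of a function in the chart at `x₀`. -/
def chartFun (I : ModelWithCorners ℝ E H) (f : M → ℝ) (x₀ : M) (y : E) : ℝ :=
  f ((extChartAt I x₀).symm y)

/-- The Christoffel symbols at `x` in the chart at `x`. -/
def christoffelAt (g : BilinField I M) (x : M) :
    TangentSpace I x →L[ℝ] TangentSpace I x →L[ℝ] TangentSpace I x :=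
  (christoffel (chartForm g x) (Set.range I) (extChartAt I x x) : E →L[ℝ] E →L[ℝ] E)

/-- The Ricci tensor of `g`. -/
def ricci (g : BilinField I M) (x : M) (v w : TangentSpace I x) : ℝ :=
  coordRicci (chartForm g x) (Set.range I) (extChartAt I x x) v w

/-- The Hessian of `f` with respect to `g`. -/
def hessian (g : BilinField I M) (f : M → ℝ) (x : M) (v w : TangentSpace I x) : ℝ :=
  coordHessian (chartForm g x) (Set.range I) (chartFun I f x) (extChartAt I x x) v w

/-- The Bakry-Émery-Ricci tensor `Ric_ψ = Ric - ∇²ψ` for the weight `e^ψ`. -/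
def ricciBE (g : BilinField I M) (ψ : M → ℝ) (x : M) (v w : TangentSpace I x) : ℝ :=
  ricci g x v w - hessian g ψ x v w

/-- The gradient of `f` with respect to `g`. -/
def grad (g : BilinField I M) (f : M → ℝ) (x : M) : TangentSpace I x :=
  (g x).inverse (mfderiv I 𝓘(ℝ, ℝ) f x)

/-- The Laplacian `Δf = div ∇f`. -/
def laplacian (g : BilinField I M) (f : M → ℝ) (x : M) : ℝ :=
  coordDiv (chartForm g x) (Set.range I)
    (coordGrad (chartForm g x) (Set.range I) (chartFun I f x)) (extChartAt I x x)

/-- The drifted Laplacian `Δ_ψ f = Δf + ⟨∇ψ, ∇f⟩`. -/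
def driftedLaplacian (g : BilinField I M) (ψ f : M → ℝ) (x : M) : ℝ :=
  laplacian g f x + g x (grad g ψ x) (grad g f x)

/-- The model `I` has range the half-space `{y | 0 ≤ ℓ y}`, as is the case for manifolds with
(possibly empty) boundary. At a boundary point `x` of such a manifold the boundary is `{ℓ = 0}` in
the chart at `x`, so its tangent space is `{w | ℓ w = 0}` and the vectors with `ℓ w > 0` point
inwards. -/
class HalfSpaceModel (I : ModelWithCorners ℝ E H) where
  /-- the defining linear form -/
  ℓ : E →L[ℝ] ℝ
  range_eq : Set.range I = {y | 0 ≤ ℓ y}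

/-- The linear form `ℓ` on the tangent space at `x`. -/
def bdryForm [h : HalfSpaceModel I] (x : M) : TangentSpace I x →L[ℝ] ℝ := h.ℓ

/-- The inner unit normal along the boundary: `ν = ∇ℓ / |∇ℓ|`. It is `g`-orthogonal to `{ℓ = 0}`,
and `ℓ ν > 0`. -/
def innerNormal [HalfSpaceModel I] (g : BilinField I M) (x : M) : TangentSpace I x :=
  (Real.sqrt (bdryForm x ((g x).inverse (bdryForm x))))⁻¹ • (g x).inverse (bdryForm x)

/-- The second fundamental form of the boundary with respect to the inner unit normal `ν`,
`II(u, w) = ⟨D_u V, ν⟩` for `u`, `w` tangent to the boundary, where `V` is any extension of `w`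
tangent to the boundary. With the extension that is constant in the chart, `D_u V = Γ(u, w)`. -/
def bdrySFF [HalfSpaceModel I] (g : BilinField I M) (x : M) (u w : TangentSpace I x) : ℝ :=
  g x (christoffelAt g x u w) (innerNormal g x)

/-- The boundary is locally convex: `II ≥ 0` with respect to the inner unit normal. -/
def HasLocallyConvexBoundary [HalfSpaceModel I] (g : BilinField I M) : Prop :=
  ∀ x ∈ I.boundary M, ∀ w : TangentSpace I x, bdryForm x w = 0 → 0 ≤ bdrySFF g x w w

/-- Weighted parabolicity: a `C²` function that is bounded from above, `ψ`-subharmonic in the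
interior, and satisfies `∂u/∂ν ≥ 0` along the boundary is constant. -/
def IsWeightedParabolic [HalfSpaceModel I] (g : BilinField I M) (ψ : M → ℝ) : Prop :=
  ∀ u : M → ℝ, ContMDiff I 𝓘(ℝ, ℝ) 2 u → BddAbove (Set.range u) →
    (∀ x ∈ I.interior M, 0 ≤ driftedLaplacian g ψ u x) →
    (∀ x ∈ I.boundary M, (0 : ℝ) ≤ mfderiv I 𝓘(ℝ, ℝ) u x (innerNormal g x)) →
    ∃ a : ℝ, ∀ x, u x = a

end Manifold

/-! ### Hypersurfaces

A hypersurface is a manifold `S` with boundary together with an immersion `F : S → W`; an embedded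
hypersurface is the case where `F` is the inclusion of a subset. -/

section Hypersurface

variable {E : Type*} [NormedAddCommGroup E] [NormedSpace ℝ E]
  {H : Type*} [TopologicalSpace H] {I : ModelWithCorners ℝ E H}
  {S : Type*} [TopologicalSpace S] [ChartedSpace H S]
  {E' : Type*} [NormedAddCommGroup E'] [NormedSpace ℝ E']
  {H' : Type*} [TopologicalSpace H'] {J : ModelWithCorners ℝ E' H'}
  {W : Type*} [TopologicalSpace W] [ChartedSpace H' W]

variable (I J) in
/-- A smooth immersion. -/
def IsSmoothImmersion (F : S → W) : Prop :=
  ContMDiff I J ∞ F ∧ ∀ p, Function.Injective (mfderiv I J F p)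

variable (I) in
/-- The pull-back `F^* g`; for an immersion of `S` this is the induced metric. -/
def pullback (F : S → W) (g : BilinField J W) : BilinField I S :=
  fun p => pullForm (g (F p)) (mfderiv I J F p)

variable (I) in
/-- `N` is a Gauss map: a smooth unit normal field along the hypersurface. -/
structure IsGaussMap [IsManifold J 1 W] (F : S → W) (g : BilinField J W)
    (N : ∀ p, TangentSpace J (F p)) : Prop where
  smooth : ContMDiff I J.tangent ∞ (fun p => (⟨F p, N p⟩ : TangentBundle J W))
  unit : ∀ p, g (F p) (N p) (N p) = 1
  normal : ∀ p (u : TangentSpace I p), g (F p) (N p) (mfderiv I J F p u) = 0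

/-- The coordinate expression, in the chart of `W` at `F p₀`, of a vector field along `F`. -/
def chartField (F : S → W) (X : ∀ p, TangentSpace J (F p)) (p₀ p : S) : E' :=
  mfderiv J 𝓘(ℝ, E') (extChartAt J (F p₀)) (F p) (X p)

/-- `u ↦ A u + Γ(B u, X)`: the covariant derivative in coordinates of a field with value `X` and
coordinate derivative `A` along a map with derivative `B`. -/
def coordCovDeriv (Γ : E' →L[ℝ] E' →L[ℝ] E') (A B : E →L[ℝ] E') (X : E') : E →L[ℝ] E' :=
  A + Γ.flip X ∘L B

variable (I) in
/-- The Levi-Civita covariant derivative `u ↦ D_u X = ∂_u X + Γ(dF u, X)` of a vector field `X`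
along `F`. -/
def covDerivAlong (F : S → W) (g : BilinField J W) (X : ∀ p, TangentSpace J (F p)) (p : S) :
    TangentSpace I p →L[ℝ] TangentSpace J (F p) :=
  coordCovDeriv (E := E) (E' := E') (christoffelAt g (F p))
    (mfderiv I 𝓘(ℝ, E') (chartField F X p) p) (mfderiv I J F p) (X p)

variable (I) in
/-- The second fundamental form of a hypersurface with Gauss map `N`:
`σ(u, w) = - ⟨D_u N, w⟩`. -/
def secondFF (F : S → W) (g : BilinField J W) (N : ∀ p, TangentSpace J (F p)) (p : S)
    (u w : TangentSpace I p) : ℝ :=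
  - g (F p) (covDerivAlong I F g N p u) (mfderiv I J F p w)

variable (I) in
/-- Totally geodesic: the second fundamental form vanishes. -/
def IsTotallyGeodesic (F : S → W) (g : BilinField J W) (N : ∀ p, TangentSpace J (F p)) : Prop :=
  ∀ p (u w : TangentSpace I p), secondFF I F g N p u w = 0

variable (I) in
/-- The divergence `div_Σ X`: the trace over the tangent space of the hypersurface of the
tangential part of `u ↦ D_u X`, i.e. of the endomorphism `A` with `⟨A u, w⟩ = ⟨D_u X, w⟩`. -/
def divAlong (F : S → W) (g : BilinField J W) (X : ∀ p, TangentSpace J (F p)) (p : S) : ℝ :=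
  LinearMap.trace ℝ (TangentSpace I p)
    ((pullback I F g p).inverse ∘L (ContinuousLinearMap.precomp ℝ (mfderiv I J F p))
      ∘L g (F p) ∘L covDerivAlong I F g X p).toLinearMap

variable (I) in
/-- The `ψ`-mean curvature `H_ψ = - div_{Σ,ψ} N = - (div_Σ N + ⟨∇ψ, N⟩)`. -/
def weightedMeanCurvature (F : S → W) (g : BilinField J W) (ψ : W → ℝ)
    (N : ∀ p, TangentSpace J (F p)) (p : S) : ℝ :=
  - (divAlong I F g N p + g (F p) (grad g ψ (F p)) (N p))

variable (I) in
/-- Free boundary: if `∂S` is not empty, then `∂S` is the set of points of `S` on `∂W`, and along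
`∂S` the hypersurface is orthogonal to `∂W`, i.e. the normal of `∂W` is tangent to it. -/
def HasFreeBoundary [HalfSpaceModel J] (F : S → W) (g : BilinField J W) : Prop :=
  (I.boundary S).Nonempty →
    I.boundary S = F ⁻¹' J.boundary W ∧
    ∀ p ∈ I.boundary S, ∃ u : TangentSpace I p, mfderiv I J F p u = innerNormal g (F p)

end Hypersurface

/-! ### Riemannian cylinders `M × ℝ` -/

section Cylinder

instance halfSpaceModelEuclidean (n : ℕ) [NeZero n] : HalfSpaceModel (𝓡∂ n) where
  ℓ := EuclideanSpace.proj 0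
  range_eq := range_modelWithCornersEuclideanHalfSpace n

instance halfSpaceModelProd {E : Type*} [NormedAddCommGroup E] [NormedSpace ℝ E]
    {H : Type*} [TopologicalSpace H] (I : ModelWithCorners ℝ E H) [h : HalfSpaceModel I] :
    HalfSpaceModel (I.prod 𝓘(ℝ, ℝ)) where
  ℓ := h.ℓ ∘L ContinuousLinearMap.fst ℝ E ℝ
  range_eq := by
    rw [ModelWithCorners.range_prod, h.range_eq]
    ext y
    simp

variable {E : Type*} [NormedAddCommGroup E] [NormedSpace ℝ E]
  {H : Type*} [TopologicalSpace H] {I : ModelWithCorners ℝ E H}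
  {M : Type*} [TopologicalSpace M] [ChartedSpace H M]

/-- The standard metric of the real line. -/
def lineMetric : BilinField 𝓘(ℝ, ℝ) ℝ := (riemannianMetricVectorSpace ℝ).inner

/-- The Riemannian product metric on `M × ℝ`. -/
def cylMetric (g : BilinField I M) : BilinField (I.prod 𝓘(ℝ, ℝ)) (M × ℝ) :=
  fun x => pullback (I.prod 𝓘(ℝ, ℝ)) Prod.fst g x
    + pullback (I.prod 𝓘(ℝ, ℝ)) Prod.snd lineMetric x

variable (I) in
/-- The vertical field `ξ = (0, 1)` on `M × ℝ`. -/
def vertical (x : M × ℝ) : TangentSpace (I.prod 𝓘(ℝ, ℝ)) x := ((0, 1) : E × ℝ)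

/-- The exponent of the product weight `e^{h(p)} e^{v(t)}`. -/
def prodWeight (h : M → ℝ) (v : ℝ → ℝ) (x : M × ℝ) : ℝ := h x.1 + v x.2

/-- The angle function `θ = ⟨ξ, N⟩`. -/
def angle {S : Type*} (g : BilinField I M) (F : S → M × ℝ)
    (N : ∀ p, TangentSpace (I.prod 𝓘(ℝ, ℝ)) (F p)) (p : S) : ℝ :=
  cylMetric g (F p) (vertical I (F p)) (N p)

end Cylinder

end WeightedGeom

end

open WeightedGeom

section

open Filter Set

set_option maxSynthPendingDepth 3

noncomputable section

/-! The angle function θ = ⟨ξ, N⟩ is ψ-subharmonic and satisfies ∂θ/∂ν ≥ 0. Being bounded above by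
0, it is constant by parabolicity, and the three alternatives are the equality case of the two
inequalities.

Interior. Let S be the shape operator and T = ξ − θN the tangential part of ξ. As ξ is parallel,
dθ(u) = ⟨ξ, D_u N⟩, so ∇θ = −S T (`coordGrad_angle`), and ∇_u T = θ S u (`tangProj_parallel`). In
the divergence of −S T, the Codazzi equation (`codazzi`) trades (∇_u S)T for (∇_T S)u plus a
curvature term, and since R(·, ξ) = 0 that term has trace −θ Ric(N, N). Hence Δθ = −T(tr S) −
θ(Ric(N, N) + tr S²) (`coordDiv_grad_angle`). Differentiating tr S − dψ(N) = H_ψ = const along T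
replaces T(tr S) by Hessians of ψ and a first-order term that the drift cancels: Δ_ψ θ = −θ(Ric_ψ(N,
N) + tr S²) − ∇²ψ(ξ, N). For the product weight, with N' the horizontal part of N and |N'|² = 1 −
θ², this is Δ_ψ θ = −θ(Ric_h(N', N') + (1 − θ²) v'' + tr S²). From Ric_h ≥ c and v'' ≥ −c the
bracket is at least (1 − θ²)(c + v'') + tr S² ≥ 0, and −θ ≥ 0.

Boundary. By symmetry of S, ⟨ξ, D_ν N⟩ = ⟨ν, D_T N⟩ with T tangent to the boundary, which yields
∂θ/∂ν = −θ II(N, N) ≥ 0 by convexity (`HasFreeBoundary.mfderiv_angle`).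

Equality. If θ = a ≠ 0, the bracket and II(N, N) vanish. So S = 0, Ric_h(N', N') = c(1 − θ²) and (1
− θ²)(c + v'') = 0. Either a² = 1, N is vertical and the height is constant, or v'' = −c along the
hypersurface and both Ricci identities follow.

The local computations are made once, for a map φ between regions of vector spaces that may be
half-spaces, with all derivatives taken within the region; the formulas therefore hold at boundary
points too. Tensors on the manifolds are defined at each q in the chart at q, whereas
differentiating H_ψ at p needs its values near p in one fixed pair of charts. The change of charts
is `covDerivAlong_eq`, which rests on the transformation rule of the Christoffel symbols. -/

namespace WeightedGeom

/-! ### Linear algebra of inner products. -/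

section Forms

variable {E : Type*} [NormedAddCommGroup E] [NormedSpace ℝ E]
  {E' : Type*} [NormedAddCommGroup E'] [NormedSpace ℝ E']

/-- A symmetric positive definite bilinear form. -/
structure IsInnerForm (B : E →L[ℝ] E →L[ℝ] ℝ) : Prop where
  symm : ∀ u v, B u v = B v u
  pos : ∀ u, u ≠ 0 → 0 < B u u

theorem IsInnerForm.eq_zero {B : E →L[ℝ] E →L[ℝ] ℝ} (h : IsInnerForm B) {u : E}
    (hu : B u u = 0) : u = 0 := by
  by_contra h0
  exact (h.pos u h0).ne' hu

theorem IsInnerForm.nonneg {B : E →L[ℝ] E →L[ℝ] ℝ} (h : IsInnerForm B) (u : E) : 0 ≤ B u u := by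
  by_cases hu : u = 0
  · simp [hu]
  · exact (h.pos u hu).le

theorem IsInnerForm.ext {B : E →L[ℝ] E →L[ℝ] ℝ} (h : IsInnerForm B) {u v : E}
    (huv : ∀ w, B u w = B v w) : u = v := by
  rw [← sub_eq_zero]
  apply h.eq_zero
  rw [map_sub B u v, sub_apply, huv, sub_self]

/-- Gradients, Christoffel symbols and divergences are defined through
`ContinuousLinearMap.inverse`, which takes the value 0 on maps that are not invertible. Definiteness
excludes this default. -/
theorem IsInnerForm.isInvertible [FiniteDimensional ℝ E] {B : E →L[ℝ] E →L[ℝ] ℝ}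
    (h : IsInnerForm B) : B.IsInvertible := by
  have hinj : Function.Injective (B : E →ₗ[ℝ] (E →L[ℝ] ℝ)) := by
    intro u v huv
    exact h.ext fun w => congrArg (fun f : E →L[ℝ] ℝ => f w) huv
  have e : (E →L[ℝ] ℝ) ≃ₗ[ℝ] Module.Dual ℝ E := LinearMap.toContinuousLinearMap.symm
  have : FiniteDimensional ℝ (E →L[ℝ] ℝ) := e.symm.finiteDimensional
  have hd : Module.finrank ℝ E = Module.finrank ℝ (E →L[ℝ] ℝ) := by
    rw [e.finrank_eq, Subspace.dual_finrank_eq]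
  refine ⟨(LinearEquiv.ofInjectiveOfFinrankEq (B : E →ₗ[ℝ] (E →L[ℝ] ℝ)) hinj
    hd).toContinuousLinearEquiv, ?_⟩
  ext u w
  rfl

theorem IsInnerForm.apply_inverse [FiniteDimensional ℝ E] {B : E →L[ℝ] E →L[ℝ] ℝ}
    (h : IsInnerForm B) (f : E →L[ℝ] ℝ) (w : E) : B (B.inverse f) w = f w := by
  rw [h.isInvertible.self_apply_inverse]

theorem IsInnerForm.pullForm {B : E' →L[ℝ] E' →L[ℝ] ℝ} (h : IsInnerForm B) {A : E →L[ℝ] E'}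
    (hA : Function.Injective A) : IsInnerForm (pullForm B A) where
  symm _ _ := h.symm _ _
  pos u hu := h.pos _ fun h0 => hu (hA ((show A u = 0 from h0).trans (map_zero A).symm))

end Forms

/-! ### The Levi-Civita connection of a metric in coordinates. -/

section Christoffel

variable {E : Type*} [NormedAddCommGroup E] [NormedSpace ℝ E]
  {E' : Type*} [NormedAddCommGroup E'] [NormedSpace ℝ E']

/-- A set on which derivatives are well defined and second derivatives are symmetric. -/
structure IsRegion (s : Set E) : Prop where
  uniqueDiffOn : UniqueDiffOn ℝ s
  subset : s ⊆ closure (interior s)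

/-- At a boundary point symmetry is inherited from the interior of `s`, which accumulates there;
this is why a region is required to lie in the closure of its interior. -/
theorem IsRegion.second_symm {s : Set E} (hs : IsRegion s) {y : E} (hy : y ∈ s) {f : E → E'}
    (hf : ContDiffWithinAt ℝ 2 f s y) (u v : E) :
    fderivWithin ℝ (fderivWithin ℝ f s) s y u v = fderivWithin ℝ (fderivWithin ℝ f s) s y v u :=
  hf.isSymmSndFDerivWithinAt (by simp) hs.uniqueDiffOn (hs.subset hy) hy u v

/-- A `C²` Riemannian metric near a point of a region. -/
structure IsLocalMetric (G : E → E →L[ℝ] E →L[ℝ] ℝ) (s : Set E) (y : E) : Prop where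
  mem : y ∈ s
  contDiff : ContDiffWithinAt ℝ 2 G s y
  inner : ∀ᶠ z in 𝓝[s] y, IsInnerForm (G z)

theorem IsLocalMetric.innerForm {G : E → E →L[ℝ] E →L[ℝ] ℝ} {s : Set E} {y : E}
    (h : IsLocalMetric G s y) : IsInnerForm (G y) := h.inner.self_of_nhdsWithin h.mem

theorem IsLocalMetric.eventually {G : E → E →L[ℝ] E →L[ℝ] ℝ} {s : Set E} {y : E}
    (h : IsLocalMetric G s y) : ∀ᶠ z in 𝓝[s] y, IsLocalMetric G s z := by
  have h1 := h.contDiff.eventually (by simp)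
  rw [insert_eq_of_mem h.mem] at h1
  filter_upwards [h1, eventually_eventually_nhdsWithin.2 h.inner, self_mem_nhdsWithin]
    with z h1 h2 h3 using ⟨h3, h1, h2⟩

variable {G : E → E →L[ℝ] E →L[ℝ] ℝ} {s : Set E} {y : E}

theorem HasFDerivWithinAt.clm_apply₂ {D : Type*} [NormedAddCommGroup D] [NormedSpace ℝ D]
    {F₁ F₂ F₃ : Type*} [NormedAddCommGroup F₁]
    [NormedSpace ℝ F₁] [NormedAddCommGroup F₂] [NormedSpace ℝ F₂] [NormedAddCommGroup F₃]
    [NormedSpace ℝ F₃] {b : D → F₁ →L[ℝ] F₂ →L[ℝ] F₃} {f : D → F₁} {g : D → F₂}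
    {b' : D →L[ℝ] F₁ →L[ℝ] F₂ →L[ℝ] F₃} {f' : D →L[ℝ] F₁} {g' : D →L[ℝ] F₂} {s : Set D} {y : D}
    (hb : HasFDerivWithinAt b b' s y) (hf : HasFDerivWithinAt f f' s y)
    (hg : HasFDerivWithinAt g g' s y) :
    HasFDerivWithinAt (fun z => b z (f z) (g z))
      (((b y (f y)).comp g') + ((b y).comp f' + b'.flip (f y)).flip (g y)) s y :=
  (hb.clm_apply hf).clm_apply hg

theorem IsLocalMetric.differentiable (h : IsLocalMetric G s y) :
    DifferentiableWithinAt ℝ G s y := h.contDiff.differentiableWithinAt (by simp)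

theorem IsLocalMetric.fderiv_symm (h : IsLocalMetric G s y) (hs : IsRegion s) (w u v : E) :
    fderivWithin ℝ G s y w u v = fderivWithin ℝ G s y w v u := by
  have hG := h.differentiable.hasFDerivWithinAt
  have h1 := HasFDerivWithinAt.clm_apply₂ hG (hasFDerivWithinAt_const u y s)
    (hasFDerivWithinAt_const v y s)
  have h2 := HasFDerivWithinAt.clm_apply₂ hG (hasFDerivWithinAt_const v y s)
    (hasFDerivWithinAt_const u y s)
  have h3 := h1.congr_of_eventuallyEq (f₁ := fun z => G z v u)
    (h.inner.mono fun z hz => hz.symm v u) (h.innerForm.symm v u)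
  have := congrArg (fun f => f w) ((hs.uniqueDiffOn y h.mem).eq h3 h2)
  simpa using this

theorem IsLocalMetric.christoffel_apply [FiniteDimensional ℝ E] (h : IsLocalMetric G s y)
    (u v w : E) : G y (christoffel G s y u v) w = christoffelLow G s y u v w := by
  rw [WeightedGeom.christoffel_apply, h.innerForm.apply_inverse]

theorem IsLocalMetric.christoffel_symm [FiniteDimensional ℝ E] (h : IsLocalMetric G s y)
    (hs : IsRegion s) (u v : E) : christoffel G s y u v = christoffel G s y v u := by
  apply h.innerForm.ext
  intro w
  rw [h.christoffel_apply, h.christoffel_apply, christoffelLow_apply, christoffelLow_apply,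
    h.fderiv_symm hs w u v]
  ring

/-- Metric compatibility: in the sum of the two Christoffel symbols of the first kind every
derivative of `G` but the one along `w` cancels. This is what turns coordinate derivatives of inner
products into covariant ones below. -/
theorem IsLocalMetric.compat [FiniteDimensional ℝ E] (h : IsLocalMetric G s y)
    (hs : IsRegion s) (w u v : E) : fderivWithin ℝ G s y w u v
      = G y (christoffel G s y w u) v + G y u (christoffel G s y w v) := by
  rw [h.innerForm.symm u, h.christoffel_apply, h.christoffel_apply, christoffelLow_apply,
    christoffelLow_apply, h.fderiv_symm hs w v u]
  ring

theorem IsLocalMetric.contDiff_inverse [FiniteDimensional ℝ E] (h : IsLocalMetric G s y) :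
    ContDiffWithinAt ℝ 2 (fun z => (G z).inverse) s y :=
  haveI := FiniteDimensional.complete ℝ E
  (h.innerForm.isInvertible.contDiffAt_map_inverse).comp_contDiffWithinAt y h.contDiff

theorem IsLocalMetric.contDiff_christoffelLow (h : IsLocalMetric G s y) (hs : IsRegion s) :
    ContDiffWithinAt ℝ 1 (christoffelLow G s) s y := by
  have hd : ContDiffWithinAt ℝ 1 (fderivWithin ℝ G s) s y :=
    h.contDiff.fderivWithin_right hs.uniqueDiffOn (by norm_num) h.mem
  have hflip : ContDiffWithinAt ℝ 1 (fun z => (fderivWithin ℝ G s z).flip) s y :=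
    (ContinuousLinearMap.flipₗᵢ ℝ E E (E →L[ℝ] ℝ)).toContinuousLinearEquiv.contDiff.contDiffAt
      |>.comp_contDiffWithinAt y hd
  unfold christoffelLow cycleForm
  exact ((hd.add hflip).add
    ((contDiffWithinAt_const.clm_comp hflip).const_smul (-1 : ℝ))).const_smul (1 / 2 : ℝ)

theorem IsLocalMetric.contDiff_christoffel [FiniteDimensional ℝ E] (h : IsLocalMetric G s y)
    (hs : IsRegion s) : ContDiffWithinAt ℝ 1 (christoffel G s) s y := by
  unfold christoffel
  have h1 : ContDiffWithinAt ℝ 1 (fun z => ContinuousLinearMap.compL ℝ E (E →L[ℝ] ℝ) E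
      (G z).inverse) s y :=
    (ContinuousLinearMap.compL ℝ E (E →L[ℝ] ℝ) E).contDiff.contDiffAt.comp_contDiffWithinAt y
      (h.contDiff_inverse.of_le (by norm_num))
  exact h1.clm_comp (h.contDiff_christoffelLow hs)

theorem christoffel_congr {G₁ G₂ : E → E →L[ℝ] E →L[ℝ] ℝ} (h : G₁ =ᶠ[𝓝[s] y] G₂) (hy : y ∈ s) :
    christoffel G₁ s y = christoffel G₂ s y := by
  have h0 := h.self_of_nhdsWithin hy
  unfold christoffel christoffelLow
  rw [h0, h.fderivWithin_eq h0]

end Christoffel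

/-! ### Induced metrics and their Christoffel symbols. -/

section Pullback

variable {E : Type*} [NormedAddCommGroup E] [NormedSpace ℝ E]
  {E' : Type*} [NormedAddCommGroup E'] [NormedSpace ℝ E']

/-- The metric induced by a map between regions. -/
def inducedForm (G' : E' → E' →L[ℝ] E' →L[ℝ] ℝ) (φ : E → E') (s : Set E) (y : E) :
    E →L[ℝ] E →L[ℝ] ℝ :=
  pullForm (G' (φ y)) (fderivWithin ℝ φ s y)

variable {G' : E' → E' →L[ℝ] E' →L[ℝ] ℝ} {φ : E → E'} {s : Set E} {s' : Set E'} {y : E}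

theorem inducedForm_apply (u v : E) : inducedForm G' φ s y u v
    = G' (φ y) (fderivWithin ℝ φ s y u) (fderivWithin ℝ φ s y v) := rfl

/-- A map between regions that is `C³` near a point. -/
structure IsLocalMap (φ : E → E') (s : Set E) (s' : Set E') (y : E) : Prop where
  mem : y ∈ s
  contDiff : ContDiffWithinAt ℝ 3 φ s y
  maps : ∀ᶠ z in 𝓝[s] y, φ z ∈ s'

theorem IsLocalMap.eventually (h : IsLocalMap φ s s' y) :
    ∀ᶠ z in 𝓝[s] y, IsLocalMap φ s s' z := by
  have h1 := h.contDiff.eventually (by simp)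
  rw [insert_eq_of_mem h.mem] at h1
  filter_upwards [h1, eventually_eventually_nhdsWithin.2 h.maps, self_mem_nhdsWithin]
    with z h1 h2 h3 using ⟨h3, h1, h2⟩

theorem IsLocalMap.map_mem (h : IsLocalMap φ s s' y) : φ y ∈ s' :=
  h.maps.self_of_nhdsWithin h.mem

theorem IsLocalMap.tendsto (h : IsLocalMap φ s s' y) : Tendsto φ (𝓝[s] y) (𝓝[s'] (φ y)) :=
  tendsto_nhdsWithin_iff.2 ⟨h.contDiff.continuousWithinAt, h.maps⟩

theorem IsLocalMap.hasFDeriv (h : IsLocalMap φ s s' y) :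
    HasFDerivWithinAt φ (fderivWithin ℝ φ s y) s y :=
  (h.contDiff.differentiableWithinAt (by simp)).hasFDerivWithinAt

theorem IsLocalMap.contDiff_fderiv (h : IsLocalMap φ s s' y) (hs : IsRegion s) :
    ContDiffWithinAt ℝ 2 (fderivWithin ℝ φ s) s y :=
  h.contDiff.fderivWithin_right hs.uniqueDiffOn (by norm_num) h.mem

theorem IsLocalMap.hasFDeriv_fderiv (h : IsLocalMap φ s s' y) (hs : IsRegion s) :
    HasFDerivWithinAt (fderivWithin ℝ φ s) (fderivWithin ℝ (fderivWithin ℝ φ s) s y) s y :=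
  ((h.contDiff_fderiv hs).differentiableWithinAt (by simp)).hasFDerivWithinAt

theorem IsLocalMap.comp_contDiff {F : Type*} [NormedAddCommGroup F] [NormedSpace ℝ F]
    (h : IsLocalMap φ s s' y) {f : E' → F} {n : ℕ∞ω} (hn : n ≤ 3)
    (hf : ContDiffWithinAt ℝ n f s' (φ y)) : ContDiffWithinAt ℝ n (fun z => f (φ z)) s y :=
  hf.comp_of_preimage_mem_nhdsWithin y (h.contDiff.of_le hn) h.maps

theorem IsLocalMap.comp_hasFDeriv {F : Type*} [NormedAddCommGroup F] [NormedSpace ℝ F]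
    (h : IsLocalMap φ s s' y) {f : E' → F} (hf : DifferentiableWithinAt ℝ f s' (φ y)) :
    HasFDerivWithinAt (fun z => f (φ z))
      ((fderivWithin ℝ f s' (φ y)).comp (fderivWithin ℝ φ s y)) s y :=
  hf.hasFDerivWithinAt.comp_of_tendsto y h.hasFDeriv h.tendsto

theorem contDiffWithinAt_inducedForm [FiniteDimensional ℝ E] (hs : IsRegion s)
    (hφ : IsLocalMap φ s s' y) (hG : IsLocalMetric G' s' (φ y)) :
    ContDiffWithinAt ℝ 2 (inducedForm G' φ s) s y := by
  have h1 := hφ.comp_contDiff (by norm_num) hG.contDiff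
  have h2 := hφ.contDiff_fderiv hs
  have h3 : ContDiffWithinAt ℝ 2
      (fun z => ContinuousLinearMap.precomp ℝ (fderivWithin ℝ φ s z)) s y :=
    (((ContinuousLinearMap.compL ℝ E E' ℝ).flip).contDiff.contDiffAt.comp_contDiffWithinAt y h2)
  exact h3.clm_comp (h1.clm_comp h2)

theorem isLocalMetric_inducedForm [FiniteDimensional ℝ E] (hs : IsRegion s)
    (hφ : IsLocalMap φ s s' y) (hG : IsLocalMetric G' s' (φ y))
    (hinj : ∀ᶠ z in 𝓝[s] y, Function.Injective (fderivWithin ℝ φ s z)) :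
    IsLocalMetric (inducedForm G' φ s) s y where
  mem := hφ.mem
  contDiff := contDiffWithinAt_inducedForm hs hφ hG
  inner := by
    filter_upwards [hφ.tendsto.eventually hG.inner, hinj] with z h1 h2 using h1.pullForm h2

/-- The Christoffel symbols of an induced metric (Gauss formula; for a diffeomorphism, the
transformation rule under a change of coordinates). -/
theorem christoffelLow_inducedForm [FiniteDimensional ℝ E] [FiniteDimensional ℝ E']
    (hs : IsRegion s)
    (hφ : IsLocalMap φ s s' y) (hG : IsLocalMetric G' s' (φ y)) (u v w : E) :
    christoffelLow (inducedForm G' φ s) s y u v w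
      = G' (φ y) (fderivWithin ℝ (fderivWithin ℝ φ s) s y u v
        + christoffel G' s' (φ y) (fderivWithin ℝ φ s y u) (fderivWithin ℝ φ s y v))
        (fderivWithin ℝ φ s y w) := by
  set B := fderivWithin ℝ φ s y with hB
  set B' := fderivWithin ℝ (fderivWithin ℝ φ s) s y with hB'
  have hBd := hφ.hasFDeriv_fderiv hs
  have hGd := hφ.comp_hasFDeriv hG.differentiable
  have hd := ((contDiffWithinAt_inducedForm hs hφ hG).differentiableWithinAt
    (by simp)).hasFDerivWithinAt
  -- Product rule for `G' (φ z) (dφ b) (dφ c)`. In the cyclic sum defining the Christoffel symbols,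
  -- the symmetry of d²φ leaves only twice the term with d²φ(u, v).
  have key : ∀ a b c, fderivWithin ℝ (inducedForm G' φ s) s y a b c
      = fderivWithin ℝ G' s' (φ y) (B a) (B b) (B c) + G' (φ y) (B' a b) (B c)
        + G' (φ y) (B b) (B' a c) := by
    intro a b c
    have e1 := HasFDerivWithinAt.clm_apply₂ hd (hasFDerivWithinAt_const b y s)
      (hasFDerivWithinAt_const c y s)
    have e2 := HasFDerivWithinAt.clm_apply₂ hGd
      (hBd.clm_apply (hasFDerivWithinAt_const b y s))
      (hBd.clm_apply (hasFDerivWithinAt_const c y s))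
    have := congrArg (fun f => f a) ((hs.uniqueDiffOn y hφ.mem).eq e1 e2)
    simp [← hB, ← hB'] at this
    rw [this]
    ring
  have sy : ∀ a b, B' a b = B' b a := hs.second_symm hφ.mem (hφ.contDiff.of_le (by norm_num))
  rw [map_add, add_apply, hG.christoffel_apply, christoffelLow_apply,
    christoffelLow_apply, key, key, key, sy w u, sy w v, sy v u,
    hG.innerForm.symm (B v) (B' u w), hG.innerForm.symm (B u) (B' v w)]
  ring

end Pullback

/-! ### Weingarten, Gauss and Codazzi equations of a hypersurface in coordinates. -/

section LocalHypersurface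

variable {E : Type*} [NormedAddCommGroup E] [NormedSpace ℝ E]
  {E' : Type*} [NormedAddCommGroup E'] [NormedSpace ℝ E']

/-- A map `φ` of regions which is an immersion near `y` as a hypersurface, with unit normal field
`n` for the metric `G'` of the target. -/
structure IsLocalHypersurface (G' : E' → E' →L[ℝ] E' →L[ℝ] ℝ) (φ n : E → E') (s : Set E)
    (s' : Set E') (y : E) : Prop where
  region : IsRegion s
  region' : IsRegion s'
  map : IsLocalMap φ s s' y
  metric : IsLocalMetric G' s' (φ y)
  inj : ∀ᶠ z in 𝓝[s] y, Function.Injective (fderivWithin ℝ φ s z)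
  field : ContDiffWithinAt ℝ 2 n s y
  unit : ∀ᶠ z in 𝓝[s] y, G' (φ z) (n z) (n z) = 1
  normal : ∀ᶠ z in 𝓝[s] y, ∀ u, G' (φ z) (n z) (fderivWithin ℝ φ s z u) = 0
  finrank : Module.finrank ℝ E' = Module.finrank ℝ E + 1

/-- The covariant derivative of a field along a map of regions. -/
def covDer (G' : E' → E' →L[ℝ] E' →L[ℝ] ℝ) (φ n : E → E') (s : Set E) (s' : Set E') (z : E) :
    E →L[ℝ] E' :=
  coordCovDeriv (christoffel G' s' (φ z)) (fderivWithin ℝ n s z) (fderivWithin ℝ φ s z) (n z)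

/-- The tangential projection `E' → E` along an immersion of regions. -/
def tangProj (G' : E' → E' →L[ℝ] E' →L[ℝ] ℝ) (φ : E → E') (s : Set E) (z : E) : E' →L[ℝ] E :=
  (inducedForm G' φ s z).inverse ∘L
    (ContinuousLinearMap.precomp ℝ (fderivWithin ℝ φ s z)) ∘L G' (φ z)

/-- The shape operator. -/
def shapeOp (G' : E' → E' →L[ℝ] E' →L[ℝ] ℝ) (φ n : E → E') (s : Set E) (s' : Set E') (z : E) :
    E →L[ℝ] E :=
  -(tangProj G' φ s z ∘L covDer G' φ n s s' z)

variable {G' : E' → E' →L[ℝ] E' →L[ℝ] ℝ} {φ n : E → E'} {s : Set E} {s' : Set E'} {y : E}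

theorem covDer_apply (z u : E) : covDer G' φ n s s' z u = fderivWithin ℝ n s z u
    + christoffel G' s' (φ z) (fderivWithin ℝ φ s z u) (n z) := rfl

namespace IsLocalHypersurface

theorem mem (h : IsLocalHypersurface G' φ n s s' y) : y ∈ s := h.map.mem

/-- Every field of the structure is a condition on germs, hence persists nearby. The equations below
thus hold in a neighbourhood within `s` and may be differentiated again. -/
theorem eventually (h : IsLocalHypersurface G' φ n s s' y) :
    ∀ᶠ z in 𝓝[s] y, IsLocalHypersurface G' φ n s s' z := by
  have h1 := h.field.eventually (by simp)
  rw [insert_eq_of_mem h.mem] at h1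
  filter_upwards [h.map.eventually, h.map.tendsto.eventually h.metric.eventually,
    eventually_eventually_nhdsWithin.2 h.inj, h1, eventually_eventually_nhdsWithin.2 h.unit,
    eventually_eventually_nhdsWithin.2 h.normal] with z a1 a2 a3 a4 a5 a6
  exact ⟨h.region, h.region', a1, a2, a3, a4, a5, a6, h.finrank⟩

theorem unit_self (h : IsLocalHypersurface G' φ n s s' y) : G' (φ y) (n y) (n y) = 1 :=
  h.unit.self_of_nhdsWithin h.mem

theorem normal_self (h : IsLocalHypersurface G' φ n s s' y) (u : E) :
    G' (φ y) (n y) (fderivWithin ℝ φ s y u) = 0 :=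
  h.normal.self_of_nhdsWithin h.mem u

theorem inj_self (h : IsLocalHypersurface G' φ n s s' y) :
    Function.Injective (fderivWithin ℝ φ s y) := h.inj.self_of_nhdsWithin h.mem

theorem hasFDeriv_field (h : IsLocalHypersurface G' φ n s s' y) :
    HasFDerivWithinAt n (fderivWithin ℝ n s y) s y :=
  (h.field.differentiableWithinAt (by simp)).hasFDerivWithinAt

variable [FiniteDimensional ℝ E]

theorem localMetric (h : IsLocalHypersurface G' φ n s s' y) :
    IsLocalMetric (inducedForm G' φ s) s y :=
  isLocalMetric_inducedForm h.region h.map h.metric h.inj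

theorem tangProj_spec (h : IsLocalHypersurface G' φ n s s' y) (X : E') (w : E) :
    inducedForm G' φ s y (tangProj G' φ s y X) w = G' (φ y) X (fderivWithin ℝ φ s y w) := by
  unfold tangProj
  rw [ContinuousLinearMap.comp_apply, h.localMetric.innerForm.apply_inverse]
  rfl

theorem tangProj_fderiv (h : IsLocalHypersurface G' φ n s s' y) (u : E) :
    tangProj G' φ s y (fderivWithin ℝ φ s y u) = u := by
  apply h.localMetric.innerForm.ext
  intro w
  rw [h.tangProj_spec, inducedForm_apply]

theorem tangProj_normal (h : IsLocalHypersurface G' φ n s s' y) :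
    tangProj G' φ s y (n y) = 0 := by
  apply h.localMetric.innerForm.ext
  intro w
  rw [h.tangProj_spec, h.normal_self]
  simp

/-- The splitting of the target into the tangent space and the normal line. -/
def split (h : IsLocalHypersurface G' φ n s s' y) : (E × ℝ) ≃ₗ[ℝ] E' := by
  have : FiniteDimensional ℝ E' := Module.finite_of_finrank_pos (by rw [h.finrank]; omega)
  exact LinearEquiv.ofInjectiveOfFinrankEq
    ((fderivWithin ℝ φ s y : E →ₗ[ℝ] E').coprod (LinearMap.toSpanSingleton ℝ E' (n y)))
    (by
      rw [← LinearMap.ker_eq_bot, LinearMap.ker_eq_bot']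
      rintro ⟨u, a⟩ hu
      have hu : fderivWithin ℝ φ s y u + a • n y = 0 := by simpa using hu
      have ha : a = 0 := by
        have := congrArg (G' (φ y) (n y)) hu
        simpa [h.normal_self, h.unit_self] using this
      subst ha
      have : fderivWithin ℝ φ s y u = fderivWithin ℝ φ s y 0 := by simpa using hu
      rw [h.inj_self this, Prod.mk_zero_zero])
    (by rw [h.finrank, Module.finrank_prod, Module.finrank_self])

theorem split_apply (h : IsLocalHypersurface G' φ n s s' y) (p : E × ℝ) :
    h.split p = fderivWithin ℝ φ s y p.1 + p.2 • n y := rfl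

theorem decomp (h : IsLocalHypersurface G' φ n s s' y) (X : E') :
    fderivWithin ℝ φ s y (tangProj G' φ s y X) + G' (φ y) X (n y) • n y = X := by
  obtain ⟨⟨u, a⟩, rfl⟩ := h.split.surjective X
  rw [split_apply]
  dsimp only
  have e : G' (φ y) (fderivWithin ℝ φ s y u) (n y) = 0 := by
    rw [h.metric.innerForm.symm, h.normal_self]
  simp [h.tangProj_fderiv, h.tangProj_normal, e, h.unit_self]

/-- The trace of an endomorphism that vanishes on the normal. -/
theorem trace_eq (h : IsLocalHypersurface G' φ n s s' y) (L : E' →ₗ[ℝ] E') (K : E →ₗ[ℝ] E)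
    (hn : L (n y) = 0) (hB : ∀ u, L (fderivWithin ℝ φ s y u) = fderivWithin ℝ φ s y (K u)) :
    LinearMap.trace ℝ E' L = LinearMap.trace ℝ E K := by
  have hL : L = h.split.conj (K.prodMap 0) := by
    ext X
    obtain ⟨p, rfl⟩ := h.split.surjective X
    rw [LinearEquiv.conj_apply_apply, LinearEquiv.symm_apply_apply, split_apply, split_apply,
      map_add, map_smul, hn, hB]
    simp
  rw [hL, LinearMap.trace_conj', LinearMap.trace_prodMap', map_zero, add_zero]

variable [FiniteDimensional ℝ E']

omit [FiniteDimensional ℝ E] in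
-- Derivative of ⟨n, n⟩ = 1.
theorem covDer_normal (h : IsLocalHypersurface G' φ n s s' y) (u : E) :
    G' (φ y) (covDer G' φ n s s' y u) (n y) = 0 := by
  have e := HasFDerivWithinAt.clm_apply₂ (h.map.comp_hasFDeriv h.metric.differentiable)
    h.hasFDeriv_field h.hasFDeriv_field
  have e' := (hasFDerivWithinAt_const (𝕜 := ℝ) (1 : ℝ) y s).congr_of_eventuallyEq h.unit h.unit_self
  have := congrArg (fun f : E →L[ℝ] ℝ => f u) ((h.region.uniqueDiffOn y h.mem).eq e e')
  simp only [add_apply, ContinuousLinearMap.comp_apply, ContinuousLinearMap.flip_apply,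
    zero_apply, h.metric.compat h.region'] at this
  rw [h.metric.innerForm.symm (n y), h.metric.innerForm.symm (n y)] at this
  rw [covDer_apply, map_add, add_apply]
  linarith

/-- Weingarten's equation: as D_u n has no normal component, it is recovered from its tangential
part, which is −S u by definition. -/
theorem covDer_eq (h : IsLocalHypersurface G' φ n s s' y) (u : E) :
    covDer G' φ n s s' y u = - fderivWithin ℝ φ s y (shapeOp G' φ n s s' y u) := by
  have := h.decomp (covDer G' φ n s s' y u)
  rw [h.covDer_normal, zero_smul, add_zero] at this
  rw [← this, shapeOp]
  simp

theorem shapeOp_spec (h : IsLocalHypersurface G' φ n s s' y) (u w : E) :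
    inducedForm G' φ s y (shapeOp G' φ n s s' y u) w
      = - G' (φ y) (covDer G' φ n s s' y u) (fderivWithin ℝ φ s y w) := by
  rw [inducedForm_apply, h.covDer_eq]
  simp

/-- Derivative of ⟨n, dφ w⟩ = 0 along u, with w constant in coordinates. This is the normal part of
Gauss's formula. -/
theorem gauss_aux (h : IsLocalHypersurface G' φ n s s' y) (u w : E) :
    G' (φ y) (fderivWithin ℝ (fderivWithin ℝ φ s) s y u w
        + christoffel G' s' (φ y) (fderivWithin ℝ φ s y u) (fderivWithin ℝ φ s y w)) (n y)
      = inducedForm G' φ s y (shapeOp G' φ n s s' y u) w := by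
  have e := HasFDerivWithinAt.clm_apply₂ (h.map.comp_hasFDeriv h.metric.differentiable)
    h.hasFDeriv_field
    ((h.map.hasFDeriv_fderiv h.region).clm_apply (hasFDerivWithinAt_const w y s))
  have e' := (hasFDerivWithinAt_const (𝕜 := ℝ) (0 : ℝ) y s).congr_of_eventuallyEq
    (h.normal.mono fun z hz => hz w) (h.normal_self w)
  have := congrArg (fun f : E →L[ℝ] ℝ => f u) ((h.region.uniqueDiffOn y h.mem).eq e e')
  simp only [add_apply, ContinuousLinearMap.comp_apply, ContinuousLinearMap.flip_apply,
    zero_apply, h.metric.compat h.region', map_zero, zero_add] at this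
  rw [h.shapeOp_spec, covDer_apply, map_add, map_add, add_apply, add_apply,
    h.metric.innerForm.symm _ (n y), h.metric.innerForm.symm _ (n y)]
  linarith

/-- The normal component is `gauss_aux`; the tangential one is the formula for the Christoffel
symbols of the induced metric. -/
theorem gauss (h : IsLocalHypersurface G' φ n s s' y) (u w : E) :
    fderivWithin ℝ (fderivWithin ℝ φ s) s y u w
        + christoffel G' s' (φ y) (fderivWithin ℝ φ s y u) (fderivWithin ℝ φ s y w)
      = fderivWithin ℝ φ s y (christoffel (inducedForm G' φ s) s y u w)
        + inducedForm G' φ s y (shapeOp G' φ n s s' y u) w • n y := by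
  have h1 := h.decomp (fderivWithin ℝ (fderivWithin ℝ φ s) s y u w
        + christoffel G' s' (φ y) (fderivWithin ℝ φ s y u) (fderivWithin ℝ φ s y w))
  rw [h.gauss_aux] at h1
  rw [← h1]
  congr 2
  apply h.localMetric.innerForm.ext
  intro z
  rw [h.tangProj_spec, ← christoffelLow_inducedForm h.region h.map h.metric,
    h.localMetric.christoffel_apply]

/-- By `gauss_aux`, S is given by the normal part of d²φ + Γ'(dφ, dφ), which is symmetric because
second derivatives are and the connection has no torsion. -/
theorem shapeOp_symm (h : IsLocalHypersurface G' φ n s s' y) (u w : E) :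
    inducedForm G' φ s y (shapeOp G' φ n s s' y u) w
      = inducedForm G' φ s y (shapeOp G' φ n s s' y w) u := by
  rw [← h.gauss_aux, ← h.gauss_aux, h.metric.christoffel_symm h.region',
    h.region.second_symm h.mem (h.map.contDiff.of_le (by norm_num))]

omit [FiniteDimensional ℝ E'] in
theorem contDiff_tangProj (h : IsLocalHypersurface G' φ n s s' y) :
    ContDiffWithinAt ℝ 1 (tangProj G' φ s) s y := by
  have h1 : ContDiffWithinAt ℝ 1
      (fun z => ContinuousLinearMap.precomp ℝ (fderivWithin ℝ φ s z)) s y :=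
    ((ContinuousLinearMap.compL ℝ E E' ℝ).flip).contDiff.contDiffAt.comp_contDiffWithinAt y
      ((h.map.contDiff_fderiv h.region).of_le (by norm_num))
  exact (h.localMetric.contDiff_inverse.of_le (by norm_num)).clm_comp
    (h1.clm_comp ((h.map.comp_contDiff (by norm_num) h.metric.contDiff).of_le (by norm_num)))

omit [FiniteDimensional ℝ E] in
theorem contDiff_christoffel (h : IsLocalHypersurface G' φ n s s' y) :
    ContDiffWithinAt ℝ 1 (fun z => christoffel G' s' (φ z)) s y :=
  h.map.comp_contDiff (by norm_num) (h.metric.contDiff_christoffel h.region')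

omit [FiniteDimensional ℝ E] in
theorem contDiff_covDer (h : IsLocalHypersurface G' φ n s s' y) :
    ContDiffWithinAt ℝ 1 (covDer G' φ n s s') s y := by
  have h1 : ContDiffWithinAt ℝ 1 (fun z => (christoffel G' s' (φ z)).flip) s y :=
    (ContinuousLinearMap.flipₗᵢ ℝ E' E' E').toContinuousLinearEquiv.contDiff.contDiffAt
      |>.comp_contDiffWithinAt y h.contDiff_christoffel
  exact (h.field.fderivWithin_right h.region.uniqueDiffOn (by norm_num) h.mem).add
    ((h1.clm_apply (h.field.of_le (by norm_num))).clm_comp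
      ((h.map.contDiff_fderiv h.region).of_le (by norm_num)))

theorem contDiff_shapeOp (h : IsLocalHypersurface G' φ n s s' y) :
    ContDiffWithinAt ℝ 1 (shapeOp G' φ n s s') s y :=
  (h.contDiff_tangProj.clm_comp h.contDiff_covDer).neg

theorem hasFDeriv_shapeOp (h : IsLocalHypersurface G' φ n s s' y) :
    HasFDerivWithinAt (shapeOp G' φ n s s') (fderivWithin ℝ (shapeOp G' φ n s s') s y) s y :=
  (h.contDiff_shapeOp.differentiableWithinAt (by simp)).hasFDerivWithinAt

/-- The Codazzi equation. -/
theorem codazzi (h : IsLocalHypersurface G' φ n s s' y) (u w : E) :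
    curvatureEnd G' s' (φ y) (fderivWithin ℝ φ s y w) (n y) (fderivWithin ℝ φ s y u)
      = fderivWithin ℝ φ s y (fderivWithin ℝ (shapeOp G' φ n s s') s y w u
        + christoffel (inducedForm G' φ s) s y w (shapeOp G' φ n s s' y u)
        - fderivWithin ℝ (shapeOp G' φ n s s') s y u w
        - christoffel (inducedForm G' φ s) s y u (shapeOp G' φ n s s' y w)) := by
  have hn2 : HasFDerivWithinAt (fderivWithin ℝ n s) (fderivWithin ℝ (fderivWithin ℝ n s) s y) s y :=
    ((h.field.fderivWithin_right h.region.uniqueDiffOn (m := 1) (by norm_num)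
      h.mem).differentiableWithinAt (by simp)).hasFDerivWithinAt
  have hΓ := h.map.comp_hasFDeriv
    ((h.metric.contDiff_christoffel h.region').differentiableWithinAt (by simp))
  have hB := h.map.hasFDeriv_fderiv h.region
  -- Weingarten's equation for D_w n, differentiated along u with w constant. Antisymmetrising in u
  -- and w removes d²n and d²φ(u, w) and leaves the curvature on the left.
  have key : ∀ u w : E, fderivWithin ℝ (fderivWithin ℝ n s) s y u w
      + fderivWithin ℝ (christoffel G' s') s' (φ y) (fderivWithin ℝ φ s y u)
        (fderivWithin ℝ φ s y w) (n y)
      + christoffel G' s' (φ y) (fderivWithin ℝ (fderivWithin ℝ φ s) s y u w) (n y)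
      + christoffel G' s' (φ y) (fderivWithin ℝ φ s y w) (fderivWithin ℝ n s y u)
      = - (fderivWithin ℝ (fderivWithin ℝ φ s) s y u (shapeOp G' φ n s s' y w)
        + fderivWithin ℝ φ s y (fderivWithin ℝ (shapeOp G' φ n s s') s y u w)) := by
    intro u w
    have e1 := (hn2.clm_apply (hasFDerivWithinAt_const w y s)).add
      (HasFDerivWithinAt.clm_apply₂ hΓ (hB.clm_apply (hasFDerivWithinAt_const w y s))
        h.hasFDeriv_field)
    have e2 := (hB.clm_apply (h.hasFDeriv_shapeOp.clm_apply
      (hasFDerivWithinAt_const w y s))).neg.congr_of_eventuallyEq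
      (h.eventually.mono fun z hz => hz.covDer_eq w) (h.covDer_eq w)
    have := congrArg (fun f : E →L[ℝ] E' => f u) ((h.region.uniqueDiffOn y h.mem).eq e1 e2)
    simp only [add_apply, neg_apply, ContinuousLinearMap.comp_apply,
      ContinuousLinearMap.flip_apply, zero_apply, map_zero, zero_add] at this
    rw [neg_add, add_comm (- _), ← neg_add, ← this]
    abel
  -- Gauss's formula at (u, S w) and (w, S u) brings in the induced connection; the normal parts ⟨S
  -- u, S w⟩ and ⟨S w, S u⟩ cancel in the difference.
  have ga := h.gauss u (shapeOp G' φ n s s' y w)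
  have gb := h.gauss w (shapeOp G' φ n s s' y u)
  have hs1 : inducedForm G' φ s y (shapeOp G' φ n s s' y u) (shapeOp G' φ n s s' y w)
    = inducedForm G' φ s y (shapeOp G' φ n s s' y w) (shapeOp G' φ n s s' y u) :=
    h.localMetric.innerForm.symm _ _
  rw [hs1] at ga
  have ca := congrArg (christoffel G' s' (φ y) (fderivWithin ℝ φ s y u)) (h.covDer_eq w)
  have cb := congrArg (christoffel G' s' (φ y) (fderivWithin ℝ φ s y w)) (h.covDer_eq u)
  rw [covDer_apply, map_add, map_neg] at ca cb
  have ku := key u w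
  have kw := key w u
  rw [h.region.second_symm h.mem (h.map.contDiff.of_le (by norm_num)) w u,
    h.region.second_symm h.mem h.field w u] at kw
  rw [curvatureEnd_apply]
  simp only [map_add, map_sub]
  linear_combination (norm := module) ku - kw + ca - cb - ga + gb

end IsLocalHypersurface

end LocalHypersurface

/-! ### The trace of the square of a self-adjoint endomorphism. -/

section TraceSquare

variable {E : Type*} [NormedAddCommGroup E] [NormedSpace ℝ E] [FiniteDimensional ℝ E]

/-- The squared norm of a self-adjoint endomorphism is a sum of squared norms. -/
theorem IsInnerForm.exists_trace_comp_self {G : E →L[ℝ] E →L[ℝ] ℝ} (hG : IsInnerForm G)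
    {S : E →L[ℝ] E} (hS : ∀ u w, G (S u) w = G (S w) u) :
    ∃ b : Module.Basis (Fin (Module.finrank ℝ E)) ℝ E,
      LinearMap.trace ℝ E (S ∘L S).toLinearMap
        = ∑ i, G (S (b i)) (S (b i)) / G (b i) (b i) := by
  let β : LinearMap.BilinForm ℝ E := LinearMap.mk₂ ℝ (fun u v => G u v)
    (fun u v w => by simp) (fun c u v => by simp) (fun u v w => by simp) (fun c u v => by simp)
  have hβ : ∀ u v, β u v = G u v := fun u v => rfl
  -- The basis is orthogonal but not normalised, whence the denominators `G (b i) (b i)`.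
  obtain ⟨b, hb⟩ := LinearMap.BilinForm.exists_orthogonal_basis
    (B := β) ⟨fun u v => hG.symm u v⟩
  refine ⟨b, ?_⟩
  have hpos : ∀ i, G (b i) (b i) ≠ 0 := fun i => (hG.pos _ (b.ne_zero i)).ne'
  have hrepr : ∀ x i, G x (b i) = b.repr x i * G (b i) (b i) := by
    intro x i
    conv_lhs => rw [← b.sum_repr x]
    rw [map_sum, sum_apply, Finset.sum_eq_single i]
    · simp
    · intro j _ hj
      have : β (b j) (b i) = 0 := hb hj
      rw [hβ] at this
      simp [this]
    · simp
  rw [LinearMap.trace_eq_matrix_trace ℝ b, Matrix.trace]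
  refine Finset.sum_congr rfl fun i _ => ?_
  rw [Matrix.diag_apply, LinearMap.toMatrix_apply, eq_div_iff (hpos i), ← hrepr, hS (b i)]
  rfl

theorem IsInnerForm.trace_comp_self_nonneg {G : E →L[ℝ] E →L[ℝ] ℝ} (hG : IsInnerForm G)
    {S : E →L[ℝ] E} (hS : ∀ u w, G (S u) w = G (S w) u) :
    0 ≤ LinearMap.trace ℝ E (S ∘L S).toLinearMap := by
  obtain ⟨b, hb⟩ := hG.exists_trace_comp_self hS
  rw [hb]
  exact Finset.sum_nonneg fun i _ => div_nonneg (hG.nonneg _) (hG.nonneg _)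

theorem IsInnerForm.eq_zero_of_trace_comp_self {G : E →L[ℝ] E →L[ℝ] ℝ} (hG : IsInnerForm G)
    {S : E →L[ℝ] E} (hS : ∀ u w, G (S u) w = G (S w) u)
    (h0 : LinearMap.trace ℝ E (S ∘L S).toLinearMap = 0) : S = 0 := by
  obtain ⟨b, hb⟩ := hG.exists_trace_comp_self hS
  rw [h0] at hb
  have h1 := (Finset.sum_eq_zero_iff_of_nonneg
    fun i _ => div_nonneg (hG.nonneg _) (hG.nonneg _)).1 hb.symm
  apply ContinuousLinearMap.coe_injective
  refine b.ext fun i => ?_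
  have h2 := h1 i (Finset.mem_univ i)
  rw [div_eq_zero_iff, or_iff_left (hG.pos _ (b.ne_zero i)).ne'] at h2
  simpa using hG.eq_zero h2

/-- The trace as a continuous linear form. -/
def traceForm : (E →L[ℝ] E) →L[ℝ] ℝ :=
  LinearMap.toContinuousLinearMap
    (LinearMap.trace ℝ E ∘ₗ ContinuousLinearMap.coeLM ℝ)

theorem traceForm_apply (A : E →L[ℝ] E) : traceForm A = LinearMap.trace ℝ E A.toLinearMap := rfl

theorem traceForm_comp_comm (A B : E →L[ℝ] E) : traceForm (A ∘L B) = traceForm (B ∘L A) :=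
  LinearMap.trace_mul_comm ℝ A.toLinearMap B.toLinearMap

end TraceSquare

/-! ### Gradient and drifted Laplacian of the angle with a parallel field, in coordinates. -/

section Angle

variable {E : Type*} [NormedAddCommGroup E] [NormedSpace ℝ E]
  {E' : Type*} [NormedAddCommGroup E'] [NormedSpace ℝ E']
  {G' : E' → E' →L[ℝ] E' →L[ℝ] ℝ} {φ n : E → E'} {s : Set E} {s' : Set E'} {y : E}

/-- A constant coordinate field is parallel near `x`. -/
def IsParallel (G' : E' → E' →L[ℝ] E' →L[ℝ] ℝ) (s' : Set E') (ξ x : E') : Prop :=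
  ∀ᶠ z in 𝓝[s'] x, ∀ u, christoffel G' s' z u ξ = 0

namespace IsLocalHypersurface

variable [FiniteDimensional ℝ E] [FiniteDimensional ℝ E'] {ξ : E'}

omit [FiniteDimensional ℝ E] in
-- By metric compatibility dθ(u) = ⟨D_u ξ, n⟩ + ⟨ξ, D_u n⟩, and the first term is zero.
theorem hasFDeriv_angle (h : IsLocalHypersurface G' φ n s s' y) (hξ : IsParallel G' s' ξ (φ y)) :
    HasFDerivWithinAt (fun z => G' (φ z) ξ (n z))
      (G' (φ y) ξ ∘L covDer G' φ n s s' y) s y := by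
  have e := HasFDerivWithinAt.clm_apply₂ (h.map.comp_hasFDeriv h.metric.differentiable)
    (hasFDerivWithinAt_const ξ y s) h.hasFDeriv_field
  refine e.congr_fderiv ?_
  ext u
  have hξ := hξ.self_of_nhdsWithin h.map.map_mem
  simp [covDer_apply, h.metric.compat h.region', hξ]

/-- D_u n is tangential, so only the tangential part T of ξ contributes to ⟨ξ, D_u n⟩ = −⟨T, S u⟩ =
−⟨S T, u⟩. -/
theorem coordGrad_angle (h : IsLocalHypersurface G' φ n s s' y) (hξ : IsParallel G' s' ξ (φ y)) :
    coordGrad (inducedForm G' φ s) s (fun z => G' (φ z) ξ (n z)) y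
      = -shapeOp G' φ n s s' y (tangProj G' φ s y ξ) := by
  apply h.localMetric.innerForm.ext
  intro w
  rw [coordGrad, h.localMetric.innerForm.apply_inverse,
    (h.hasFDeriv_angle hξ).fderivWithin (h.region.uniqueDiffOn y h.mem), map_neg,
    neg_apply, h.shapeOp_symm, h.shapeOp_spec, neg_neg, ContinuousLinearMap.comp_apply]
  conv_lhs => rw [← h.decomp ξ]
  rw [map_add, map_smul, add_apply, smul_apply, h.metric.innerForm.symm (n y), h.covDer_normal,
    smul_zero, add_zero, h.metric.innerForm.symm]

/-- The covariant derivative of the tangential part of a parallel field. -/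
theorem tangProj_parallel (h : IsLocalHypersurface G' φ n s s' y)
    (hξ : IsParallel G' s' ξ (φ y)) (u : E) :
    fderivWithin ℝ (tangProj G' φ s) s y u ξ
        + christoffel (inducedForm G' φ s) s y u (tangProj G' φ s y ξ)
      = G' (φ y) ξ (n y) • shapeOp G' φ n s s' y u := by
  have hP : HasFDerivWithinAt (tangProj G' φ s) (fderivWithin ℝ (tangProj G' φ s) s y) s y :=
    (h.contDiff_tangProj.differentiableWithinAt (by simp)).hasFDerivWithinAt
  -- Both sides of dφ T + θ n = ξ are differentiated along u; the right-hand side is constant in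
  -- coordinates.
  have e1 := ((h.map.hasFDeriv_fderiv h.region).clm_apply
    (hP.clm_apply (hasFDerivWithinAt_const ξ y s))).add
      ((h.hasFDeriv_angle hξ).smul h.hasFDeriv_field)
  have e2 := (hasFDerivWithinAt_const (𝕜 := ℝ) ξ y s).congr_of_eventuallyEq
    (h.eventually.mono fun z hz => hz.decomp ξ) (h.decomp ξ)
  have e3 := congrArg (fun f : E →L[ℝ] E' => f u) ((h.region.uniqueDiffOn y h.mem).eq e1 e2)
  simp only [add_apply, ContinuousLinearMap.comp_apply, ContinuousLinearMap.flip_apply,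
    zero_apply, map_zero, zero_add, smul_apply, ContinuousLinearMap.smulRight_apply] at e3
  have e4 := h.gauss u (tangProj G' φ s y ξ)
  have e5 : christoffel G' s' (φ y) (fderivWithin ℝ φ s y u)
      (fderivWithin ℝ φ s y (tangProj G' φ s y ξ))
      = - (G' (φ y) ξ (n y) • christoffel G' s' (φ y) (fderivWithin ℝ φ s y u) (n y)) := by
    have := congrArg (christoffel G' s' (φ y) (fderivWithin ℝ φ s y u)) (h.decomp ξ)
    rw [map_add, map_smul, hξ.self_of_nhdsWithin h.map.map_mem] at this
    exact eq_neg_of_add_eq_zero_left this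
  have e6 := h.covDer_eq u
  rw [covDer_apply] at e6
  -- With the Gauss and Weingarten equations inserted, everything except dφ(∇_u T − θ S u) is a
  -- multiple of n, which the tangential projection kills.
  have e7 := congrArg (tangProj G' φ s y) (show
    fderivWithin ℝ φ s y (fderivWithin ℝ (tangProj G' φ s) s y u ξ
        + christoffel (inducedForm G' φ s) s y u (tangProj G' φ s y ξ)
      - G' (φ y) ξ (n y) • shapeOp G' φ n s s' y u)
      = - (inducedForm G' φ s y (shapeOp G' φ n s s' y u) (tangProj G' φ s y ξ)
        + G' (φ y) ξ (covDer G' φ n s s' y u)) • n y by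
    simp only [map_add, map_sub, map_smul, covDer_apply] at e3 ⊢
    rw [e5] at e4
    linear_combination (norm := module) e3 - e4 - G' (φ y) ξ (n y) • e6)
  rw [h.tangProj_fderiv, map_smul, h.tangProj_normal, smul_zero] at e7
  exact sub_eq_zero.1 e7

/-- The Laplacian of the angle function. -/
theorem coordDiv_grad_angle (h : IsLocalHypersurface G' φ n s s' y)
    (hξ : IsParallel G' s' ξ (φ y))
    (hR : ∀ u w, curvatureEnd G' s' (φ y) ξ w u = 0) :
    coordDiv (inducedForm G' φ s) s
        (coordGrad (inducedForm G' φ s) s (fun z => G' (φ z) ξ (n z))) y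
      = - traceForm (fderivWithin ℝ (shapeOp G' φ n s s') s y (tangProj G' φ s y ξ))
        - G' (φ y) ξ (n y) * (coordRicci G' s' (φ y) (n y) (n y)
          + traceForm (shapeOp G' φ n s s' y ∘L shapeOp G' φ n s s' y)) := by
  set T := tangProj G' φ s y ξ with hT
  set S := shapeOp G' φ n s s' y with hS
  set S' := fderivWithin ℝ (shapeOp G' φ n s s') s y with hS'
  set θ := G' (φ y) ξ (n y) with hθ
  set Γ := christoffel (inducedForm G' φ s) s y with hΓ
  have hP : HasFDerivWithinAt (tangProj G' φ s) (fderivWithin ℝ (tangProj G' φ s) s y) s y :=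
    (h.contDiff_tangProj.differentiableWithinAt (by simp)).hasFDerivWithinAt
  have hev : ∀ᶠ z in 𝓝[s] y, IsParallel G' s' ξ (φ z) :=
    h.map.tendsto.eventually (eventually_eventually_nhdsWithin.2 hξ)
  have hd := (h.hasFDeriv_shapeOp.clm_apply
    (hP.clm_apply (hasFDerivWithinAt_const ξ y s))).neg.congr_of_eventuallyEq
      ((h.eventually.and hev).mono fun z hz => hz.1.coordGrad_angle hz.2) (h.coordGrad_angle hξ)
  -- the endomorphism `u ↦ (R(B u, B T) n)^tan`
  obtain ⟨K, hKdef⟩ : ∃ K : E →L[ℝ] E, K = S' T + Γ T ∘L S - S'.flip T - Γ.flip (S T) := ⟨_, rfl⟩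
  have hK : ∀ u, fderivWithin ℝ φ s y (K u) = - (θ •
      curvatureEnd G' s' (φ y) (n y) (n y) (fderivWithin ℝ φ s y u)) := by
    intro u
    have e1 := h.codazzi u T
    -- The Codazzi equation computes R(dφ u, dφ T) n. Since dφ T = ξ − θ n and ξ is annihilated by
    -- the curvature, this is −θ R(dφ u, n) n.
    have e2 : fderivWithin ℝ φ s y T = ξ - θ • n y := eq_sub_of_add_eq (h.decomp ξ)
    have e3 : curvatureEnd G' s' (φ y) (ξ - θ • n y) (n y) (fderivWithin ℝ φ s y u)
        = curvatureEnd G' s' (φ y) ξ (n y) (fderivWithin ℝ φ s y u)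
          - θ • curvatureEnd G' s' (φ y) (n y) (n y) (fderivWithin ℝ φ s y u) := by
      simp only [curvatureEnd_apply, map_sub, map_smul, sub_apply, smul_apply]
      module
    rw [e2, e3, hR, zero_sub] at e1
    rw [hKdef]
    exact e1.symm
  have htr : traceForm K = - (θ * coordRicci G' s' (φ y) (n y) (n y)) := by
    -- The Ricci tensor is a trace over the ambient space; the normal direction contributes nothing
    -- because R(n, n) = 0.
    have := h.trace_eq (-(θ • (curvatureEnd G' s' (φ y) (n y) (n y)).toLinearMap)) K.toLinearMap
      (by simp [curvatureEnd_apply]) (fun u => (hK u).symm)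
    rw [traceForm_apply, ← this, map_neg, map_smul, smul_eq_mul]
    rfl
  -- ∇(−S T) split into the Codazzi term K, the derivative of S along T, a commutator of trace zero,
  -- and −θ S² coming from ∇T = θ S.
  have hdiv : fderivWithin ℝ (coordGrad (inducedForm G' φ s) s
      (fun z => G' (φ z) ξ (n z))) s y + Γ.flip (coordGrad (inducedForm G' φ s) s
      (fun z => G' (φ z) ξ (n z)) y)
      = K - S' T - (Γ T ∘L S - S ∘L Γ T) - θ • (S ∘L S) := by
    rw [hd.fderivWithin (h.region.uniqueDiffOn y h.mem), h.coordGrad_angle hξ]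
    ext u
    have e1 := congrArg S (h.tangProj_parallel hξ u)
    rw [map_add, map_smul, h.localMetric.christoffel_symm h.region] at e1
    simp only [add_apply, neg_apply, sub_apply, smul_apply, ContinuousLinearMap.comp_apply,
      ContinuousLinearMap.flip_apply, zero_apply, map_zero, zero_add, map_neg, hKdef, ← hT, ← hS,
      ← hS']
    linear_combination (norm := module) -e1
  rw [coordDiv, ← traceForm_apply, hdiv, map_sub, map_sub, map_sub, map_sub, htr, map_smul,
    traceForm_comp_comm (Γ T) S, smul_eq_mul]
  ring

/-- The drifted Laplacian of the angle function of a hypersurface with constant weighted mean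
curvature. -/
theorem coordDiv_grad_angle_add_drift (h : IsLocalHypersurface G' φ n s s' y)
    (hξ : IsParallel G' s' ξ (φ y))
    (hR : ∀ u w, curvatureEnd G' s' (φ y) ξ w u = 0) {ψ : E' → ℝ}
    (hψ : ContDiffWithinAt ℝ 2 ψ s' (φ y)) {a : ℝ}
    (hH : ∀ᶠ z in 𝓝[s] y, traceForm (shapeOp G' φ n s s' z)
      - fderivWithin ℝ ψ s' (φ z) (n z) = a) :
    coordDiv (inducedForm G' φ s) s
        (coordGrad (inducedForm G' φ s) s (fun z => G' (φ z) ξ (n z))) y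
      + fderivWithin ℝ (fun z => ψ (φ z)) s y
        (coordGrad (inducedForm G' φ s) s (fun z => G' (φ z) ξ (n z)) y)
      = - G' (φ y) ξ (n y) * (coordRicci G' s' (φ y) (n y) (n y)
          - coordHessian G' s' ψ (φ y) (n y) (n y)
          + traceForm (shapeOp G' φ n s s' y ∘L shapeOp G' φ n s s' y))
        - coordHessian G' s' ψ (φ y) ξ (n y) := by
  rw [h.coordDiv_grad_angle hξ hR, h.coordGrad_angle hξ]
  set T := tangProj G' φ s y ξ with hT
  have e0 := h.map.comp_hasFDeriv (hψ.differentiableWithinAt (by simp))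
  have hdψ : DifferentiableWithinAt ℝ (fderivWithin ℝ ψ s') s' (φ y) :=
    (hψ.fderivWithin_right h.region'.uniqueDiffOn (m := 1) (by norm_num)
      h.map.map_mem).differentiableWithinAt (by simp)
  -- Constancy of tr S − dψ(n), differentiated along T: T(tr S) = ∇²ψ(dφ T, n) + dψ(D_T n). Here D_T
  -- n = −dφ(S T), so the last term is exactly the drift dψ(dφ ∇θ).
  have e1 := (traceForm.hasFDerivAt.comp_hasFDerivWithinAt y h.hasFDeriv_shapeOp).sub
    ((h.map.comp_hasFDeriv hdψ).clm_apply h.hasFDeriv_field)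
  have e2 := (hasFDerivWithinAt_const (𝕜 := ℝ) a y s).congr_of_eventuallyEq hH
    (hH.self_of_nhdsWithin h.mem)
  have e3 := congrArg (fun f : E →L[ℝ] ℝ => f T) ((h.region.uniqueDiffOn y h.mem).eq e1 e2)
  simp only [add_apply, sub_apply, ContinuousLinearMap.comp_apply, ContinuousLinearMap.flip_apply,
    zero_apply] at e3
  have e4 := congrArg (fderivWithin ℝ ψ s' (φ y)) (h.covDer_eq T)
  rw [covDer_apply, map_add, map_neg] at e4
  have e5 : fderivWithin ℝ φ s y T = ξ - G' (φ y) ξ (n y) • n y := eq_sub_of_add_eq (h.decomp ξ)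
  rw [e5] at e3 e4
  rw [e0.fderivWithin (h.region.uniqueDiffOn y h.mem)]
  simp only [ContinuousLinearMap.comp_apply, map_neg, coordHessian, map_sub, map_smul, sub_apply,
    smul_apply, smul_eq_mul] at e3 e4 ⊢
  linear_combination -e3 - e4

end IsLocalHypersurface

end Angle

/-! ### Coordinate expressions of maps and metrics, and changes of charts. -/

section ChartExpressions

variable {E : Type*} [NormedAddCommGroup E] [NormedSpace ℝ E]
  {H : Type*} [TopologicalSpace H] {I : ModelWithCorners ℝ E H}
  {S : Type*} [TopologicalSpace S] [ChartedSpace H S]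
  {E' : Type*} [NormedAddCommGroup E'] [NormedSpace ℝ E']
  {H' : Type*} [TopologicalSpace H'] {J : ModelWithCorners ℝ E' H'}
  {W : Type*} [TopologicalSpace W] [ChartedSpace H' W]

variable (I) in
theorem isRegion_range : IsRegion (range I) :=
  ⟨I.uniqueDiffOn, I.range_subset_closure_interior⟩

variable (I J) in
/-- The coordinate expression of a map in the charts at `p₀` and `x₁`. -/
def chartMap (F : S → W) (p₀ : S) (x₁ : W) (y : E) : E' :=
  extChartAt J x₁ (F ((extChartAt I p₀).symm y))

theorem chartMap_self (F : S → W) (p : S) (x₁ : W) :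
    chartMap I J F p x₁ (extChartAt I p p) = extChartAt J x₁ (F p) := by
  simp [chartMap]

theorem chartMap_of_mem (F : S → W) {p q : S} (hq : q ∈ (extChartAt I p).source) (x₁ : W) :
    chartMap I J F p x₁ (extChartAt I p q) = extChartAt J x₁ (F q) := by
  simp only [chartMap, (extChartAt I p).left_inv hq]

variable [IsManifold I ∞ S] [IsManifold J ∞ W]

omit [IsManifold I ∞ S] [IsManifold J ∞ W] in
theorem instIsManifoldOne [IsManifold I ∞ S] : IsManifold I 1 S := .of_le (n := ∞) (by simp)

variable (I) in
/-- The derivative at `x` of the chart at `x₁`. -/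
def chartDeriv (x₁ x : S) : TangentSpace I x →L[ℝ] E :=
  mfderiv I 𝓘(ℝ, E) (extChartAt I x₁) x

variable (I) in
/-- The derivative at `y` of the inverse of the chart at `x₁`. -/
def chartDerivSymm (x₁ : S) (y : E) : E →L[ℝ] TangentSpace I ((extChartAt I x₁).symm y) :=
  mfderivWithin 𝓘(ℝ, E) I (extChartAt I x₁).symm (range I) y

omit [IsManifold I ∞ S] in
theorem chartForm_eq (g : BilinField I S) (x₁ : S) (y u v : E) : chartForm g x₁ y u v
    = g ((extChartAt I x₁).symm y) (chartDerivSymm I x₁ y u) (chartDerivSymm I x₁ y v) := rfl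

theorem chartDeriv_symm {x₁ : S} {y : E} (hy : y ∈ (extChartAt I x₁).target) (u : E) :
    chartDeriv I x₁ ((extChartAt I x₁).symm y) (chartDerivSymm I x₁ y u) = u := by
  have : IsManifold I 1 S := instIsManifoldOne
  exact congrArg (fun f : E →L[ℝ] E => f u)
    (mfderiv_extChartAt_comp_mfderivWithin_extChartAt_symm (I := I) hy)

theorem chartDerivSymm_chartDeriv {x₁ : S} {y : E} (hy : y ∈ (extChartAt I x₁).target)
    (a : TangentSpace I ((extChartAt I x₁).symm y)) :
    chartDerivSymm I x₁ y (chartDeriv I x₁ ((extChartAt I x₁).symm y) a) = a := by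
  have : IsManifold I 1 S := instIsManifoldOne
  exact congrArg (fun f : TangentSpace I ((extChartAt I x₁).symm y) →L[ℝ]
    TangentSpace I ((extChartAt I x₁).symm y) => f a)
    (mfderivWithin_extChartAt_symm_comp_mfderiv_extChartAt (I := I) hy)

theorem chartDeriv_self (x : S) (a : TangentSpace I x) : chartDeriv I x x a = a := by
  have : IsManifold I 1 S := instIsManifoldOne
  exact congrArg (fun f : E →L[ℝ] E => f a) (mfderiv_extChartAt_self (I := I))

theorem chartDeriv_injective {x₁ x : S} (hx : x ∈ (extChartAt I x₁).source) :
    Function.Injective (chartDeriv I x₁ x) := by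
  have : IsManifold I 1 S := instIsManifoldOne
  exact (isInvertible_mfderiv_extChartAt hx).injective

theorem chartDeriv_surjective {x₁ x : S} (hx : x ∈ (extChartAt I x₁).source) :
    Function.Surjective (chartDeriv I x₁ x) := by
  have : IsManifold I 1 S := instIsManifoldOne
  exact (isInvertible_mfderiv_extChartAt hx).surjective

theorem fderivWithin_chartMap {F : S → W} {p₀ : S} {x₁ : W} {z : E}
    (hz : z ∈ (extChartAt I p₀).target)
    (hF : MDifferentiableAt I J F ((extChartAt I p₀).symm z))
    (hx : F ((extChartAt I p₀).symm z) ∈ (extChartAt J x₁).source) (u : E) :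
    fderivWithin ℝ (chartMap I J F p₀ x₁) (range I) z u
      = chartDeriv J x₁ (F ((extChartAt I p₀).symm z))
        (mfderiv I J F ((extChartAt I p₀).symm z) (chartDerivSymm I p₀ z u)) := by
  have : IsManifold I 1 S := instIsManifoldOne
  have : IsManifold J 1 W := instIsManifoldOne
  have hzr : z ∈ range I := extChartAt_target_subset_range p₀ hz
  have hu : UniqueMDiffWithinAt 𝓘(ℝ, E) (range I) z := I.uniqueMDiffOn z hzr
  have h1 := mdifferentiableWithinAt_extChartAt_symm hz
  rw [extChartAt_source] at hx
  have h2 := mdifferentiableAt_extChartAt (I := J) hx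
  have e : chartMap I J F p₀ x₁ = (extChartAt J x₁ ∘ F) ∘ (extChartAt I p₀).symm := rfl
  rw [← mfderivWithin_eq_fderivWithin, e, mfderiv_comp_mfderivWithin z (h2.comp _ hF) h1 hu,
    mfderiv_comp _ h2 hF]
  rfl

omit [IsManifold I ∞ S] [IsManifold J ∞ W] in
theorem eventually_mem_source {F : S → W} {p₀ : S} {x₁ : W} {z : E}
    (hz : z ∈ (extChartAt I p₀).target)
    (hF : ContinuousAt F ((extChartAt I p₀).symm z))
    (hx : F ((extChartAt I p₀).symm z) ∈ (extChartAt J x₁).source) :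
    ∀ᶠ w in 𝓝[range I] z, w ∈ (extChartAt I p₀).target ∧
      F ((extChartAt I p₀).symm w) ∈ (extChartAt J x₁).source := by
  have h1 : ContinuousWithinAt (fun w => F ((extChartAt I p₀).symm w)) (range I) z :=
    hF.comp_continuousWithinAt (continuousAt_extChartAt_symm'' hz).continuousWithinAt
  filter_upwards [extChartAt_target_mem_nhdsWithin_of_mem hz,
    h1.eventually ((isOpen_extChartAt_source x₁).mem_nhds hx)] with w h2 h3 using ⟨h2, h3⟩

theorem isLocalMap_chartMap {F : S → W} (hF : ContMDiff I J ∞ F) {p₀ : S} {x₁ : W} {z : E}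
    (hz : z ∈ (extChartAt I p₀).target)
    (hx : F ((extChartAt I p₀).symm z) ∈ (extChartAt J x₁).source) :
    IsLocalMap (chartMap I J F p₀ x₁) (range I) (range J) z where
  mem := extChartAt_target_subset_range p₀ hz
  contDiff := by
    rw [extChartAt_source] at hx
    have h1 : ContMDiffAt J 𝓘(ℝ, E') ∞ (extChartAt J x₁) (F ((extChartAt I p₀).symm z)) :=
      contMDiffAt_extChartAt' hx
    have h2 : ContMDiffWithinAt 𝓘(ℝ, E) I ∞ (extChartAt I p₀).symm (range I) z :=
      contMDiffWithinAt_extChartAt_symm_range p₀ hz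
    have h3 := (h1.comp _ hF.contMDiffAt).comp_contMDiffWithinAt z h2
    exact h3.contDiffWithinAt.of_le (by norm_cast)
  maps := Eventually.of_forall fun w => by
    unfold chartMap
    exact mem_range_self _

/-- The coordinate expression of a metric, evaluated on coordinate vectors. -/
theorem chartForm_chartDeriv (g : BilinField J W) {x₁ x : W} (hx : x ∈ (extChartAt J x₁).source)
    (a b : TangentSpace J x) :
    chartForm g x₁ (extChartAt J x₁ x) (chartDeriv J x₁ x a) (chartDeriv J x₁ x b) = g x a b := by
  obtain ⟨y, hy, rfl⟩ : ∃ y ∈ (extChartAt J x₁).target, (extChartAt J x₁).symm y = x :=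
    ⟨_, (extChartAt J x₁).map_source hx, (extChartAt J x₁).left_inv hx⟩
  rw [(extChartAt J x₁).right_inv hy, chartForm_eq, chartDerivSymm_chartDeriv hy,
    chartDerivSymm_chartDeriv hy]

theorem inducedForm_chartMap (g : BilinField J W) {F : S → W} {p₀ : S} {x₁ : W} {z : E}
    (hz : z ∈ (extChartAt I p₀).target)
    (hF : MDifferentiableAt I J F ((extChartAt I p₀).symm z))
    (hx : F ((extChartAt I p₀).symm z) ∈ (extChartAt J x₁).source) :
    inducedForm (chartForm g x₁) (chartMap I J F p₀ x₁) (range I) z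
      = chartForm (pullback I F g) p₀ z := by
  ext u v
  rw [inducedForm_apply, fderivWithin_chartMap hz hF hx, fderivWithin_chartMap hz hF hx,
    chartMap, chartForm_chartDeriv g hx]
  rfl

/-- A Riemannian metric whose coordinate expressions are smooth. -/
structure IsSmoothMetric (g : BilinField J W) : Prop where
  inner : ∀ x, IsInnerForm (E := E') (g x)
  contDiff : ∀ x₁, ∀ y ∈ (extChartAt J x₁).target,
    ContDiffWithinAt ℝ 2 (chartForm g x₁) (range J) y

theorem IsSmoothMetric.innerForm_chartForm {g : BilinField J W} (hg : IsSmoothMetric g) {x₁ : W}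
    {y : E'} (hy : y ∈ (extChartAt J x₁).target) : IsInnerForm (chartForm g x₁ y) := by
  have : IsManifold J 1 W := instIsManifoldOne
  exact (hg.inner _).pullForm (E := E') (E' := E')
    (isInvertible_mfderivWithin_extChartAt_symm hy).injective

theorem IsSmoothMetric.isLocalMetric {g : BilinField J W} (hg : IsSmoothMetric g) {x₁ : W}
    {y : E'} (hy : y ∈ (extChartAt J x₁).target) :
    IsLocalMetric (chartForm g x₁) (range J) y where
  mem := extChartAt_target_subset_range x₁ hy
  contDiff := hg.contDiff x₁ y hy
  inner := by
    filter_upwards [extChartAt_target_mem_nhdsWithin_of_mem hy] with z hz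
      using hg.innerForm_chartForm hz

/-- The transformation rule of the Christoffel symbols. -/
theorem IsSmoothMetric.christoffel_transition [FiniteDimensional ℝ E'] {g : BilinField J W}
    (hg : IsSmoothMetric g) {x₀ x : W} (hx : x ∈ (extChartAt J x₀).source) (a b : E') :
    fderivWithin ℝ (chartMap J J id x₀ x) (range J) (extChartAt J x₀ x)
        (christoffel (chartForm g x₀) (range J) (extChartAt J x₀ x) a b)
      = fderivWithin ℝ (fderivWithin ℝ (chartMap J J id x₀ x) (range J)) (range J)
          (extChartAt J x₀ x) a b
        + christoffel (chartForm g x) (range J) (extChartAt J x x)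
          (fderivWithin ℝ (chartMap J J id x₀ x) (range J) (extChartAt J x₀ x) a)
          (fderivWithin ℝ (chartMap J J id x₀ x) (range J) (extChartAt J x₀ x) b) := by
  have : IsManifold J 1 W := instIsManifoldOne
  have ht : extChartAt J x₀ x ∈ (extChartAt J x₀).target := (extChartAt J x₀).map_source hx
  have hx' : id ((extChartAt J x₀).symm (extChartAt J x₀ x)) ∈ (extChartAt J x).source := by
    rw [id, (extChartAt J x₀).left_inv hx]
    exact mem_extChartAt_source x
  have hφ := isLocalMap_chartMap (contMDiff_id (I := J) (M := W) (n := ∞)) ht hx'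
  have hφx : chartMap J J id x₀ x (extChartAt J x₀ x) = extChartAt J x x := chartMap_of_mem id hx x
  have hG := hg.isLocalMetric (x₁ := x) (y := chartMap J J id x₀ x (extChartAt J x₀ x))
    (by rw [hφx]; exact mem_extChartAt_target x)
  -- The metric in the chart at `x₀` is induced by the transition map from the metric in the chart
  -- at `x`, so the rule is an instance of `christoffelLow_inducedForm`.
  have hind : inducedForm (chartForm g x) (chartMap J J id x₀ x) (range J)
      =ᶠ[𝓝[range J] (extChartAt J x₀ x)] chartForm g x₀ := by
    filter_upwards [eventually_mem_source (J := J) ht continuousAt_id hx'] with w hw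
    rw [inducedForm_chartMap g hw.1 mdifferentiableAt_id hw.2]
    ext u v
    rw [chartForm_eq, chartForm_eq, pullback, mfderiv_id]
    rfl
  have hlow : christoffelLow (inducedForm (chartForm g x) (chartMap J J id x₀ x) (range J))
      (range J) (extChartAt J x₀ x) = christoffelLow (chartForm g x₀) (range J)
        (extChartAt J x₀ x) := by
    unfold christoffelLow
    rw [hind.fderivWithin_eq (hind.self_of_nhdsWithin hφ.mem)]
  have hsurj : Function.Surjective
      (fderivWithin ℝ (chartMap J J id x₀ x) (range J) (extChartAt J x₀ x)) := by
    intro c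
    obtain ⟨d, hd⟩ := chartDeriv_surjective hx' c
    refine ⟨chartDeriv J x₀ _ d, ?_⟩
    rw [fderivWithin_chartMap ht mdifferentiableAt_id hx', ← hd]
    refine congrArg _ ?_
    rw [mfderiv_id]
    exact chartDerivSymm_chartDeriv ht _
  apply hG.innerForm.ext
  intro c
  obtain ⟨c, rfl⟩ := hsurj c
  rw [← inducedForm_apply, hind.self_of_nhdsWithin hφ.mem,
    (hg.isLocalMetric ht).christoffel_apply, ← hlow,
    christoffelLow_inducedForm (isRegion_range J) hφ hG]
  rw [hφx]

end ChartExpressions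

/-! ### Independence of the covariant derivative along a map from the charts. -/

section CovariantDerivative

variable {E : Type*} [NormedAddCommGroup E] [NormedSpace ℝ E]
  {H : Type*} [TopologicalSpace H] {I : ModelWithCorners ℝ E H}
  {S : Type*} [TopologicalSpace S] [ChartedSpace H S]
  {E' : Type*} [NormedAddCommGroup E'] [NormedSpace ℝ E']
  {H' : Type*} [TopologicalSpace H'] {J : ModelWithCorners ℝ E' H'}
  {W : Type*} [TopologicalSpace W] [ChartedSpace H' W]

/-- The coordinate expression of a vector field along `F` in the charts at `p₀` and `F p₀`. -/
def chartFieldMap (I : ModelWithCorners ℝ E H) (F : S → W) (X : ∀ p, TangentSpace J (F p))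
    (p₀ : S) (y : E) : E' :=
  chartField F X p₀ ((extChartAt I p₀).symm y)

omit [TopologicalSpace S] in
theorem chartField_eq (F : S → W) (X : ∀ p, TangentSpace J (F p)) (p₀ p : S) :
    chartField F X p₀ p = chartDeriv J (F p₀) (F p) (X p) := rfl

variable [IsManifold I ∞ S] [IsManifold J ∞ W]

omit [IsManifold I ∞ S] [IsManifold J ∞ W] in
theorem contMDiffAt_chartField [IsManifold J 1 W] {F : S → W} {X : ∀ p, TangentSpace J (F p)}
    (hX : ContMDiff I J.tangent ∞ (fun p => (⟨F p, X p⟩ : TangentBundle J W))) (p : S) :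
    ContMDiffAt I 𝓘(ℝ, E') ∞ (chartField F X p) p := by
  have h := hX p
  rw [Bundle.contMDiffAt_totalSpace] at h
  refine h.2.congr_of_eventuallyEq ?_
  filter_upwards [h.1.continuousAt.eventually
    ((chartAt H' (F p)).open_source.mem_nhds (mem_chart_source H' (F p)))] with q hq
  rw [chartField_eq, chartDeriv, ← TangentBundle.continuousLinearMapAt_trivializationAt hq]
  rw [Bundle.Trivialization.continuousLinearMapAt_apply,
    Bundle.Trivialization.coe_linearMapAt_of_mem _ hq]

theorem transition_chartDeriv {x₀ x₁ x : W} (hx₀ : x ∈ (extChartAt J x₀).source)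
    (hx₁ : x ∈ (extChartAt J x₁).source) (a : TangentSpace J x) :
    fderivWithin ℝ (chartMap J J id x₀ x₁) (range J) (extChartAt J x₀ x) (chartDeriv J x₀ x a)
      = chartDeriv J x₁ x a := by
  obtain ⟨y, hy, rfl⟩ : ∃ y ∈ (extChartAt J x₀).target, (extChartAt J x₀).symm y = x :=
    ⟨_, (extChartAt J x₀).map_source hx₀, (extChartAt J x₀).left_inv hx₀⟩
  rw [(extChartAt J x₀).right_inv hy, fderivWithin_chartMap hy mdifferentiableAt_id hx₁,
    chartDerivSymm_chartDeriv hy, mfderiv_id]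
  rfl

omit [IsManifold I ∞ S] [IsManifold J ∞ W] in
theorem chartFieldMap_eq {F : S → W} (X : ∀ p, TangentSpace J (F p)) (p₀ : S) (z : E) :
    chartFieldMap I F X p₀ z = chartDeriv J (F p₀) (F ((extChartAt I p₀).symm z))
      (X ((extChartAt I p₀).symm z)) := rfl

/-- `covDerivAlong` at a point q uses the charts at q and F q. This expresses it in the charts at a
fixed p₀ for all q near p₀, as is needed to differentiate the mean curvature. -/
theorem covDerivAlong_eq [IsManifold J 1 W] [FiniteDimensional ℝ E'] {g : BilinField J W}
    (hg : IsSmoothMetric g)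
    {F : S → W} (hF : ContMDiff I J ∞ F) {X : ∀ p, TangentSpace J (F p)}
    (hX : ContMDiff I J.tangent ∞ (fun p => (⟨F p, X p⟩ : TangentBundle J W))) {p₀ : S} {z : E}
    (hz : z ∈ (extChartAt I p₀).target)
    (hx : F ((extChartAt I p₀).symm z) ∈ (extChartAt J (F p₀)).source)
    (hn : DifferentiableWithinAt ℝ (chartFieldMap I F X p₀) (range I) z) (u : E) :
    covDer (chartForm g (F p₀)) (chartMap I J F p₀ (F p₀)) (chartFieldMap I F X p₀) (range I)
      (range J) z u = chartDeriv J (F p₀) (F ((extChartAt I p₀).symm z))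
        (covDerivAlong I F g X ((extChartAt I p₀).symm z) (chartDerivSymm I p₀ z u)) := by
  have : IsManifold I 1 S := instIsManifoldOne
  obtain ⟨a, ha⟩ := chartDeriv_surjective hx (covDer (chartForm g (F p₀))
    (chartMap I J F p₀ (F p₀)) (chartFieldMap I F X p₀) (range I) (range J) z u)
  rw [← ha]
  congr 1
  -- Both sides are compared in the chart at F q, whose derivative at F q is the identity; the
  -- transition map carries the chart at F p₀ to it.
  have hT := transition_chartDeriv (J := J) hx (mem_extChartAt_source _) a
  rw [chartDeriv_self, ha, covDer_apply, map_add] at hT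
  have hzr : z ∈ range I := extChartAt_target_subset_range p₀ hz
  have hFd : MDifferentiableAt I J F ((extChartAt I p₀).symm z) :=
    hF.mdifferentiableAt (by simp)
  have hB := fderivWithin_chartMap (x₁ := F p₀) hz hFd hx u
  have hφ := isLocalMap_chartMap (x₁ := F p₀) hF hz hx
  have hφz : chartMap I J F p₀ (F p₀) z = extChartAt J (F p₀) (F ((extChartAt I p₀).symm z)) := rfl
  have hτ : IsLocalMap (chartMap J J id (F p₀) (F ((extChartAt I p₀).symm z))) (range J) (range J)
      (chartMap I J F p₀ (F p₀) z) := by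
    apply isLocalMap_chartMap contMDiff_id
    · exact (extChartAt J (F p₀)).map_source hx
    · rw [hφz, (extChartAt J (F p₀)).left_inv hx]
      exact mem_extChartAt_source _
  have e1 := (hφ.comp_hasFDeriv ((hτ.contDiff_fderiv (isRegion_range J)).differentiableWithinAt
    (by simp))).clm_apply hn.hasFDerivWithinAt
  -- The components of the field in the chart at F q are the transition derivative applied to those
  -- in the chart at F p₀. The product rule then yields the second derivative of the transition map,
  -- the very term that the transformation rule of the Christoffel symbols supplies.
  have e2 : (fun w => chartField F X ((extChartAt I p₀).symm z) ((extChartAt I p₀).symm w))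
      =ᶠ[𝓝[range I] z] fun w =>
        fderivWithin ℝ (chartMap J J id (F p₀) (F ((extChartAt I p₀).symm z))) (range J)
          (chartMap I J F p₀ (F p₀) w) (chartFieldMap I F X p₀ w) := by
    filter_upwards [eventually_mem_source hz hF.continuous.continuousAt hx,
      eventually_mem_source (J := J) hz hF.continuous.continuousAt (mem_extChartAt_source _)] with w h1 h2
    rw [chartFieldMap_eq, chartField_eq, chartMap, transition_chartDeriv h1.2 h2.2]
  have e3 := (e1.congr_of_eventuallyEq e2 (e2.self_of_nhdsWithin hzr)).fderivWithin
    (I.uniqueDiffOn z hzr)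
  have e4 : fderivWithin ℝ (fun w => chartField F X ((extChartAt I p₀).symm z)
      ((extChartAt I p₀).symm w)) (range I) z u
      = mfderiv I 𝓘(ℝ, E') (chartField F X ((extChartAt I p₀).symm z)) ((extChartAt I p₀).symm z)
        (chartDerivSymm I p₀ z u) := by
    have := mfderiv_comp_mfderivWithin z
      ((contMDiffAt_chartField hX ((extChartAt I p₀).symm z)).mdifferentiableAt (by simp))
      (mdifferentiableWithinAt_extChartAt_symm hz) (I.uniqueMDiffOn z hzr)
    rw [mfderivWithin_eq_fderivWithin] at this
    exact congrArg (fun f : E →L[ℝ] E' => f u) this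
  rw [e3] at e4
  simp only [add_apply, ContinuousLinearMap.comp_apply, ContinuousLinearMap.flip_apply] at e4
  have e5 := hg.christoffel_transition hx
    (fderivWithin ℝ (chartMap I J F p₀ (F p₀)) (range I) z u) (chartFieldMap I F X p₀ z)
  rw [chartFieldMap_eq, hB, transition_chartDeriv hx (mem_extChartAt_source _),
    transition_chartDeriv hx (mem_extChartAt_source _), chartDeriv_self, chartDeriv_self,
    ← hB, ← chartFieldMap_eq] at e5
  rw [hφz] at hT
  rw [e5, ← add_assoc, ← hφz, e4] at hT
  exact hT.symm

theorem covDerivAlong_eq_of_mem [IsManifold J 1 W] [FiniteDimensional ℝ E'] {g : BilinField J W}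
    (hg : IsSmoothMetric g)
    {F : S → W} (hF : ContMDiff I J ∞ F) {X : ∀ p, TangentSpace J (F p)}
    (hX : ContMDiff I J.tangent ∞ (fun p => (⟨F p, X p⟩ : TangentBundle J W))) {p q : S}
    (hq : q ∈ (extChartAt I p).source) (hx : F q ∈ (extChartAt J (F p)).source)
    (hn : DifferentiableWithinAt ℝ (chartFieldMap I F X p) (range I) (extChartAt I p q))
    (u : TangentSpace I q) :
    covDer (chartForm g (F p)) (chartMap I J F p (F p)) (chartFieldMap I F X p) (range I)
      (range J) (extChartAt I p q) (chartDeriv I p q u)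
      = chartDeriv J (F p) (F q) (covDerivAlong I F g X q u) := by
  obtain ⟨z, hz, rfl⟩ : ∃ z ∈ (extChartAt I p).target, (extChartAt I p).symm z = q :=
    ⟨_, (extChartAt I p).map_source hq, (extChartAt I p).left_inv hq⟩
  rw [(extChartAt I p).right_inv hz] at hn ⊢
  rw [covDerivAlong_eq hg hF hX hz hx hn, chartDerivSymm_chartDeriv hz]

end CovariantDerivative

/-! ### Dependence of gradient and divergence on germs only. -/

section CoordCongr

variable {E : Type*} [NormedAddCommGroup E] [NormedSpace ℝ E]
  {G₁ G₂ : E → E →L[ℝ] E →L[ℝ] ℝ} {s : Set E} {y : E}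

theorem coordGrad_congr (hG : G₁ =ᶠ[𝓝[s] y] G₂) {f₁ f₂ : E → ℝ} (hf : f₁ =ᶠ[𝓝[s] y] f₂) :
    coordGrad G₁ s f₁ =ᶠ[𝓝[s] y] coordGrad G₂ s f₂ := by
  filter_upwards [hG, hf.fderivWithin (𝕜 := ℝ)] with z h1 h2
  rw [coordGrad, coordGrad, h1, h2]

theorem coordDiv_congr (hy : y ∈ s) (hG : G₁ =ᶠ[𝓝[s] y] G₂) {X₁ X₂ : E → E}
    (hX : X₁ =ᶠ[𝓝[s] y] X₂) : coordDiv G₁ s X₁ y = coordDiv G₂ s X₂ y := by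
  rw [coordDiv, coordDiv, christoffel_congr hG hy, hX.fderivWithin_eq (hX.self_of_nhdsWithin hy),
    hX.self_of_nhdsWithin hy]

end CoordCongr

/-! ### Transfer of the local formulas to immersed hypersurfaces. -/

section Manifold

variable {E : Type*} [NormedAddCommGroup E] [NormedSpace ℝ E]
  {H : Type*} [TopologicalSpace H] {I : ModelWithCorners ℝ E H}
  {S : Type*} [TopologicalSpace S] [ChartedSpace H S]
  {E' : Type*} [NormedAddCommGroup E'] [NormedSpace ℝ E']
  {H' : Type*} [TopologicalSpace H'] {J : ModelWithCorners ℝ E' H'}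
  {W : Type*} [TopologicalSpace W] [ChartedSpace H' W]
  [IsManifold I ∞ S] [IsManifold J ∞ W]

theorem chartForm_self (g : BilinField J W) (x : W) (a b : TangentSpace J x) :
    chartForm g x (extChartAt J x x) a b = g x a b := by
  rw [← chartForm_chartDeriv g (mem_extChartAt_source x) a b, chartDeriv_self, chartDeriv_self]

theorem fderivWithin_chartFun {f : W → ℝ} {x₀ x : W} (hf : MDifferentiableAt J 𝓘(ℝ, ℝ) f x)
    (hx : x ∈ (extChartAt J x₀).source) (a : TangentSpace J x) :
    fderivWithin ℝ (chartFun J f x₀) (range J) (extChartAt J x₀ x) (chartDeriv J x₀ x a)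
      = mfderiv J 𝓘(ℝ, ℝ) f x a := by
  have : IsManifold J 1 W := instIsManifoldOne
  obtain ⟨y, hy, rfl⟩ : ∃ y ∈ (extChartAt J x₀).target, (extChartAt J x₀).symm y = x :=
    ⟨_, (extChartAt J x₀).map_source hx, (extChartAt J x₀).left_inv hx⟩
  have hyr : y ∈ range J := extChartAt_target_subset_range x₀ hy
  have e := mfderiv_comp_mfderivWithin y hf (mdifferentiableWithinAt_extChartAt_symm hy)
    (J.uniqueMDiffOn y hyr)
  rw [mfderivWithin_eq_fderivWithin] at e
  rw [(extChartAt J x₀).right_inv hy]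
  refine (congrArg (fun f : E' →L[ℝ] ℝ => f (chartDeriv J x₀ ((extChartAt J x₀).symm y) a)) e).trans
    ?_
  exact congrArg _ (chartDerivSymm_chartDeriv hy a)

theorem fderivWithin_chartFun_self {f : W → ℝ} {x : W} (hf : MDifferentiableAt J 𝓘(ℝ, ℝ) f x)
    (a : TangentSpace J x) :
    fderivWithin ℝ (chartFun J f x) (range J) (extChartAt J x x) a = mfderiv J 𝓘(ℝ, ℝ) f x a := by
  rw [← fderivWithin_chartFun hf (mem_extChartAt_source x), chartDeriv_self]

theorem contDiffWithinAt_chartFun {f : W → ℝ} (hf : ContMDiff J 𝓘(ℝ, ℝ) ∞ f) {x₀ : W} {y : E'}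
    (hy : y ∈ (extChartAt J x₀).target) : ContDiffWithinAt ℝ 2 (chartFun J f x₀) (range J) y :=
  ((hf.contMDiffAt.comp_contMDiffWithinAt y
    (contMDiffWithinAt_extChartAt_symm_range x₀ hy)).contDiffWithinAt).of_le (by norm_cast)

omit [IsManifold J ∞ W] in
theorem grad_spec [FiniteDimensional ℝ E'] {g : BilinField J W} {x : W}
    (hg : IsInnerForm (E := E') (g x)) (f : W → ℝ) (v : TangentSpace J x) :
    g x (grad g f x) v = mfderiv J 𝓘(ℝ, ℝ) f x v :=
  hg.apply_inverse (mfderiv J 𝓘(ℝ, ℝ) f x : E' →L[ℝ] ℝ) v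

theorem coordGrad_self {g : BilinField J W} {x : W} {f : W → ℝ} (hf : MDifferentiableAt J 𝓘(ℝ, ℝ) f x) :
    coordGrad (chartForm g x) (range J) (chartFun J f x) (extChartAt J x x) = grad g f x := by
  have e : chartForm g x (extChartAt J x x) = (g x : E' →L[ℝ] E' →L[ℝ] ℝ) := by
    ext a b
    exact chartForm_self g x a b
  have e' : fderivWithin ℝ (chartFun J f x) (range J) (extChartAt J x x)
      = (mfderiv J 𝓘(ℝ, ℝ) f x : E' →L[ℝ] ℝ) := by
    ext a
    exact fderivWithin_chartFun_self hf a
  rw [coordGrad, e, e']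
  rfl

theorem chartDerivSymm_injective {x₁ : S} {y : E} (hy : y ∈ (extChartAt I x₁).target) :
    Function.Injective (chartDerivSymm I x₁ y) :=
  Function.LeftInverse.injective (g := chartDeriv I x₁ ((extChartAt I x₁).symm y))
    (chartDeriv_symm hy)

/-- The derivative of the inverse of a chart as a linear equivalence. -/
def chartDerivEquiv {x₁ : S} {y : E} (hy : y ∈ (extChartAt I x₁).target) :
    E ≃ₗ[ℝ] TangentSpace I ((extChartAt I x₁).symm y) where
  toLinearMap := (chartDerivSymm I x₁ y).toLinearMap
  invFun := chartDeriv I x₁ ((extChartAt I x₁).symm y)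
  left_inv := chartDeriv_symm hy
  right_inv := chartDerivSymm_chartDeriv hy

variable [IsManifold J 1 W] {g : BilinField J W} {F : S → W} {N : ∀ p, TangentSpace J (F p)}

/-- A hypersurface in the charts at `p` and `F p`. -/
theorem IsGaussMap.isLocalHypersurface (hN : IsGaussMap I F g N) (hg : IsSmoothMetric g)
    (hF : IsSmoothImmersion I J F)
    (hd : Module.finrank ℝ E' = Module.finrank ℝ E + 1) (p : S) :
    IsLocalHypersurface (chartForm g (F p)) (chartMap I J F p (F p)) (chartFieldMap I F N p)
      (range I) (range J) (extChartAt I p p) := by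
  have hz := mem_extChartAt_target (I := I) p
  have hx : F ((extChartAt I p).symm (extChartAt I p p)) ∈ (extChartAt J (F p)).source := by
    rw [(extChartAt I p).left_inv (mem_extChartAt_source p)]
    exact mem_extChartAt_source _
  have hev := eventually_mem_source (J := J) hz hF.1.continuous.continuousAt hx
  have hφx : chartMap I J F p (F p) (extChartAt I p p) = extChartAt J (F p) (F p) :=
    chartMap_self F p (F p)
  refine ⟨isRegion_range I, isRegion_range J, isLocalMap_chartMap hF.1 hz hx,
    hg.isLocalMetric (by rw [hφx]; exact mem_extChartAt_target _), ?_, ?_, ?_, ?_, hd⟩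
  · filter_upwards [hev] with w hw u₁ u₂ hu
    have hFd : MDifferentiableAt I J F ((extChartAt I p).symm w) :=
      hF.1.mdifferentiableAt (by simp)
    rw [fderivWithin_chartMap hw.1 hFd hw.2, fderivWithin_chartMap hw.1 hFd hw.2] at hu
    exact chartDerivSymm_injective hw.1 (hF.2 _ (chartDeriv_injective hw.2 hu))
  · have h1 : ContMDiffAt I 𝓘(ℝ, E') ∞ (chartField F N p)
        ((extChartAt I p).symm (extChartAt I p p)) := by
      rw [(extChartAt I p).left_inv (mem_extChartAt_source p)]
      exact contMDiffAt_chartField hN.smooth p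
    exact ((h1.comp_contMDiffWithinAt _
      (contMDiffWithinAt_extChartAt_symm_range p hz)).contDiffWithinAt).of_le (by norm_cast)
  · filter_upwards [hev] with w hw
    rw [chartFieldMap_eq, chartMap, chartForm_chartDeriv g hw.2, hN.unit]
  · filter_upwards [hev] with w hw u
    rw [chartFieldMap_eq, fderivWithin_chartMap hw.1 (hF.1.mdifferentiableAt (by simp)) hw.2,
      chartMap, chartForm_chartDeriv g hw.2, hN.normal]

variable [FiniteDimensional ℝ E] [FiniteDimensional ℝ E']

omit [IsManifold I ∞ S] [IsManifold J ∞ W] [IsManifold J 1 W] [FiniteDimensional ℝ E]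
  [FiniteDimensional ℝ E'] in
theorem pullback_innerForm (hg : IsSmoothMetric g) (hF : IsSmoothImmersion I J F) (p : S) :
    IsInnerForm (E := E) (pullback I F g p) :=
  (hg.inner (F p)).pullForm (E := E) (E' := E') (hF.2 p)

/-- The divergence of the Gauss map is minus the trace of the shape operator. -/
theorem divAlong_eq (hg : IsSmoothMetric g) (hF : IsSmoothImmersion I J F)
    (hN : IsGaussMap I F g N) {p : S} {z : E} (hz : z ∈ (extChartAt I p).target)
    (hx : F ((extChartAt I p).symm z) ∈ (extChartAt J (F p)).source)
    (h : IsLocalHypersurface (chartForm g (F p)) (chartMap I J F p (F p)) (chartFieldMap I F N p)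
      (range I) (range J) z) :
    divAlong I F g N ((extChartAt I p).symm z)
      = - traceForm (shapeOp (chartForm g (F p)) (chartMap I J F p (F p)) (chartFieldMap I F N p)
        (range I) (range J) z) := by
  set A := shapeOp (chartForm g (F p)) (chartMap I J F p (F p)) (chartFieldMap I F N p)
        (range I) (range J) z with hA
  have hFd : MDifferentiableAt I J F ((extChartAt I p).symm z) := hF.1.mdifferentiableAt (by simp)
  -- The derivative of the inverse chart conjugates −S to the endomorphism in `divAlong`, and the
  -- trace is invariant under conjugation.
  have key : ((pullback I F g ((extChartAt I p).symm z)).inverse ∘L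
      (ContinuousLinearMap.precomp ℝ (mfderiv I J F ((extChartAt I p).symm z)))
      ∘L g (F ((extChartAt I p).symm z)) ∘L
        covDerivAlong I F g N ((extChartAt I p).symm z)).toLinearMap
      = (chartDerivEquiv hz).conj (-A.toLinearMap) := by
    ext v
    obtain ⟨u, rfl⟩ := (chartDerivEquiv hz).surjective v
    rw [LinearEquiv.conj_apply_apply, LinearEquiv.symm_apply_apply]
    apply (pullback_innerForm hg hF ((extChartAt I p).symm z)).ext
    intro w
    obtain ⟨w, rfl⟩ := (chartDerivEquiv hz).surjective w
    have e1 : pullback I F g ((extChartAt I p).symm z)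
        (chartDerivSymm I p z (-A u)) (chartDerivSymm I p z w)
        = g (F ((extChartAt I p).symm z))
          (covDerivAlong I F g N ((extChartAt I p).symm z) (chartDerivSymm I p z u))
          (mfderiv I J F ((extChartAt I p).symm z) (chartDerivSymm I p z w)) := by
      have e2 := h.shapeOp_spec u w
      rw [covDerivAlong_eq hg hF.1 hN.smooth hz hx (h.field.differentiableWithinAt (by simp)),
        fderivWithin_chartMap hz hFd hx, chartMap, chartForm_chartDeriv g hx,
        inducedForm_chartMap g hz hFd hx, ← hA, chartForm_eq] at e2
      rw [map_neg, map_neg, neg_apply, e2, neg_neg]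
    refine Eq.trans ?_ e1.symm
    exact (pullback_innerForm hg hF ((extChartAt I p).symm z)).apply_inverse
      (((ContinuousLinearMap.precomp ℝ (mfderiv I J F ((extChartAt I p).symm z)))
      ∘L g (F ((extChartAt I p).symm z)) ∘L
        covDerivAlong I F g N ((extChartAt I p).symm z)) (chartDerivSymm I p z u)) _
  rw [divAlong, key, LinearMap.trace_conj', map_neg]
  rfl

/-- The weighted mean curvature in the charts at `p` and `F p`. -/
theorem weightedMeanCurvature_eq (hg : IsSmoothMetric g) (hF : IsSmoothImmersion I J F)
    (hN : IsGaussMap I F g N) {ψ : W → ℝ} (hψ : ContMDiff J 𝓘(ℝ, ℝ) ∞ ψ) {p : S} {z : E}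
    (hz : z ∈ (extChartAt I p).target)
    (hx : F ((extChartAt I p).symm z) ∈ (extChartAt J (F p)).source)
    (h : IsLocalHypersurface (chartForm g (F p)) (chartMap I J F p (F p)) (chartFieldMap I F N p)
      (range I) (range J) z) :
    weightedMeanCurvature I F g ψ N ((extChartAt I p).symm z)
      = traceForm (shapeOp (chartForm g (F p)) (chartMap I J F p (F p)) (chartFieldMap I F N p)
        (range I) (range J) z) - fderivWithin ℝ (chartFun J ψ (F p)) (range J)
          (chartMap I J F p (F p) z) (chartFieldMap I F N p z) := by
  rw [weightedMeanCurvature, divAlong_eq hg hF hN hz hx h, grad_spec (hg.inner _),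
    chartFieldMap_eq, chartMap, fderivWithin_chartFun (hψ.mdifferentiableAt (by simp)) hx]
  have e : ∀ a b : ℝ, -(-a + b) = a - b := fun a b => by ring
  exact e _ _

theorem covDerivAlong_eq_zero (hg : IsSmoothMetric g) (hF : IsSmoothImmersion I J F)
    (hN : IsGaussMap I F g N) (hd : Module.finrank ℝ E' = Module.finrank ℝ E + 1) {p : S}
    (h0 : shapeOp (chartForm g (F p)) (chartMap I J F p (F p)) (chartFieldMap I F N p)
        (range I) (range J) (extChartAt I p p) = 0) (u : TangentSpace I p) :
    covDerivAlong I F g N p u = 0 := by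
  have h := hN.isLocalHypersurface hg hF hd p
  have e : ∀ v, covDer (chartForm g (F p)) (chartMap I J F p (F p)) (chartFieldMap I F N p)
      (range I) (range J) (extChartAt I p p) v = 0 := fun v => by
    rw [h.covDer_eq, h0, zero_apply, map_zero, neg_zero]
  have e' := e (chartDeriv I p p u)
  rw [covDerivAlong_eq_of_mem hg hF.1 hN.smooth (mem_extChartAt_source p)
    (mem_extChartAt_source _) (h.field.differentiableWithinAt (by simp)), chartDeriv_self] at e'
  exact e'

theorem secondFF_eq_zero (hg : IsSmoothMetric g) (hF : IsSmoothImmersion I J F)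
    (hN : IsGaussMap I F g N) (hd : Module.finrank ℝ E' = Module.finrank ℝ E + 1) {p : S}
    (h0 : shapeOp (chartForm g (F p)) (chartMap I J F p (F p)) (chartFieldMap I F N p)
        (range I) (range J) (extChartAt I p p) = 0) (u w : TangentSpace I p) :
    secondFF I F g N p u w = 0 := by
  rw [secondFF, covDerivAlong_eq_zero hg hF hN hd h0]
  simp

/-- A vector field with constant coordinate expressions that is parallel and annihilated by the
curvature. -/
structure IsParallelField (g : BilinField J W) (V : ∀ x : W, TangentSpace J x) (ξ : E') : Prop where
  chartDeriv_eq : ∀ x₀ x : W, x ∈ (extChartAt J x₀).source → chartDeriv J x₀ x (V x) = ξ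
  parallel : ∀ x : W, IsParallel (chartForm g x) (range J) ξ (extChartAt J x x)
  curvature : ∀ (x : W) (u w : E'), curvatureEnd (chartForm g x) (range J) (extChartAt J x x) ξ w u = 0

/-- The drifted Laplacian of the angle function of a hypersurface with constant weighted mean
curvature with respect to a parallel field. -/
theorem driftedLaplacian_angle (hg : IsSmoothMetric g) (hF : IsSmoothImmersion I J F)
    (hN : IsGaussMap I F g N) (hd : Module.finrank ℝ E' = Module.finrank ℝ E + 1)
    {V : ∀ x : W, TangentSpace J x} {ξ : E'} (hV : IsParallelField g V ξ)
    {ψ : W → ℝ} (hψ : ContMDiff J 𝓘(ℝ, ℝ) ∞ ψ) {a : ℝ}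
    (hH : ∀ p, weightedMeanCurvature I F g ψ N p = a) {θ : S → ℝ}
    (hθ : ∀ p, θ p = g (F p) (V (F p)) (N p)) (hθd : MDifferentiable I 𝓘(ℝ, ℝ) θ) (p : S) :
    driftedLaplacian (pullback I F g) (ψ ∘ F) θ p
      = - θ p * (ricciBE g ψ (F p) (N p) (N p) + traceForm
        (shapeOp (chartForm g (F p)) (chartMap I J F p (F p)) (chartFieldMap I F N p)
          (range I) (range J) (extChartAt I p p) ∘L
        shapeOp (chartForm g (F p)) (chartMap I J F p (F p)) (chartFieldMap I F N p)
          (range I) (range J) (extChartAt I p p)))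
        - hessian g ψ (F p) (V (F p)) (N p) := by
  have h := hN.isLocalHypersurface hg hF hd p
  have hz := mem_extChartAt_target (I := I) p
  have hpp : (extChartAt I p).symm (extChartAt I p p) = p :=
    (extChartAt I p).left_inv (mem_extChartAt_source p)
  have hx : F ((extChartAt I p).symm (extChartAt I p p)) ∈ (extChartAt J (F p)).source := by
    rw [hpp]
    exact mem_extChartAt_source _
  have hev := eventually_mem_source (J := J) hz hF.1.continuous.continuousAt hx
  have hφx : chartMap I J F p (F p) (extChartAt I p p) = extChartAt J (F p) (F p) :=
    chartMap_self F p (F p)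
  have hn : chartFieldMap I F N p (extChartAt I p p) = N p := by
    rw [chartFieldMap, hpp, chartField_eq, chartDeriv_self]
  have hVp : V (F p) = ξ := by
    rw [← hV.chartDeriv_eq (F p) (F p) (mem_extChartAt_source _), chartDeriv_self]
  have hG : inducedForm (chartForm g (F p)) (chartMap I J F p (F p)) (range I)
      =ᶠ[𝓝[range I] (extChartAt I p p)] chartForm (pullback I F g) p := by
    filter_upwards [hev] with w hw
    exact inducedForm_chartMap g hw.1 (hF.1.mdifferentiableAt (by simp)) hw.2
  have hθc : (fun z => chartForm g (F p) (chartMap I J F p (F p) z) ξ (chartFieldMap I F N p z))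
      =ᶠ[𝓝[range I] (extChartAt I p p)] chartFun I θ p := by
    filter_upwards [hev] with w hw
    rw [chartFun, hθ, ← hV.chartDeriv_eq _ _ hw.2, chartFieldMap_eq, chartMap,
      chartForm_chartDeriv g hw.2]
  have hψc : (fun z => chartFun J ψ (F p) (chartMap I J F p (F p) z))
      =ᶠ[𝓝[range I] (extChartAt I p p)] chartFun I (ψ ∘ F) p := by
    filter_upwards [hev] with w hw
    rw [chartFun, chartFun, chartMap, (extChartAt J (F p)).left_inv hw.2]
    rfl
  -- The constancy of the mean curvature at all points near p, read in the charts at p and F p.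
  have hHc : ∀ᶠ z in 𝓝[range I] (extChartAt I p p),
      traceForm (shapeOp (chartForm g (F p)) (chartMap I J F p (F p)) (chartFieldMap I F N p)
        (range I) (range J) z) - fderivWithin ℝ (chartFun J ψ (F p)) (range J)
          (chartMap I J F p (F p) z) (chartFieldMap I F N p z) = a := by
    filter_upwards [hev, h.eventually] with w hw h'
    rw [← weightedMeanCurvature_eq hg hF hN hψ hw.1 hw.2 h', hH]
  have hθξ : chartForm g (F p) (extChartAt J (F p) (F p)) ξ (N p) = θ p := by
    rw [hθ, ← hVp]
    exact chartForm_self g (F p) _ _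
  have hessV : hessian g ψ (F p) (V (F p)) (N p) = coordHessian (chartForm g (F p)) (range J)
      (chartFun J ψ (F p)) (extChartAt J (F p) (F p)) ξ (N p) := by
    rw [← hVp]
    rfl
  have key := h.coordDiv_grad_angle_add_drift (by rw [hφx]; exact hV.parallel _)
    (by rw [hφx]; exact hV.curvature _)
    (contDiffWithinAt_chartFun hψ (by rw [hφx]; exact mem_extChartAt_target _)) hHc
  have hgrad := coordGrad_congr hG hθc
  rw [coordDiv_congr h.mem hG hgrad, hgrad.self_of_nhdsWithin h.mem,
    coordGrad_self (hθd p), hφx, hn, hψc.fderivWithin_eq (hψc.self_of_nhdsWithin h.mem),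
    fderivWithin_chartFun_self ((hψ.comp hF.1).mdifferentiableAt (by simp)),
    hθξ] at key
  rw [hessV, driftedLaplacian, grad_spec (pullback_innerForm hg hF p)]
  exact key

end Manifold

/-! ### Connection, curvature and Hessian of a product with a line, in coordinates. -/

section ProductCoordinates

variable {E : Type*} [NormedAddCommGroup E] [NormedSpace ℝ E]

/-- The pull-back of bilinear forms to `E × ℝ`. -/
def liftForm : (E →L[ℝ] E →L[ℝ] ℝ) →L[ℝ] (E × ℝ →L[ℝ] E × ℝ →L[ℝ] ℝ) :=
  (ContinuousLinearMap.postcomp (E × ℝ)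
      (ContinuousLinearMap.precomp ℝ (ContinuousLinearMap.fst ℝ E ℝ)))
    ∘L (ContinuousLinearMap.precomp (E →L[ℝ] ℝ) (ContinuousLinearMap.fst ℝ E ℝ))

theorem liftForm_apply (A : E →L[ℝ] E →L[ℝ] ℝ) (a b : E × ℝ) : liftForm A a b = A a.1 b.1 := rfl

/-- The form `dt²` on `E × ℝ`. -/
def lineForm : E × ℝ →L[ℝ] E × ℝ →L[ℝ] ℝ :=
  pullForm (innerSL ℝ : ℝ →L[ℝ] ℝ →L[ℝ] ℝ) (ContinuousLinearMap.snd ℝ E ℝ)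

theorem lineForm_apply (a b : E × ℝ) : lineForm a b = a.2 * b.2 := by
  change inner ℝ a.2 b.2 = _
  simp [mul_comm]

/-- The product of a form on `E` and `dt²`. -/
def prodForm (A : E →L[ℝ] E →L[ℝ] ℝ) : E × ℝ →L[ℝ] E × ℝ →L[ℝ] ℝ := liftForm A + lineForm

theorem prodForm_apply (A : E →L[ℝ] E →L[ℝ] ℝ) (a b : E × ℝ) :
    prodForm A a b = A a.1 b.1 + a.2 * b.2 := by
  rw [prodForm, add_apply, add_apply, liftForm_apply, lineForm_apply]

theorem IsInnerForm.prodForm {A : E →L[ℝ] E →L[ℝ] ℝ} (hA : IsInnerForm A) :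
    IsInnerForm (prodForm A) where
  symm a b := by
    rw [prodForm_apply, prodForm_apply, hA.symm, mul_comm]
  pos a ha := by
    rw [prodForm_apply]
    by_cases h1 : a.1 = 0
    · have h2 : a.2 ≠ 0 := fun h2 => ha (Prod.ext h1 h2)
      rw [h1]
      simpa using h2
    · exact add_pos_of_pos_of_nonneg (hA.pos _ h1) (mul_self_nonneg _)

/-- Christoffel symbols of a product with a line. -/
def liftChristoffel : (E →L[ℝ] E →L[ℝ] E) →L[ℝ] (E × ℝ →L[ℝ] E × ℝ →L[ℝ] E × ℝ) :=
  (ContinuousLinearMap.postcomp (E × ℝ)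
      ((ContinuousLinearMap.postcomp (E × ℝ) (ContinuousLinearMap.inl ℝ E ℝ))
        ∘L (ContinuousLinearMap.precomp E (ContinuousLinearMap.fst ℝ E ℝ))))
    ∘L (ContinuousLinearMap.precomp (E →L[ℝ] E) (ContinuousLinearMap.fst ℝ E ℝ))

theorem liftChristoffel_apply (A : E →L[ℝ] E →L[ℝ] E) (a b : E × ℝ) :
    liftChristoffel A a b = (A a.1 b.1, 0) := rfl

variable {G : E → E →L[ℝ] E →L[ℝ] ℝ} {G' : E × ℝ → E × ℝ →L[ℝ] E × ℝ →L[ℝ] ℝ} {s : Set E}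

/-- Coordinate expressions of a product with a line. -/
def IsLineProduct (G' : E × ℝ → E × ℝ →L[ℝ] E × ℝ →L[ℝ] ℝ) (G : E → E →L[ℝ] E →L[ℝ] ℝ)
    (s : Set E) (z : E × ℝ) : Prop :=
  ∀ᶠ w in 𝓝[s ×ˢ univ] z, G' w = prodForm (G w.1)

omit [NormedSpace ℝ E] in
theorem tendsto_fst_nhdsWithin (s : Set E) (z : E × ℝ) :
    Tendsto Prod.fst (𝓝[s ×ˢ (univ : Set ℝ)] z) (𝓝[s] z.1) :=
  tendsto_nhdsWithin_iff.2 ⟨continuousAt_fst.continuousWithinAt,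
    eventually_mem_nhdsWithin.mono fun _ hw => hw.1⟩

theorem hasFDerivWithinAt_comp_fst {F : Type*} [NormedAddCommGroup F] [NormedSpace ℝ F]
    {f : E → F} {f' : E →L[ℝ] F} {z : E × ℝ} (hf : HasFDerivWithinAt f f' s z.1) :
    HasFDerivWithinAt (fun w : E × ℝ => f w.1) (f' ∘L ContinuousLinearMap.fst ℝ E ℝ)
      (s ×ˢ univ) z :=
  hf.comp_of_tendsto z hasFDerivWithinAt_fst (tendsto_fst_nhdsWithin s z)

theorem IsLineProduct.eventually {z : E × ℝ} (h : IsLineProduct G' G s z) :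
    ∀ᶠ w in 𝓝[s ×ˢ univ] z, IsLineProduct G' G s w := eventually_eventually_nhdsWithin.2 h

theorem IsLineProduct.isLocalMetric {z : E × ℝ} (h : IsLineProduct G' G s z)
    (hG : IsLocalMetric G s z.1) : IsLocalMetric G' (s ×ˢ univ) z where
  mem := ⟨hG.mem, mem_univ _⟩
  contDiff := by
    have h1 : ContDiffWithinAt ℝ 2 (fun w : E × ℝ => G w.1) (s ×ˢ univ) z :=
      hG.contDiff.comp z contDiffWithinAt_fst fun w hw => hw.1
    exact (((liftForm (E := E)).contDiff.contDiffAt.comp_contDiffWithinAt z h1).add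
      (contDiffWithinAt_const (c := lineForm (E := E)))).congr_of_eventuallyEq h
      (h.self_of_nhdsWithin ⟨hG.mem, mem_univ _⟩)
  inner := by
    filter_upwards [h, (tendsto_fst_nhdsWithin s z).eventually hG.inner] with w h1 h2
    rw [h1]
    exact h2.prodForm

/-- The coefficients of the metric do not depend on the last coordinate and those of dt² are
constant, so both sides have the same inner product with every vector. -/
theorem IsLineProduct.christoffel_eq [FiniteDimensional ℝ E]
    (hs' : IsRegion (s ×ˢ (univ : Set ℝ))) {z : E × ℝ} (h : IsLineProduct G' G s z)
    (hG : IsLocalMetric G s z.1) :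
    christoffel G' (s ×ˢ univ) z = liftChristoffel (christoffel G s z.1) := by
  have hz : z ∈ s ×ˢ (univ : Set ℝ) := ⟨hG.mem, mem_univ _⟩
  have hG' := h.isLocalMetric hG
  have hd : fderivWithin ℝ G' (s ×ˢ univ) z
      = (liftForm ∘L fderivWithin ℝ G s z.1) ∘L ContinuousLinearMap.fst ℝ E ℝ := by
    have h1 := hasFDerivWithinAt_comp_fst ((liftForm (E := E)).hasFDerivAt.comp_hasFDerivWithinAt _
      hG.differentiable.hasFDerivWithinAt)
    have h2 := (h1.add_const lineForm).congr_of_eventuallyEq h (h.self_of_nhdsWithin hz)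
    exact h2.fderivWithin (hs'.uniqueDiffOn z hz)
  refine ContinuousLinearMap.ext fun a => ContinuousLinearMap.ext fun b => ?_
  apply hG'.innerForm.ext
  intro c
  rw [hG'.christoffel_apply, h.self_of_nhdsWithin hz, prodForm_apply, liftChristoffel_apply,
    hG.christoffel_apply, christoffelLow_apply, christoffelLow_apply, hd]
  simp only [ContinuousLinearMap.comp_apply, liftForm_apply, ContinuousLinearMap.coe_fst']
  ring

theorem IsLineProduct.fderivWithin_christoffel [FiniteDimensional ℝ E] (hs : IsRegion s)
    (hs' : IsRegion (s ×ˢ (univ : Set ℝ))) {z : E × ℝ} (h : IsLineProduct G' G s z)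
    (hG : IsLocalMetric G s z.1) (a : E × ℝ) :
    fderivWithin ℝ (christoffel G' (s ×ˢ univ)) (s ×ˢ univ) z a
      = liftChristoffel (fderivWithin ℝ (christoffel G s) s z.1 a.1) := by
  have hz : z ∈ s ×ˢ (univ : Set ℝ) := ⟨hG.mem, mem_univ _⟩
  have h1 := hasFDerivWithinAt_comp_fst
    ((liftChristoffel (E := E)).hasFDerivAt.comp_hasFDerivWithinAt _
      ((hG.contDiff_christoffel hs).differentiableWithinAt (by simp)).hasFDerivWithinAt)
  have h2 := h1.congr_of_eventuallyEq (f₁ := christoffel G' (s ×ˢ univ))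
    ((h.eventually.and ((tendsto_fst_nhdsWithin s z).eventually hG.eventually)).mono
      fun w hw => hw.1.christoffel_eq hs' hw.2) (h.christoffel_eq hs' hG)
  rw [h2.fderivWithin (hs'.uniqueDiffOn z hz)]
  rfl

theorem IsLineProduct.curvatureEnd_eq [FiniteDimensional ℝ E] (hs : IsRegion s)
    (hs' : IsRegion (s ×ˢ (univ : Set ℝ))) {z : E × ℝ} (h : IsLineProduct G' G s z)
    (hG : IsLocalMetric G s z.1) (u v w : E × ℝ) :
    curvatureEnd G' (s ×ˢ univ) z v w u = (curvatureEnd G s z.1 v.1 w.1 u.1, 0) := by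
  rw [curvatureEnd_apply, curvatureEnd_apply, h.fderivWithin_christoffel hs hs' hG,
    h.fderivWithin_christoffel hs hs' hG, h.christoffel_eq hs' hG]
  simp [liftChristoffel_apply]

theorem IsLineProduct.coordRicci_eq [FiniteDimensional ℝ E] (hs : IsRegion s)
    (hs' : IsRegion (s ×ˢ (univ : Set ℝ))) {z : E × ℝ} (h : IsLineProduct G' G s z)
    (hG : IsLocalMetric G s z.1) (v w : E × ℝ) :
    coordRicci G' (s ×ˢ univ) z v w = coordRicci G s z.1 v.1 w.1 := by
  have e : (curvatureEnd G' (s ×ˢ univ) z v w).toLinearMap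
      = (curvatureEnd G s z.1 v.1 w.1).toLinearMap.prodMap (0 : ℝ →ₗ[ℝ] ℝ) := by
    refine LinearMap.ext fun u => ?_
    exact h.curvatureEnd_eq hs hs' hG u v w
  rw [coordRicci, e, LinearMap.trace_prodMap', map_zero, add_zero]
  rfl

theorem IsLineProduct.isParallel [FiniteDimensional ℝ E]
    (hs' : IsRegion (s ×ˢ (univ : Set ℝ))) {z : E × ℝ} (h : IsLineProduct G' G s z)
    (hG : IsLocalMetric G s z.1) : IsParallel G' (s ×ˢ univ) (0, 1) z := by
  filter_upwards [h.eventually, (tendsto_fst_nhdsWithin s z).eventually hG.eventually]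
    with w h1 h2 u
  rw [h1.christoffel_eq hs' h2, liftChristoffel_apply, map_zero, Prod.mk_zero_zero]

theorem IsLineProduct.curvatureEnd_vertical [FiniteDimensional ℝ E] (hs : IsRegion s)
    (hs' : IsRegion (s ×ˢ (univ : Set ℝ))) {z : E × ℝ} (h : IsLineProduct G' G s z)
    (hG : IsLocalMetric G s z.1) (u w : E × ℝ) :
    curvatureEnd G' (s ×ˢ univ) z (0, 1) w u = 0 := by
  rw [h.curvatureEnd_eq hs hs' hG, curvatureEnd_apply]
  simp

/-- A sum f(x) + v(t) has no mixed second derivatives, and the Christoffel symbols have no vertical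
component for dv to see. -/
theorem IsLineProduct.coordHessian_eq [FiniteDimensional ℝ E] (hs : IsRegion s)
    (hs' : IsRegion (s ×ˢ (univ : Set ℝ))) {z : E × ℝ} (h : IsLineProduct G' G s z)
    (hG : IsLocalMetric G s z.1) {f : E → ℝ} (hf : ContDiffWithinAt ℝ 2 f s z.1)
    {v : ℝ → ℝ} (hv : ContDiff ℝ 2 v) {f' : E × ℝ → ℝ}
    (hf' : ∀ᶠ w in 𝓝[s ×ˢ univ] z, f' w = f w.1 + v w.2) (a b : E × ℝ) :
    coordHessian G' (s ×ˢ univ) f' z a b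
      = coordHessian G s f z.1 a.1 b.1 + fderiv ℝ (fderiv ℝ v) z.2 a.2 b.2 := by
  have hz : z ∈ s ×ˢ (univ : Set ℝ) := ⟨hG.mem, mem_univ _⟩
  have hvd : Differentiable ℝ v := hv.differentiable (by simp)
  have hvd' : Differentiable ℝ (fderiv ℝ v) :=
    (hv.fderiv_right (m := 1) (by norm_num)).differentiable (by simp)
  have hdiff : ∀ w ∈ s ×ˢ (univ : Set ℝ), DifferentiableWithinAt ℝ f s w.1 →
      f' =ᶠ[𝓝[s ×ˢ univ] w] (fun w => f w.1 + v w.2) →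
      fderivWithin ℝ f' (s ×ˢ univ) w = fderivWithin ℝ f s w.1 ∘L ContinuousLinearMap.fst ℝ E ℝ
        + fderiv ℝ v w.2 ∘L ContinuousLinearMap.snd ℝ E ℝ := by
    intro w hw h1 h2
    have h3 := (hasFDerivWithinAt_comp_fst h1.hasFDerivWithinAt).add
      ((hvd w.2).hasFDerivAt.comp_hasFDerivWithinAt w hasFDerivWithinAt_snd)
    exact (h3.congr_of_eventuallyEq h2 (h2.self_of_nhdsWithin hw)).fderivWithin
      (hs'.uniqueDiffOn w hw)
  have hfe := hf.eventually (by simp)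
  rw [insert_eq_of_mem hG.mem] at hfe
  have hev : fderivWithin ℝ f' (s ×ˢ univ) =ᶠ[𝓝[s ×ˢ univ] z] fun w =>
      ContinuousLinearMap.precomp ℝ (ContinuousLinearMap.fst ℝ E ℝ) (fderivWithin ℝ f s w.1)
        + ContinuousLinearMap.precomp ℝ (ContinuousLinearMap.snd ℝ E ℝ) (fderiv ℝ v w.2) := by
    filter_upwards [self_mem_nhdsWithin, (tendsto_fst_nhdsWithin s z).eventually hfe,
      eventually_eventually_nhdsWithin.2 hf'] with w h1 h2 h3
    exact hdiff w h1 (h2.differentiableWithinAt (by simp)) h3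
  have hfd : DifferentiableWithinAt ℝ (fderivWithin ℝ f s) s z.1 :=
    (hf.fderivWithin_right hs.uniqueDiffOn (m := 1) (by norm_num)
      hG.mem).differentiableWithinAt (by simp)
  have h3 := ((ContinuousLinearMap.precomp ℝ (ContinuousLinearMap.fst ℝ E ℝ)
      ).hasFDerivAt.comp_hasFDerivWithinAt _ (hasFDerivWithinAt_comp_fst hfd.hasFDerivWithinAt)).add
    ((ContinuousLinearMap.precomp ℝ (ContinuousLinearMap.snd ℝ E ℝ)
      ).hasFDerivAt.comp_hasFDerivWithinAt z
        ((hvd' z.2).hasFDerivAt.comp_hasFDerivWithinAt z hasFDerivWithinAt_snd))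
  have h4 := (h3.congr_of_eventuallyEq hev (hev.self_of_nhdsWithin hz)).fderivWithin
    (hs'.uniqueDiffOn z hz)
  rw [coordHessian, coordHessian, h4, hdiff z hz (hf.differentiableWithinAt (by simp)) hf',
    h.christoffel_eq hs' hG, liftChristoffel_apply]
  simp only [add_apply, ContinuousLinearMap.comp_apply, ContinuousLinearMap.coe_fst',
    ContinuousLinearMap.coe_snd', map_zero, add_zero, ContinuousLinearMap.precomp_apply]
  ring

end ProductCoordinates

/-! ### Smoothness of the coefficients of a Riemannian metric. -/

section SmoothMetric

variable {E : Type*} [NormedAddCommGroup E] [NormedSpace ℝ E]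
  {H : Type*} [TopologicalSpace H] {I : ModelWithCorners ℝ E H}
  {M : Type*} [TopologicalSpace M] [ChartedSpace H M]

theorem contDiffWithinAt_of_apply [FiniteDimensional ℝ E] {D F : Type*}
    [NormedAddCommGroup D] [NormedSpace ℝ D] [NormedAddCommGroup F] [NormedSpace ℝ F]
    {f : D → E →L[ℝ] F} {s : Set D} {n : ℕ∞ω} {y : D}
    (h : ∀ u, ContDiffWithinAt ℝ n (fun z => f z u) s y) : ContDiffWithinAt ℝ n f s y := by
  let e₁ := ContinuousLinearEquiv.ofFinrankEq
    (Module.finrank_fin_fun (n := Module.finrank ℝ E) ℝ).symm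
  let e₂ := (e₁.arrowCongr (1 : F ≃L[ℝ] F)).trans
    (ContinuousLinearEquiv.piRing (Fin (Module.finrank ℝ E)))
  rw [← Function.id_comp f, ← e₂.symm_comp_self]
  exact e₂.symm.contDiff.contDiffAt.comp_contDiffWithinAt y (contDiffWithinAt_pi.2 fun i => h _)

theorem chartForm_eq_symmL [IsManifold I 1 M] (g : BilinField I M) {x₁ : M} {y : E}
    (hy : y ∈ (extChartAt I x₁).target) (u w : E) :
    chartForm g x₁ y u w = g ((extChartAt I x₁).symm y)
      ((trivializationAt E (TangentSpace I) x₁).symmL ℝ ((extChartAt I x₁).symm y) u)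
      ((trivializationAt E (TangentSpace I) x₁).symmL ℝ ((extChartAt I x₁).symm y) w) := by
  have hx : (extChartAt I x₁).symm y ∈ (chartAt H x₁).source := by
    rw [← extChartAt_source I]
    exact (extChartAt I x₁).map_target hy
  rw [TangentBundle.symmL_trivializationAt hx, (extChartAt I x₁).right_inv hy]
  rfl

/-- The metric is smooth as a section of a bundle. Evaluating it on the local fields that the
tangent trivialization at `x₁` makes of constant vectors gives smooth functions, and these are its
coefficients in the chart. -/
theorem isSmoothMetric_inner [FiniteDimensional ℝ E] [IsManifold I ∞ M]
    (g : Bundle.ContMDiffRiemannianMetric I ∞ E (fun x : M => TangentSpace I x)) :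
    IsSmoothMetric (J := I) g.inner where
  inner x := ⟨g.symm x, fun u hu => g.pos x u hu⟩
  contDiff x₁ y hy := by
    have : IsManifold I 1 M := instIsManifoldOne
    refine ContDiffWithinAt.of_le (n := ∞) (contDiffWithinAt_of_apply fun u => contDiffWithinAt_of_apply fun w => ?_)
      (by norm_cast)
    have hx : (extChartAt I x₁).symm y ∈ (chartAt H x₁).source := by
      rw [← extChartAt_source I]
      exact (extChartAt I x₁).map_target hy
    have hs : ∀ a : E, ContMDiffAt I (I.prod 𝓘(ℝ, E)) ∞ (fun m : M =>
        Bundle.TotalSpace.mk' E (E := TangentSpace I) m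
          ((trivializationAt E (TangentSpace I) x₁).symmL ℝ m a)) ((extChartAt I x₁).symm y) := by
      intro a
      exact ((trivializationAt E (TangentSpace I) x₁).contMDiffAt_symmL (n := ∞) (IB := I)
        (by simpa using hx)).clm_bundle_apply (E₁ := Bundle.Trivial M E)
        (Bundle.contMDiffAt_totalSpace.2 ⟨contMDiffAt_id, contMDiffAt_const⟩)
    have h2 := (g.contMDiff ((extChartAt I x₁).symm y)).clm_bundle_apply₂
      (E₃ := Bundle.Trivial M ℝ) (hs u) (hs w)
    have h3 := (Bundle.contMDiffAt_totalSpace.1 h2).2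
    have h4 := (h3.comp_contMDiffWithinAt y
      (contMDiffWithinAt_extChartAt_symm_range (n := ∞) x₁ hy)).contDiffWithinAt
    refine h4.congr_of_eventuallyEq ?_ ?_
    · filter_upwards [extChartAt_target_mem_nhdsWithin_of_mem hy] with z hz
      exact chartForm_eq_symmL g.inner hz u w
    · exact chartForm_eq_symmL g.inner hy u w

end SmoothMetric

/-! ### The cylinder over M: metric, vertical field, Ricci tensor and Hessian. -/

section Product

variable {E : Type*} [NormedAddCommGroup E] [NormedSpace ℝ E]
  {H : Type*} [TopologicalSpace H] {I : ModelWithCorners ℝ E H}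
  {M : Type*} [TopologicalSpace M] [ChartedSpace H M]

theorem lineMetric_apply (t : ℝ) (a b : ℝ) : lineMetric t a b = a * b := by
  change inner ℝ a b = _
  simp [mul_comm]

theorem cylMetric_apply (g : BilinField I M) (x : M × ℝ)
    (a b : TangentSpace (I.prod 𝓘(ℝ, ℝ)) x) :
    cylMetric g x a b = g x.1 a.1 b.1 + (a.2 : ℝ) * (b.2 : ℝ) := by
  have h1 : mfderiv (I.prod 𝓘(ℝ, ℝ)) I Prod.fst x
      = ContinuousLinearMap.fst ℝ (TangentSpace I x.1) (TangentSpace 𝓘(ℝ, ℝ) x.2) := mfderiv_fst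
  have h2 : mfderiv (I.prod 𝓘(ℝ, ℝ)) 𝓘(ℝ, ℝ) Prod.snd x
      = ContinuousLinearMap.snd ℝ (TangentSpace I x.1) (TangentSpace 𝓘(ℝ, ℝ) x.2) := mfderiv_snd
  change g x.1 (mfderiv (I.prod 𝓘(ℝ, ℝ)) I Prod.fst x a) (mfderiv (I.prod 𝓘(ℝ, ℝ)) I Prod.fst x b)
    + lineMetric x.2 (mfderiv (I.prod 𝓘(ℝ, ℝ)) 𝓘(ℝ, ℝ) Prod.snd x a)
      (mfderiv (I.prod 𝓘(ℝ, ℝ)) 𝓘(ℝ, ℝ) Prod.snd x b) = _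
  rw [h1, h2]
  exact congrArg (_ + ·) (lineMetric_apply x.2 a.2 b.2)

theorem extChartAt_prod_real (x : M × ℝ) :
    extChartAt (I.prod 𝓘(ℝ, ℝ)) x = (extChartAt I x.1).prod (PartialEquiv.refl ℝ) := by
  rw [extChartAt_prod, extChartAt_model_space_eq_id]

variable [IsManifold I ∞ M]


omit [IsManifold I ∞ M] in
theorem extChartAt_prod_real_apply (x y : M × ℝ) :
    extChartAt (I.prod 𝓘(ℝ, ℝ)) x y = (extChartAt I x.1 y.1, y.2) := by
  rw [extChartAt_prod_real]; rfl

omit [IsManifold I ∞ M] in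
theorem mem_extChartAt_prod_real_source {x y : M × ℝ} :
    y ∈ (extChartAt (I.prod 𝓘(ℝ, ℝ)) x).source ↔ y.1 ∈ (extChartAt I x.1).source := by
  rw [extChartAt_prod_real]; simp

theorem chartDeriv_prod {x y : M × ℝ} (hy : y.1 ∈ (extChartAt I x.1).source)
    (a : TangentSpace (I.prod 𝓘(ℝ, ℝ)) y) : chartDeriv (I.prod 𝓘(ℝ, ℝ)) x y a
      = (chartDeriv I x.1 y.1 a.1, a.2) := by
  have : IsManifold I 1 M := instIsManifoldOne
  have h1 : HasMFDerivAt I 𝓘(ℝ, E) (extChartAt I x.1) y.1 (chartDeriv I x.1 y.1) := by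
    rw [extChartAt_source] at hy
    exact (mdifferentiableAt_extChartAt hy).hasMFDerivAt
  have h2 : HasMFDerivAt (I.prod 𝓘(ℝ, ℝ)) 𝓘(ℝ, E) (extChartAt I x.1 ∘ Prod.fst) y
      (chartDeriv I x.1 y.1 ∘L ContinuousLinearMap.fst ℝ (TangentSpace I y.1) ℝ) :=
    h1.comp y (hasMFDerivAt_fst (I' := 𝓘(ℝ, ℝ)) y)
  have h3 : HasMFDerivAt (I.prod 𝓘(ℝ, ℝ)) 𝓘(ℝ, E × ℝ)
      (fun y => ((extChartAt I x.1 ∘ Prod.fst) y, y.2)) y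
      ((chartDeriv I x.1 y.1 ∘L ContinuousLinearMap.fst ℝ (TangentSpace I y.1) ℝ).prod
        (ContinuousLinearMap.snd ℝ (TangentSpace I y.1) ℝ)) :=
    ⟨h2.1.prodMk continuousAt_snd,
      h2.2.prodMk (hasMFDerivAt_snd (I := I) (I' := 𝓘(ℝ, ℝ)) y).2⟩
  have e : (extChartAt (I.prod 𝓘(ℝ, ℝ)) x : M × ℝ → E × ℝ)
      = fun y => ((extChartAt I x.1 ∘ Prod.fst) y, y.2) := by
    funext y
    exact extChartAt_prod_real_apply x y
  rw [chartDeriv, e, h3.mfderiv]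
  rfl

theorem chartForm_cylMetric (g : BilinField I M) {x y : M × ℝ}
    (hy : y ∈ (extChartAt (I.prod 𝓘(ℝ, ℝ)) x).source) :
    chartForm (cylMetric g) x (extChartAt (I.prod 𝓘(ℝ, ℝ)) x y)
      = prodForm (chartForm g x.1 (extChartAt (I.prod 𝓘(ℝ, ℝ)) x y).1) := by
  have hy1 := mem_extChartAt_prod_real_source.1 hy
  refine ContinuousLinearMap.ext fun A => ContinuousLinearMap.ext fun B => ?_
  obtain ⟨a, rfl⟩ := chartDeriv_surjective hy A
  obtain ⟨b, rfl⟩ := chartDeriv_surjective hy B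
  rw [chartForm_chartDeriv _ hy, prodForm_apply, chartDeriv_prod hy1, chartDeriv_prod hy1,
    extChartAt_prod_real_apply]
  refine (cylMetric_apply g y a b).trans ?_
  exact congrArg (· + _) (chartForm_chartDeriv g hy1 a.1 b.1).symm

theorem isLineProduct_cylMetric (g : BilinField I M) {x : M × ℝ} {w : E × ℝ}
    (hw : w ∈ (extChartAt (I.prod 𝓘(ℝ, ℝ)) x).target) :
    IsLineProduct (chartForm (cylMetric g) x) (chartForm g x.1) (range I) w := by
  have h := extChartAt_target_mem_nhdsWithin_of_mem hw
  rw [ModelWithCorners.range_prod, modelWithCornersSelf_coe, range_id] at h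
  filter_upwards [h] with z hz
  have := chartForm_cylMetric g ((extChartAt (I.prod 𝓘(ℝ, ℝ)) x).map_target hz)
  rwa [(extChartAt (I.prod 𝓘(ℝ, ℝ)) x).right_inv hz] at this

omit [IsManifold I ∞ M] in
theorem range_prod_real : range (I.prod 𝓘(ℝ, ℝ)) = range I ×ˢ (univ : Set ℝ) := by
  rw [ModelWithCorners.range_prod, modelWithCornersSelf_coe, range_id]

omit [IsManifold I ∞ M] in
theorem fst_mem_target {x : M × ℝ} {w : E × ℝ}
    (hw : w ∈ (extChartAt (I.prod 𝓘(ℝ, ℝ)) x).target) : w.1 ∈ (extChartAt I x.1).target := by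
  rw [extChartAt_prod_real] at hw
  exact hw.1

theorem IsSmoothMetric.cylMetric {g : BilinField I M} (hg : IsSmoothMetric g) :
    IsSmoothMetric (cylMetric g) where
  inner x := by
    have h := (hg.inner x.1).prodForm
    have e : (WeightedGeom.cylMetric g x : E × ℝ →L[ℝ] E × ℝ →L[ℝ] ℝ)
        = prodForm (E := E) (g x.1) := by
      refine ContinuousLinearMap.ext fun A => ContinuousLinearMap.ext fun B => ?_
      exact (cylMetric_apply g x A B).trans (prodForm_apply (E := E) (g x.1) A B).symm
    exact e ▸ h
  contDiff x w hw := by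
    rw [range_prod_real]
    exact ((isLineProduct_cylMetric g hw).isLocalMetric
      (hg.isLocalMetric (fst_mem_target hw))).contDiff

theorem isParallelField_vertical [FiniteDimensional ℝ E] {g : BilinField I M}
    (hg : IsSmoothMetric g) : IsParallelField (cylMetric g) (vertical I) (0, 1) where
  chartDeriv_eq x₀ x hx := by
    rw [chartDeriv_prod (mem_extChartAt_prod_real_source.1 hx)]
    exact Prod.ext (map_zero _) rfl
  parallel x := by
    have hx := mem_extChartAt_target (I := I.prod 𝓘(ℝ, ℝ)) x
    have hs := isRegion_range (I.prod 𝓘(ℝ, ℝ))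
    rw [range_prod_real] at hs ⊢
    exact (isLineProduct_cylMetric g hx).isParallel hs (hg.isLocalMetric (fst_mem_target hx))
  curvature x u w := by
    have hx := mem_extChartAt_target (I := I.prod 𝓘(ℝ, ℝ)) x
    have hs := isRegion_range (I.prod 𝓘(ℝ, ℝ))
    rw [range_prod_real] at hs ⊢
    exact (isLineProduct_cylMetric g hx).curvatureEnd_vertical (isRegion_range I) hs
      (hg.isLocalMetric (fst_mem_target hx)) u w

theorem ricci_cylMetric [FiniteDimensional ℝ E] {g : BilinField I M} (hg : IsSmoothMetric g)
    (x : M × ℝ) (a b : TangentSpace (I.prod 𝓘(ℝ, ℝ)) x) :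
    ricci (cylMetric g) x a b = ricci g x.1 a.1 b.1 := by
  have hx := mem_extChartAt_target (I := I.prod 𝓘(ℝ, ℝ)) x
  have hs := isRegion_range (I.prod 𝓘(ℝ, ℝ))
  change coordRicci (chartForm (cylMetric g) x) (range (I.prod 𝓘(ℝ, ℝ)))
    (extChartAt (I.prod 𝓘(ℝ, ℝ)) x x) a b
    = coordRicci (chartForm g x.1) (range I) (extChartAt I x.1 x.1) a.1 b.1
  rw [range_prod_real] at hs ⊢
  have := (isLineProduct_cylMetric g hx).coordRicci_eq (isRegion_range I) hs
      (hg.isLocalMetric (fst_mem_target hx)) a b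
  rw [extChartAt_prod_real_apply] at this ⊢
  exact this

theorem hessian_prodWeight [FiniteDimensional ℝ E] {g : BilinField I M} (hg : IsSmoothMetric g)
    {h : M → ℝ} (hh : ContMDiff I 𝓘(ℝ, ℝ) ∞ h) {v : ℝ → ℝ} (hv : ContDiff ℝ ∞ v)
    (x : M × ℝ) (a b : TangentSpace (I.prod 𝓘(ℝ, ℝ)) x) :
    hessian (cylMetric g) (prodWeight h v) x a b
      = hessian g h x.1 a.1 b.1 + fderiv ℝ (fderiv ℝ v) x.2 a.2 b.2 := by
  have hx := mem_extChartAt_target (I := I.prod 𝓘(ℝ, ℝ)) x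
  have hs := isRegion_range (I.prod 𝓘(ℝ, ℝ))
  change coordHessian (chartForm (cylMetric g) x) (range (I.prod 𝓘(ℝ, ℝ)))
    (chartFun (I.prod 𝓘(ℝ, ℝ)) (prodWeight h v) x) (extChartAt (I.prod 𝓘(ℝ, ℝ)) x x) a b
    = coordHessian (chartForm g x.1) (range I) (chartFun I h x.1) (extChartAt I x.1 x.1) a.1 b.1
      + fderiv ℝ (fderiv ℝ v) x.2 a.2 b.2
  rw [range_prod_real] at hs ⊢
  have := (isLineProduct_cylMetric g hx).coordHessian_eq (isRegion_range I) hs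
      (hg.isLocalMetric (fst_mem_target hx)) (contDiffWithinAt_chartFun hh (fst_mem_target hx))
      (hv.of_le (by norm_cast)) (f' := chartFun (I.prod 𝓘(ℝ, ℝ)) (prodWeight h v) x) (by
        refine Eventually.of_forall fun w => ?_
        rw [chartFun, chartFun, prodWeight, extChartAt_prod_real]
        rfl) a b
  rw [extChartAt_prod_real_apply] at this ⊢
  exact this

theorem ricciBE_prodWeight [FiniteDimensional ℝ E] {g : BilinField I M} (hg : IsSmoothMetric g)
    {h : M → ℝ} (hh : ContMDiff I 𝓘(ℝ, ℝ) ∞ h) {v : ℝ → ℝ} (hv : ContDiff ℝ ∞ v)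
    (x : M × ℝ) (a b : TangentSpace (I.prod 𝓘(ℝ, ℝ)) x) :
    ricciBE (cylMetric g) (prodWeight h v) x a b
      = ricciBE g h x.1 a.1 b.1 - fderiv ℝ (fderiv ℝ v) x.2 a.2 b.2 := by
  refine (congrArg₂ (· - ·) (ricci_cylMetric hg x a b) (hessian_prodWeight hg hh hv x a b)).trans ?_
  exact (sub_sub _ _ _).symm

theorem christoffelAt_cylMetric [FiniteDimensional ℝ E] {g : BilinField I M}
    (hg : IsSmoothMetric g) (x : M × ℝ) (a b : TangentSpace (I.prod 𝓘(ℝ, ℝ)) x) :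
    christoffelAt (cylMetric g) x a b = (christoffelAt g x.1 a.1 b.1, (0 : ℝ)) := by
  have hx := mem_extChartAt_target (I := I.prod 𝓘(ℝ, ℝ)) x
  have hs := isRegion_range (I.prod 𝓘(ℝ, ℝ))
  rw [christoffelAt, christoffelAt]
  rw [range_prod_real] at hs ⊢
  rw [(isLineProduct_cylMetric g hx).christoffel_eq hs (hg.isLocalMetric (fst_mem_target hx)),
    extChartAt_prod_real_apply]
  rfl

end Product

/-! ### The weighted line. -/

section Line

theorem chartForm_lineMetric (t y : ℝ) :
    chartForm lineMetric t y = (innerSL ℝ : ℝ →L[ℝ] ℝ →L[ℝ] ℝ) := by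
  refine ContinuousLinearMap.ext fun a => ContinuousLinearMap.ext fun b => ?_
  have h := chartForm_chartDeriv lineMetric (x₁ := t) (x := y) (J := 𝓘(ℝ, ℝ))
    (by rw [extChartAt_model_space_eq_id]; trivial) a b
  have e : ∀ a : ℝ, chartDeriv 𝓘(ℝ, ℝ) t y a = a := by
    intro a
    rw [chartDeriv, extChartAt_model_space_eq_id]
    change mfderiv 𝓘(ℝ, ℝ) 𝓘(ℝ, ℝ) id y a = a
    rw [mfderiv_id]
    rfl
  have e1 := e a
  have e2 := e b
  rw [extChartAt_model_space_eq_id] at h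
  erw [e1, e2] at h
  exact h

/-- The charts of ℝ are the identity, so the metric is constant in them: no Christoffel symbols, no
curvature, and the Hessian is the second derivative. -/
theorem ricciBE_lineMetric (v : ℝ → ℝ) (t : ℝ) (a b : ℝ) :
    ricciBE lineMetric v t a b = - fderiv ℝ (fderiv ℝ v) t a b := by
  have e : chartForm lineMetric t = fun _ => (innerSL ℝ : ℝ →L[ℝ] ℝ →L[ℝ] ℝ) :=
    funext (chartForm_lineMetric t)
  have hlow : ∀ y, christoffelLow (fun _ : ℝ => (innerSL ℝ : ℝ →L[ℝ] ℝ →L[ℝ] ℝ)) univ y = 0 := by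
    intro y
    refine ContinuousLinearMap.ext fun a => ContinuousLinearMap.ext fun b =>
      ContinuousLinearMap.ext fun c => ?_
    rw [christoffelLow_apply]
    simp
  have hΓ : christoffel (fun _ : ℝ => (innerSL ℝ : ℝ →L[ℝ] ℝ →L[ℝ] ℝ)) univ = fun _ => 0 := by
    funext y
    refine ContinuousLinearMap.ext fun a => ContinuousLinearMap.ext fun b => ?_
    rw [christoffel_apply, hlow]
    simp
  have hR : ∀ y a b, coordRicci (fun _ : ℝ => (innerSL ℝ : ℝ →L[ℝ] ℝ →L[ℝ] ℝ)) univ y a b = 0 := by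
    intro y a b
    have : curvatureEnd (fun _ : ℝ => (innerSL ℝ : ℝ →L[ℝ] ℝ →L[ℝ] ℝ)) univ y a b = 0 := by
      refine ContinuousLinearMap.ext fun u => ?_
      rw [curvatureEnd_apply, hΓ]
      simp
    rw [coordRicci, this]
    simp
  have hv : chartFun 𝓘(ℝ, ℝ) v t = v := by
    funext y
    rw [chartFun, extChartAt_model_space_eq_id]
    rfl
  have hx : extChartAt 𝓘(ℝ, ℝ) t t = t := by
    rw [extChartAt_model_space_eq_id]
    rfl
  change coordRicci (chartForm lineMetric t) (range 𝓘(ℝ, ℝ)) (extChartAt 𝓘(ℝ, ℝ) t t) a b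
    - coordHessian (chartForm lineMetric t) (range 𝓘(ℝ, ℝ)) (chartFun 𝓘(ℝ, ℝ) v t)
      (extChartAt 𝓘(ℝ, ℝ) t t) a b = _
  rw [e, modelWithCornersSelf_coe, range_id, hR, coordHessian, hΓ, hv, hx]
  simp [fderivWithin_univ]

end Line

/-! ### The angle function as the vertical component of the normal. -/

section Angle

variable {E : Type*} [NormedAddCommGroup E] [NormedSpace ℝ E]
  {H : Type*} [TopologicalSpace H] {I : ModelWithCorners ℝ E H}
  {M : Type*} [TopologicalSpace M] [ChartedSpace H M]
  {E₀ : Type*} [NormedAddCommGroup E₀] [NormedSpace ℝ E₀]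
  {H₀ : Type*} [TopologicalSpace H₀] {I₀ : ModelWithCorners ℝ E₀ H₀}
  {S : Type*} [TopologicalSpace S] [ChartedSpace H₀ S]
  {F : S → M × ℝ} {N : ∀ p, TangentSpace (I.prod 𝓘(ℝ, ℝ)) (F p)}

omit [TopologicalSpace S] in
theorem angle_eq (g : BilinField I M) (p : S) : angle g F N p = (N p).2 := by
  refine (cylMetric_apply g (F p) (vertical I (F p)) (N p)).trans ?_
  have h : ∀ b : TangentSpace I (F p).1, ∀ r : ℝ, g (F p).1 (0 : TangentSpace I (F p).1) b
      + (1 : ℝ) * r = r := by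
    intro b r
    rw [map_zero, zero_apply, zero_add, one_mul]
  exact h (N p).1 (N p).2

theorem horizontal_eq {g : BilinField I M} [IsManifold I ∞ M]
    (hN : IsGaussMap I₀ F (cylMetric g) N) (p : S) :
    g (F p).1 (N p).1 (N p).1 = 1 - angle g F N p ^ 2 := by
  have h := hN.unit p
  rw [angle_eq]
  have h2 := (cylMetric_apply g (F p) (N p) (N p)).symm.trans h
  linear_combination h2

variable [IsManifold I ∞ M] [IsManifold I₀ ∞ S]

omit [IsManifold I₀ ∞ S] in
theorem contMDiff_angle {g : BilinField I M} (hN : IsGaussMap I₀ F (cylMetric g) N) :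
    ContMDiff I₀ 𝓘(ℝ, ℝ) ∞ (angle g F N) := by
  intro p
  have h1 := contMDiffAt_chartField hN.smooth p
  have h2 : ContMDiffAt I₀ 𝓘(ℝ, ℝ) ∞ (fun q => (chartField F N p q).2) p :=
    (ContinuousLinearMap.snd ℝ E ℝ).contMDiff.contMDiffAt.comp p h1
  have hF : ContinuousAt F p :=
    ((Bundle.contMDiffAt_totalSpace.1 (hN.smooth p)).1).continuousAt
  refine h2.congr_of_eventuallyEq ?_
  filter_upwards [hF.eventually ((isOpen_extChartAt_source (F p)).mem_nhds
    (mem_extChartAt_source (I := I.prod 𝓘(ℝ, ℝ)) (F p)))] with q hq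
  rw [angle_eq, chartField_eq, chartDeriv_prod (mem_extChartAt_prod_real_source.1 hq)]

omit [IsManifold I ∞ M] [IsManifold I₀ ∞ S] in
theorem mfderiv_snd_comp (hF : MDifferentiable I₀ (I.prod 𝓘(ℝ, ℝ)) F) (p : S)
    (u : TangentSpace I₀ p) :
    mfderiv I₀ 𝓘(ℝ, ℝ) (fun q => (F q).2) p u = (mfderiv I₀ (I.prod 𝓘(ℝ, ℝ)) F p u).2 := by
  have h := mfderiv_comp p (mdifferentiableAt_snd (I := I) (I' := 𝓘(ℝ, ℝ)) (x := F p)) (hF p)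
  have e : (fun q => (F q).2) = Prod.snd ∘ F := rfl
  rw [e, h, mfderiv_snd]
  rfl

end Angle

/-! ### The drifted Laplacian of the angle for a product weight. -/

section DriftedLaplacian

variable {E : Type*} [NormedAddCommGroup E] [NormedSpace ℝ E] [FiniteDimensional ℝ E]
  {H : Type*} [TopologicalSpace H] {I : ModelWithCorners ℝ E H}
  {M : Type*} [TopologicalSpace M] [ChartedSpace H M] [IsManifold I ∞ M]
  {H₀ : Type*} [TopologicalSpace H₀] {I₀ : ModelWithCorners ℝ E H₀}
  {S : Type*} [TopologicalSpace S] [ChartedSpace H₀ S] [IsManifold I₀ ∞ S]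
  {F : S → M × ℝ} {N : ∀ p, TangentSpace (I.prod 𝓘(ℝ, ℝ)) (F p)} {g : BilinField I M}

theorem fderiv_fderiv_apply (v : ℝ → ℝ) (t x y : ℝ) :
    fderiv ℝ (fderiv ℝ v) t x y = x * y * fderiv ℝ (fderiv ℝ v) t 1 1 := by
  have : fderiv ℝ (fderiv ℝ v) t (x • 1) (y • 1) = x * y * fderiv ℝ (fderiv ℝ v) t 1 1 := by
    rw [map_smul, map_smul, smul_apply, smul_eq_mul, smul_eq_mul]
    ring
  simpa using this

omit [TopologicalSpace S] in
theorem ricciBE_cylMetric_normal (hg : IsSmoothMetric g) {h : M → ℝ}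
    (hh : ContMDiff I 𝓘(ℝ, ℝ) ∞ h) {v : ℝ → ℝ} (hv : ContDiff ℝ ∞ v) (p : S) :
    ricciBE (cylMetric g) (prodWeight h v) (F p) (N p) (N p)
      = ricciBE g h (F p).1 (N p).1 (N p).1
        - angle g F N p ^ 2 * fderiv ℝ (fderiv ℝ v) (F p).2 1 1 := by
  rw [ricciBE_prodWeight hg hh hv, angle_eq]
  refine congrArg (_ - ·) ((fderiv_fderiv_apply v _ (N p).2 (N p).2).trans ?_)
  ring

omit [FiniteDimensional ℝ E] [IsManifold I ∞ M] in
theorem ricciBE_zero (g : BilinField I M) (h : M → ℝ) (x : M) :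
    ricciBE g h x (0 : TangentSpace I x) (0 : TangentSpace I x) = 0 := by
  change coordRicci (chartForm g x) (range I) (extChartAt I x x) (0 : E) (0 : E)
    - coordHessian (chartForm g x) (range I) (chartFun I h x) (extChartAt I x x) (0 : E) (0 : E) = 0
  simp [coordRicci, coordHessian, curvatureEnd]

theorem ricciBE_cylMetric_vertical (hg : IsSmoothMetric g) {h : M → ℝ}
    (hh : ContMDiff I 𝓘(ℝ, ℝ) ∞ h) {v : ℝ → ℝ} (hv : ContDiff ℝ ∞ v) (x : M × ℝ) :
    ricciBE (cylMetric g) (prodWeight h v) x (vertical I x) (vertical I x)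
      = - fderiv ℝ (fderiv ℝ v) x.2 1 1 :=
  (ricciBE_prodWeight hg hh hv x (vertical I x) (vertical I x)).trans
    ((congrArg (· - _) (ricciBE_zero g h x.1)).trans (zero_sub _))

/-- The weight in the t-direction enters twice: Ric_ψ(N, N) contains −θ² v'', and ∇²ψ(ξ, N) = θ v''.
Together they give the factor (1 − θ²) v'', which can be weighed against Ric_h of the horizontal
part, of squared length 1 − θ². -/
theorem driftedLaplacian_angle_cylMetric (hg : IsSmoothMetric g)
    (hF : IsSmoothImmersion I₀ (I.prod 𝓘(ℝ, ℝ)) F) (hN : IsGaussMap I₀ F (cylMetric g) N)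
    {h : M → ℝ} (hh : ContMDiff I 𝓘(ℝ, ℝ) ∞ h) {v : ℝ → ℝ} (hv : ContDiff ℝ ∞ v)
    {a : ℝ} (hH : ∀ p, weightedMeanCurvature I₀ F (cylMetric g) (prodWeight h v) N p = a) (p : S) :
    driftedLaplacian (pullback I₀ F (cylMetric g)) (prodWeight h v ∘ F) (angle g F N) p
      = - angle g F N p * (ricciBE g h (F p).1 (N p).1 (N p).1
          + (1 - angle g F N p ^ 2) * fderiv ℝ (fderiv ℝ v) (F p).2 1 1
        + traceForm (shapeOp (chartForm (cylMetric g) (F p))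
            (chartMap I₀ (I.prod 𝓘(ℝ, ℝ)) F p (F p)) (chartFieldMap I₀ F N p) (range I₀)
            (range (I.prod 𝓘(ℝ, ℝ))) (extChartAt I₀ p p)
          ∘L shapeOp (chartForm (cylMetric g) (F p))
            (chartMap I₀ (I.prod 𝓘(ℝ, ℝ)) F p (F p)) (chartFieldMap I₀ F N p) (range I₀)
            (range (I.prod 𝓘(ℝ, ℝ))) (extChartAt I₀ p p))) := by
  have hψ : ContMDiff (I.prod 𝓘(ℝ, ℝ)) 𝓘(ℝ, ℝ) ∞ (prodWeight h v) :=
    (hh.comp contMDiff_fst).add (hv.contMDiff.comp contMDiff_snd)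
  rw [driftedLaplacian_angle hg.cylMetric hF hN (by simp) (isParallelField_vertical hg) hψ hH
    (θ := angle g F N) (fun _ => rfl) ((contMDiff_angle hN).mdifferentiable (by simp)) p]
  have e2 := hessian_prodWeight hg hh hv (F p) (vertical I (F p)) (N p)
  have e3 : hessian g h (F p).1 (vertical I (F p)).1 (N p).1 = 0 := by
    change coordHessian _ _ _ _ (0 : E) _ = 0
    simp [coordHessian]
  have e5 := angle_eq (F := F) (N := N) g p
  have e6 : hessian (cylMetric g) (prodWeight h v) (F p) (vertical I (F p)) (N p)
      = angle g F N p * fderiv ℝ (fderiv ℝ v) (F p).2 1 1 := by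
    rw [e2, e3, e5]
    refine (zero_add _).trans ((fderiv_fderiv_apply v _ 1 (N p).2).trans ?_)
    ring
  rw [e6, ricciBE_cylMetric_normal hg hh hv]
  ring

end DriftedLaplacian

/-! ### Calculus at the boundary of a half-space. -/

section HalfSpace

variable {E : Type*} [NormedAddCommGroup E] [NormedSpace ℝ E] {ℓ : E →L[ℝ] ℝ} {y : E}

/-- The form may be zero, in which case the half-space is everything and there is no boundary. If y
with ℓ y = 0 were interior, ℓ would have a local minimum there, hence be zero. -/
theorem mem_frontier_halfSpace_iff : y ∈ frontier {z | 0 ≤ ℓ z} ↔ ℓ y = 0 ∧ ℓ ≠ 0 := by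
  constructor
  · intro h
    refine ⟨(frontier_le_subset_eq continuous_const ℓ.continuous h).symm, ?_⟩
    rintro rfl
    simp at h
  · rintro ⟨h0, h1⟩
    refine ⟨subset_closure h0.ge, fun h => h1 ?_⟩
    have h2 : IsLocalMin ℓ y := by
      filter_upwards [mem_interior_iff_mem_nhds.1 h] with z hz
      rw [h0]
      exact hz
    simpa using h2.fderiv_eq_zero

theorem mem_posTangentConeAt_halfSpace (hy : ℓ y = 0) {w : E} (hw : 0 ≤ ℓ w) :
    w ∈ posTangentConeAt {z | 0 ≤ ℓ z} y := by
  apply mem_posTangentConeAt_of_segment_subset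
  rintro z ⟨a, b, ha, hb, hab, rfl⟩
  change 0 ≤ ℓ (a • y + b • (y + w))
  simp only [map_add, map_smul, hy, smul_eq_mul]
  nlinarith [mul_nonneg hb hw]

theorem mem_posTangentConeAt_hyperplane (hy : ℓ y = 0) {w : E} (hw : ℓ w = 0) :
    w ∈ posTangentConeAt {z | ℓ z = 0} y := by
  apply mem_posTangentConeAt_of_segment_subset
  rintro z ⟨a, b, ha, hb, hab, rfl⟩
  change ℓ (a • y + b • (y + w)) = 0
  simp [hy, hw]

/-- At a minimum over the half-space f' is nonnegative on inward vectors. On the hyperplane both w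
and −w are inward, so f' vanishes there and is a multiple of ℓ. -/
theorem exists_eq_mul_of_hasFDerivWithinAt {f : E → ℝ} {f' : E →L[ℝ] ℝ}
    (hf : HasFDerivWithinAt f f' {z | 0 ≤ ℓ z} y) (hy : ℓ y = 0) (h0 : f y = 0)
    (hpos : ∀ᶠ z in 𝓝[{z | 0 ≤ ℓ z}] y, 0 ≤ f z) : ∃ k : ℝ, 0 ≤ k ∧ ∀ w, f' w = k * ℓ w := by
  have hmin : IsLocalMinOn f {z | 0 ≤ ℓ z} y := by
    filter_upwards [hpos] with z hz
    rwa [h0]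
  have hn : ∀ w, 0 ≤ ℓ w → 0 ≤ f' w := fun w hw =>
    hmin.hasFDerivWithinAt_nonneg hf (mem_posTangentConeAt_halfSpace hy hw)
  have hz : ∀ w, ℓ w = 0 → f' w = 0 := by
    intro w hw
    have h1 := hn w hw.ge
    have h2 := hn (-w) (by simp [hw])
    rw [map_neg] at h2
    linarith
  by_cases hℓ : ∀ w, ℓ w = 0
  · exact ⟨0, le_rfl, fun w => by rw [hz w (hℓ w), zero_mul]⟩
  · push Not at hℓ
    obtain ⟨e, he⟩ := hℓ
    have hk : ∀ w, f' w = f' ((ℓ e)⁻¹ • e) * ℓ w := by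
      intro w
      have h1 := hz (w - ℓ w • ((ℓ e)⁻¹ • e)) (by simp [he])
      rw [map_sub, map_smul, smul_eq_mul] at h1
      linarith
    exact ⟨_, hn _ (by simp [he]), hk⟩

theorem hasFDerivWithinAt_apply_eq_zero {f : E → ℝ} {f' : E →L[ℝ] ℝ}
    (hf : HasFDerivWithinAt f f' {z | 0 ≤ ℓ z} y) (hy : ℓ y = 0)
    (h0 : ∀ᶠ z in 𝓝[{z | 0 ≤ ℓ z}] y, ℓ z = 0 → f z = 0) {w : E} (hw : ℓ w = 0) : f' w = 0 := by
  have hsub : {z | ℓ z = 0} ⊆ {z | 0 ≤ ℓ z} := fun z hz => hz.ge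
  have hy0 : f y = 0 := h0.self_of_nhdsWithin (hsub hy) hy
  have hmin : IsLocalMinOn f {z | ℓ z = 0} y := by
    filter_upwards [nhdsWithin_mono y hsub h0, self_mem_nhdsWithin] with z hz hz'
    rw [hy0, hz hz']
  have h1 := hmin.hasFDerivWithinAt_nonneg (hf.mono hsub) (mem_posTangentConeAt_hyperplane hy hw)
  have h2 := hmin.hasFDerivWithinAt_nonneg (hf.mono hsub)
    (mem_posTangentConeAt_hyperplane hy (w := -w) (by simp [hw]))
  rw [map_neg] at h2
  linarith

end HalfSpace

/-! ### The conormal derivative of the angle in coordinates. -/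

section LocalFreeBoundary

variable {E : Type*} [NormedAddCommGroup E] [NormedSpace ℝ E] [FiniteDimensional ℝ E]
  {E' : Type*} [NormedAddCommGroup E'] [NormedSpace ℝ E'] [FiniteDimensional ℝ E']
  {G' : E' → E' →L[ℝ] E' →L[ℝ] ℝ} {φ n : E → E'} {ℓ : E →L[ℝ] ℝ} {ℓ' : E' →L[ℝ] ℝ} {y : E}

omit [FiniteDimensional ℝ E] [FiniteDimensional ℝ E'] in
theorem IsLocalMap.exists_bdryForm_eq (hφ : IsLocalMap φ {z | 0 ≤ ℓ z} {z | 0 ≤ ℓ' z} y)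
    (hy : ℓ y = 0) (hy' : ℓ' (φ y) = 0) :
    ∃ k : ℝ, 0 ≤ k ∧ ∀ w, ℓ' (fderivWithin ℝ φ {z | 0 ≤ ℓ z} y w) = k * ℓ w :=
  exists_eq_mul_of_hasFDerivWithinAt (ℓ'.hasFDerivAt.comp_hasFDerivWithinAt y hφ.hasFDeriv) hy hy'
    hφ.maps

/-- The derivative of the angle function with a parallel field along the conormal. -/
theorem IsLocalHypersurface.angle_conormal
    (h : IsLocalHypersurface G' φ n {z | 0 ≤ ℓ z} {z | 0 ≤ ℓ' z} y)
    (hy : ℓ y = 0) (hy' : ℓ' (φ y) = 0)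
    (hn : ∀ᶠ z in 𝓝[{z | 0 ≤ ℓ z}] y, ℓ z = 0 → ℓ' (n z) = 0) {ξ : E'}
    (hξ : ∀ u, christoffel G' {z | 0 ≤ ℓ' z} (φ y) u ξ = 0) (hξ' : ℓ' ξ = 0)
    {u : E} {m : ℝ} (hu : u ≠ 0)
    (hm : ∀ X, G' (φ y) (fderivWithin ℝ φ {z | 0 ≤ ℓ z} y u) X = m * ℓ' X) :
    G' (φ y) ξ (covDer G' φ n {z | 0 ≤ ℓ z} {z | 0 ≤ ℓ' z} y u)
      = - G' (φ y) ξ (n y) * G' (φ y) (christoffel G' {z | 0 ≤ ℓ' z} (φ y) (n y) (n y))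
          (fderivWithin ℝ φ {z | 0 ≤ ℓ z} y u) := by
  obtain ⟨k, -, hk⟩ := h.map.exists_bdryForm_eq hy hy'
  have hB := h.localMetric.innerForm
  set T := tangProj G' φ {z | 0 ≤ ℓ z} y ξ with hT
  have hny := hn.self_of_nhdsWithin h.mem hy
  have hdec := h.decomp ξ
  rw [← hT] at hdec
  -- If k = 0, the vector dφ u, dual to m ℓ', would have length zero.
  have hk0 : k ≠ 0 := by
    rintro rfl
    have := hm (fderivWithin ℝ φ {z | 0 ≤ ℓ z} y u)
    rw [hk, zero_mul, mul_zero] at this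
    exact hu (hB.eq_zero this)
  -- ξ and n are tangent to the ambient boundary, hence so is dφ T = ξ − θ n, and T is tangent to
  -- the boundary of the hypersurface.
  have hℓT : ℓ T = 0 := by
    have h1 := congrArg ℓ' hdec
    rw [map_add, map_smul, hny, smul_zero, add_zero, hk, hξ'] at h1
    exact (mul_eq_zero.1 h1).resolve_left hk0
  -- ℓ'(n) vanishes along the boundary, so its derivative in the tangential direction T does too.
  -- Only the Christoffel term of D_T n survives pairing with dφ u.
  have hdn : ℓ' (fderivWithin ℝ n {z | 0 ≤ ℓ z} y T) = 0 :=
    hasFDerivWithinAt_apply_eq_zero (ℓ'.hasFDerivAt.comp_hasFDerivWithinAt y h.hasFDeriv_field) hy hn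
      hℓT
  -- Symmetry of S moves the derivative from the conormal direction u to T.
  have hswap : G' (φ y) ξ (covDer G' φ n {z | 0 ≤ ℓ z} {z | 0 ≤ ℓ' z} y u)
      = G' (φ y) (fderivWithin ℝ φ {z | 0 ≤ ℓ z} y u)
          (covDer G' φ n {z | 0 ≤ ℓ z} {z | 0 ≤ ℓ' z} y T) := by
    have h1 := h.shapeOp_symm u T
    rw [h.shapeOp_spec, h.shapeOp_spec, neg_inj] at h1
    rw [h.metric.innerForm.symm _ (covDer _ _ _ _ _ _ T), ← h1]
    conv_lhs => rw [← hdec]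
    rw [map_add, map_smul, add_apply, smul_apply, h.metric.innerForm.symm (n y), h.covDer_normal,
      smul_zero, add_zero, h.metric.innerForm.symm]
  -- As ξ is parallel, Γ(n, dφ T) = −θ Γ(n, n), whose pairing with the inner normal is −θ II(n, n).
  have hBT : fderivWithin ℝ φ {z | 0 ≤ ℓ z} y T = ξ - G' (φ y) ξ (n y) • n y :=
    eq_sub_of_add_eq hdec
  rw [hswap, h.metric.innerForm.symm (christoffel _ _ _ _ _), hm, hm, covDer_apply, map_add, hdn,
    h.metric.christoffel_symm h.region', hBT, map_sub, hξ, map_smul, zero_sub, map_neg, map_smul]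
  simp only [smul_eq_mul]
  ring

end LocalFreeBoundary

/-! ### Boundary points and the inner unit normal. -/

section Boundary

variable {E : Type*} [NormedAddCommGroup E] [NormedSpace ℝ E]
  {H : Type*} [TopologicalSpace H] {I : ModelWithCorners ℝ E H} [hI : HalfSpaceModel I]
  {S : Type*} [TopologicalSpace S] [ChartedSpace H S]

/-- Boundary points are defined by the chart centred at them; that interior points can be recognised
in any chart of the atlas makes those near p visible in the chart at p. -/
theorem mem_boundary_iff [IsManifold I 1 S] {p q : S} (hq : q ∈ (extChartAt I p).source) :
    q ∈ I.boundary S ↔ hI.ℓ (extChartAt I p q) = 0 ∧ hI.ℓ ≠ 0 := by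
  have hz := (extChartAt I p).map_source hq
  have h1 : I.IsInteriorPoint q ↔ extChartAt I p q ∈ interior (extChartAt I p).target := by
    rw [extChartAt_source] at hq
    exact I.isInteriorPoint_iff_of_mem_atlas one_ne_zero (chart_mem_atlas H p) hq
  have h2 : extChartAt I p q ∈ interior (extChartAt I p).target
      ↔ extChartAt I p q ∈ interior (range I) := by
    refine ⟨fun h => interior_mono (extChartAt_target_subset_range p) h, fun h => ?_⟩
    rw [mem_interior_iff_mem_nhds] at h ⊢
    have := extChartAt_target_mem_nhdsWithin_of_mem hz
    rwa [nhdsWithin_eq_nhds.2 h] at this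
  have h3 : extChartAt I p q ∈ closure (range I) :=
    subset_closure (extChartAt_target_subset_range p hz)
  rw [← mem_frontier_halfSpace_iff, ← hI.range_eq, ← I.compl_interior, mem_compl_iff]
  change ¬ I.IsInteriorPoint q ↔ _
  rw [h1, h2]
  exact ⟨fun h => ⟨h3, h⟩, fun h => h.2⟩

theorem ℓ_ne_zero_of_mem_boundary {p : S} (hp : p ∈ I.boundary S) : hI.ℓ ≠ 0 := by
  have h : extChartAt I p p ∈ frontier (range I) := hp
  rw [hI.range_eq] at h
  exact (mem_frontier_halfSpace_iff.1 h).2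

theorem ℓ_eq_zero_of_mem_boundary {p : S} (hp : p ∈ I.boundary S) :
    hI.ℓ (extChartAt I p p) = 0 := by
  have h : extChartAt I p p ∈ frontier (range I) := hp
  rw [hI.range_eq] at h
  exact (mem_frontier_halfSpace_iff.1 h).1

/-- The inner unit normal is dual to a positive multiple of the form defining the boundary. -/
theorem innerNormal_spec [FiniteDimensional ℝ E] {g : BilinField I S} {p : S}
    (hg : IsInnerForm (E := E) (g p)) (hp : p ∈ I.boundary S) :
    ∃ m : ℝ, 0 < m ∧ (∀ w, g p (innerNormal g p) w = m * bdryForm p w) ∧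
      g p (innerNormal g p) (innerNormal g p) = 1 := by
  have hinv : ∀ w : TangentSpace I p, g p ((g p).inverse (bdryForm p)) w = bdryForm p w :=
    fun w => hg.apply_inverse (hI.ℓ) w
  have hpos : 0 < bdryForm p ((g p).inverse (bdryForm p)) := by
    have hne : ((g p).inverse (bdryForm p) : E) ≠ 0 := by
      intro h0
      apply ℓ_ne_zero_of_mem_boundary hp
      ext w
      have h1 : g p (0 : TangentSpace I p) w = bdryForm (I := I) p w := by
        rw [← hinv w]
        exact congrArg (fun v : TangentSpace I p => g p v w) h0.symm
      rw [map_zero] at h1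
      exact h1.symm
    exact (hg.pos _ hne).trans_eq (hinv _)
  have hspec : ∀ w, g p (innerNormal g p) w
      = (Real.sqrt (bdryForm p ((g p).inverse (bdryForm p))))⁻¹ * bdryForm p w := by
    intro w
    rw [innerNormal, map_smul, smul_apply, smul_eq_mul, hinv]
  refine ⟨_, inv_pos.2 (Real.sqrt_pos.2 hpos), hspec, ?_⟩
  rw [hspec, innerNormal, map_smul, smul_eq_mul, ← mul_assoc, ← mul_inv,
    Real.mul_self_sqrt hpos.le, inv_mul_cancel₀ hpos.ne']

/-- A unit vector that is dual to a nonnegative multiple of the form defining the boundary is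
the inner unit normal. -/
theorem eq_innerNormal [FiniteDimensional ℝ E] {g : BilinField I S} {p : S}
    (hg : IsInnerForm (E := E) (g p)) (hp : p ∈ I.boundary S) {u : TangentSpace I p} {k : ℝ}
    (hk : 0 ≤ k) (hu : ∀ w, g p u w = k * bdryForm p w) (hu1 : g p u u = 1) :
    u = innerNormal g p := by
  obtain ⟨m, hm, h1, h2⟩ := innerNormal_spec hg hp
  have hu2 : m • u = k • innerNormal g p := by
    apply hg.ext (E := E)
    intro (w : TangentSpace I p)
    have e1 : g p (m • u) w = m * (k * bdryForm (I := I) p w) := by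
      rw [map_smul, smul_apply, hu, smul_eq_mul]
    have e2 : g p (k • innerNormal g p) w = k * (m * bdryForm (I := I) p w) := by
      rw [map_smul, smul_apply, h1, smul_eq_mul]
    exact e1.trans (Eq.trans (by ring) e2.symm)
  have e : g p (m • u) (m • u) = g p (k • innerNormal g p) (k • innerNormal g p) := by rw [hu2]
  simp only [map_smul, smul_apply, hu1, h2, smul_eq_mul, mul_one] at e
  -- Comparison of lengths gives m² = k², with m > 0 and k ≥ 0.
  have hmk : m = k := by nlinarith
  rw [← hmk] at hu2
  exact smul_right_injective _ hm.ne' hu2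

end Boundary

/-! ### Free boundary hypersurfaces. -/

section FreeBoundary

variable {E : Type*} [NormedAddCommGroup E] [NormedSpace ℝ E]
  {H : Type*} [TopologicalSpace H] {I : ModelWithCorners ℝ E H} [hI : HalfSpaceModel I]
  {S : Type*} [TopologicalSpace S] [ChartedSpace H S]
  {E' : Type*} [NormedAddCommGroup E'] [NormedSpace ℝ E']
  {H' : Type*} [TopologicalSpace H'] {J : ModelWithCorners ℝ E' H'} [hJ : HalfSpaceModel J]
  {W : Type*} [TopologicalSpace W] [ChartedSpace H' W]
  [IsManifold I ∞ S] [IsManifold J ∞ W]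

omit hI hJ in
theorem fderivWithin_chartMap_chartDeriv {F : S → W} {p q : S} {x₁ : W}
    (hq : q ∈ (extChartAt I p).source) (hF : MDifferentiableAt I J F q)
    (hx : F q ∈ (extChartAt J x₁).source) (a : TangentSpace I q) :
    fderivWithin ℝ (chartMap I J F p x₁) (range I) (extChartAt I p q) (chartDeriv I p q a)
      = chartDeriv J x₁ (F q) (mfderiv I J F q a) := by
  obtain ⟨z, hz, rfl⟩ : ∃ z ∈ (extChartAt I p).target, (extChartAt I p).symm z = q :=
    ⟨_, (extChartAt I p).map_source hq, (extChartAt I p).left_inv hq⟩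
  rw [(extChartAt I p).right_inv hz, fderivWithin_chartMap hz hF hx, chartDerivSymm_chartDeriv hz]

omit hI hJ in
theorem fderivWithin_chartMap_self {F : S → W} {p : S} (hF : MDifferentiableAt I J F p)
    (a : TangentSpace I p) :
    fderivWithin ℝ (chartMap I J F p (F p)) (range I) (extChartAt I p p) a
      = mfderiv I J F p a := by
  have h := fderivWithin_chartMap_chartDeriv (mem_extChartAt_source p) hF
    (mem_extChartAt_source (F p)) a
  rw [chartDeriv_self, chartDeriv_self] at h
  exact h

omit hI in
/-- The form defining the boundary vanishes on tangent vectors of the boundary in every chart. -/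
theorem bdryForm_chartDeriv_eq_zero [IsManifold J 1 W] {x₀ x : W}
    (hx : x ∈ (extChartAt J x₀).source)
    (hb : x ∈ J.boundary W) {a : TangentSpace J x} (ha : bdryForm x a = 0) :
    hJ.ℓ (chartDeriv J x₀ x a) = 0 := by
  have hτ : IsLocalMap (chartMap J J id x x₀) (range J) (range J) (extChartAt J x x) := by
    apply isLocalMap_chartMap contMDiff_id (mem_extChartAt_target x)
    rwa [(extChartAt J x).left_inv (mem_extChartAt_source x)]
  have h0 : chartMap J J id x x₀ (extChartAt J x x) = extChartAt J x₀ x := chartMap_self id x x₀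
  have h1 := transition_chartDeriv (mem_extChartAt_source x) hx a
  rw [hJ.range_eq] at hτ h1
  obtain ⟨k, -, hk⟩ := hτ.exists_bdryForm_eq (ℓ_eq_zero_of_mem_boundary hb)
    (by rw [h0]; exact ((mem_boundary_iff hx).1 hb).1)
  rw [← h1, hk, chartDeriv_self]
  exact mul_eq_zero_of_right _ ha

variable [IsManifold J 1 W] [FiniteDimensional ℝ E] [FiniteDimensional ℝ E']
  {g : BilinField J W} {F : S → W} {N : ∀ p, TangentSpace J (F p)}

omit hI [IsManifold I ∞ S] [IsManifold J ∞ W] [FiniteDimensional ℝ E] in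
/-- Along a free boundary the Gauss map is tangent to the boundary of the ambient manifold. -/
theorem HasFreeBoundary.bdryForm_normal (hfree : HasFreeBoundary I F g) (hg : IsSmoothMetric g)
    (hN : IsGaussMap I F g N) {p : S} (hp : p ∈ I.boundary S) : bdryForm (F p) (N p) = 0 := by
  obtain ⟨hb, ho⟩ := hfree ⟨p, hp⟩
  obtain ⟨u, hu⟩ := ho p hp
  have hFp : F p ∈ J.boundary W := by
    rw [hb] at hp
    exact hp
  obtain ⟨m, hm, h1, -⟩ := innerNormal_spec (hg.inner (F p)) hFp
  have h2 := hN.normal p u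
  rw [hu] at h2
  have h3 := ((hg.inner (F p)).symm (N p) (innerNormal g (F p))).symm.trans h2
  exact (mul_eq_zero.1 ((h1 (N p)).symm.trans h3)).resolve_left hm.ne'

omit [IsManifold J 1 W] in
/-- Along a free boundary the inner unit normals of the hypersurface and of the ambient manifold
agree. -/
theorem HasFreeBoundary.mfderiv_innerNormal (hfree : HasFreeBoundary I F g)
    (hg : IsSmoothMetric g) (hF : IsSmoothImmersion I J F) {p : S} (hp : p ∈ I.boundary S) :
    mfderiv I J F p (innerNormal (pullback I F g) p) = innerNormal g (F p) := by
  obtain ⟨hb, ho⟩ := hfree ⟨p, hp⟩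
  obtain ⟨u, hu⟩ := ho p hp
  have hFp : F p ∈ J.boundary W := by
    rw [hb] at hp
    exact hp
  have hFd : MDifferentiableAt I J F p := hF.1.mdifferentiableAt (by simp)
  obtain ⟨m, hm, h1, h2⟩ := innerNormal_spec (hg.inner (F p)) hFp
  have hφ : IsLocalMap (chartMap I J F p (F p)) (range I) (range J) (extChartAt I p p) := by
    apply isLocalMap_chartMap hF.1 (mem_extChartAt_target p)
    rw [(extChartAt I p).left_inv (mem_extChartAt_source p)]
    exact mem_extChartAt_source _
  have hD := fderivWithin_chartMap_self (J := J) hFd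
  rw [hI.range_eq] at hφ hD
  rw [hJ.range_eq] at hφ
  obtain ⟨k, hk0, hk⟩ := hφ.exists_bdryForm_eq (ℓ_eq_zero_of_mem_boundary hp)
    (by rw [chartMap_self]; exact ℓ_eq_zero_of_mem_boundary hFp)
  have hk' : ∀ w : TangentSpace I p, bdryForm (F p) (mfderiv I J F p w) = k * bdryForm p w := by
    intro w
    rw [← hD]
    exact hk w
  rw [← hu]
  -- For the vector u with dF u = ν one has ⟨u, w⟩ = ⟨ν, dF w⟩ = m ℓ'(dF w) = m k ℓ(w), with m k ≥
  -- 0.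
  refine (congrArg _ (eq_innerNormal (pullback_innerForm hg hF p) hp (mul_nonneg hm.le hk0)
    (fun w => ?_) ?_)).symm
  · change g (F p) (mfderiv I J F p u) (mfderiv I J F p w) = _
    rw [hu, h1, hk', mul_assoc]
  · change g (F p) (mfderiv I J F p u) (mfderiv I J F p u) = _
    rw [hu, h2]

/-- The derivative of the angle function along the conormal of a free boundary. -/
theorem HasFreeBoundary.mfderiv_angle (hfree : HasFreeBoundary I F g) (hg : IsSmoothMetric g)
    (hF : IsSmoothImmersion I J F) (hN : IsGaussMap I F g N)
    (hd : Module.finrank ℝ E' = Module.finrank ℝ E + 1)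
    {V : ∀ x : W, TangentSpace J x} {ξ : E'} (hV : IsParallelField g V ξ) (hξ : hJ.ℓ ξ = 0)
    {θ : S → ℝ} (hθ : ∀ p, θ p = g (F p) (V (F p)) (N p))
    (hθd : MDifferentiable I 𝓘(ℝ, ℝ) θ) {p : S} (hp : p ∈ I.boundary S) :
    (mfderiv I 𝓘(ℝ, ℝ) θ p (innerNormal (pullback I F g) p) : ℝ)
      = - θ p * bdrySFF g (F p) (N p) (N p) := by
  have : IsManifold I 1 S := instIsManifoldOne
  have hFp : F p ∈ J.boundary W := by
    rw [(hfree ⟨p, hp⟩).1] at hp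
    exact hp
  obtain ⟨m, hm, hm1, hm2⟩ := innerNormal_spec (hg.inner (F p)) hFp
  have hν := hfree.mfderiv_innerNormal hg hF hp
  have hFd : MDifferentiableAt I J F p := hF.1.mdifferentiableAt (by simp)
  have h := hN.isLocalHypersurface hg hF hd p
  have hz := mem_extChartAt_target (I := I) p
  have hpp : (extChartAt I p).symm (extChartAt I p p) = p :=
    (extChartAt I p).left_inv (mem_extChartAt_source p)
  have hx : F ((extChartAt I p).symm (extChartAt I p p)) ∈ (extChartAt J (F p)).source := by
    rw [hpp]
    exact mem_extChartAt_source _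
  have hev := eventually_mem_source (J := J) hz hF.1.continuous.continuousAt hx
  have hφx : chartMap I J F p (F p) (extChartAt I p p) = extChartAt J (F p) (F p) :=
    chartMap_self F p (F p)
  have hn : chartFieldMap I F N p (extChartAt I p p) = N p := by
    rw [chartFieldMap, hpp, chartField_eq, chartDeriv_self]
  have hVp : V (F p) = ξ := by
    rw [← hV.chartDeriv_eq (F p) (F p) (mem_extChartAt_source _), chartDeriv_self]
  have hθc : (fun z => chartForm g (F p) (chartMap I J F p (F p) z) ξ (chartFieldMap I F N p z))
      =ᶠ[𝓝[range I] (extChartAt I p p)] chartFun I θ p := by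
    filter_upwards [hev] with w hw
    rw [chartFun, hθ, ← hV.chartDeriv_eq _ _ hw.2, chartFieldMap_eq, chartMap,
      chartForm_chartDeriv g hw.2]
  have hθξ : chartForm g (F p) (extChartAt J (F p) (F p)) ξ (N p) = θ p := by
    rw [hθ, ← hVp]
    exact chartForm_self g (F p) _ _
  -- Tangency of N at all boundary points near p is needed in the single chart at F p, since it is
  -- differentiated along the boundary.
  have htan : ∀ᶠ z in 𝓝[range I] (extChartAt I p p), hI.ℓ z = 0 →
      hJ.ℓ (chartFieldMap I F N p z) = 0 := by
    filter_upwards [hev] with w hw h0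
    have hq : (extChartAt I p).symm w ∈ I.boundary S := by
      rw [mem_boundary_iff ((extChartAt I p).map_target hw.1), (extChartAt I p).right_inv hw.1]
      exact ⟨h0, ℓ_ne_zero_of_mem_boundary hp⟩
    have hFq : F ((extChartAt I p).symm w) ∈ J.boundary W := by
      rw [(hfree ⟨p, hp⟩).1] at hq
      exact hq
    exact bdryForm_chartDeriv_eq_zero hw.2 hFq (hfree.bdryForm_normal hg hN hq)
  have hpar := (hV.parallel (F p)).self_of_nhdsWithin
    (extChartAt_target_subset_range _ (mem_extChartAt_target (F p)))
  have hdθ := fderivWithin_chartFun_self (hθd p) (innerNormal (pullback I F g) p)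
  rw [← hθc.fderivWithin_eq (hθc.self_of_nhdsWithin h.mem),
    (h.hasFDeriv_angle (by rw [hφx]; exact hV.parallel _)).fderivWithin
      (h.region.uniqueDiffOn _ h.mem)] at hdθ
  have hD := fderivWithin_chartMap_self hFd (innerNormal (pullback I F g) p)
  rw [hν] at hD
  have hu : (innerNormal (pullback I F g) p : E) ≠ 0 := by
    intro h0
    have h0' : innerNormal (pullback I F g) p = (0 : TangentSpace I p) := h0
    rw [h0', map_zero] at hν
    rw [← hν, map_zero] at hm2
    exact zero_ne_one hm2
  rw [hI.range_eq] at h htan hdθ hD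
  rw [hJ.range_eq] at h hpar hdθ
  have key := h.angle_conormal (ℓ_eq_zero_of_mem_boundary hp)
    (by rw [hφx]; exact ℓ_eq_zero_of_mem_boundary hFp) htan (by rw [hφx]; exact hpar) hξ hu
    (m := m) (fun X => by
      rw [hD, hφx]
      exact (chartForm_self g (F p) _ _).trans (hm1 X))
  refine hdθ.symm.trans (key.trans ?_)
  rw [hD, hφx, hn, hθξ, bdrySFF]
  refine congrArg _ ((chartForm_self g (F p) _ _).trans ?_)
  rw [christoffelAt, hJ.range_eq]
  rfl

end FreeBoundary

/-! ### Constant functions. -/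

section Constant

variable {E : Type*} [NormedAddCommGroup E] [NormedSpace ℝ E]
  {H : Type*} [TopologicalSpace H] {I : ModelWithCorners ℝ E H}
  {S : Type*} [TopologicalSpace S] [ChartedSpace H S] [IsManifold I ∞ S]

/-- A function with vanishing derivative on a connected manifold is constant. -/
theorem exists_eq_const_of_mfderiv_eq_zero [ConnectedSpace S] {f : S → ℝ}
    (hf : MDifferentiable I 𝓘(ℝ, ℝ) f)
    (h0 : ∀ p (u : TangentSpace I p), (mfderiv I 𝓘(ℝ, ℝ) f p u : ℝ) = 0) :
    ∃ a : ℝ, ∀ p, f p = a := by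
  have hd : ∀ p : S, ∀ z ∈ (extChartAt I p).target,
      HasFDerivWithinAt (chartFun I f p) (0 : E →L[ℝ] ℝ) (range I) z := by
    intro p z hz
    have : IsManifold I 1 S := instIsManifoldOne
    have h1 : DifferentiableWithinAt ℝ (chartFun I f p) (range I) z :=
      mdifferentiableWithinAt_iff_differentiableWithinAt.1
        ((hf _).comp_mdifferentiableWithinAt z (mdifferentiableWithinAt_extChartAt_symm hz))
    refine h1.hasFDerivWithinAt.congr_fderiv (ContinuousLinearMap.ext fun u => ?_)
    have hs := (extChartAt I p).map_target hz
    obtain ⟨a, rfl⟩ := chartDeriv_surjective hs u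
    have h2 := fderivWithin_chartFun (hf _) hs a
    rw [(extChartAt I p).right_inv hz] at h2
    exact h2.trans (h0 _ _)
  have hloc : IsLocallyConstant f := by
    rw [IsLocallyConstant.iff_eventually_eq]
    intro p
    obtain ⟨r, hr, hsub⟩ := Metric.mem_nhdsWithin_iff.1
      (extChartAt_target_mem_nhdsWithin_of_mem (mem_extChartAt_target (I := I) p))
    -- The range of the model is convex, so the mean value inequality applies within it, at boundary
    -- points as well.
    have hc : Convex ℝ (Metric.ball (extChartAt I p p) r ∩ range I) :=
      (convex_ball _ _).inter I.convex_range
    have hev : ∀ᶠ q in 𝓝 p, extChartAt I p q ∈ Metric.ball (extChartAt I p p) r :=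
      (continuousAt_extChartAt p).eventually (Metric.ball_mem_nhds _ hr)
    filter_upwards [hev, extChartAt_source_mem_nhds (I := I) p] with q hq hq'
    have hmem : ∀ q', q' ∈ (extChartAt I p).source → extChartAt I p q' ∈ range I := fun q' h =>
      extChartAt_target_subset_range p ((extChartAt I p).map_source h)
    have hp' := mem_extChartAt_source (I := I) p
    have h1 := hc.norm_image_sub_le_of_norm_hasFDerivWithin_le (C := 0) (f' := fun _ => 0)
      (fun z hz => (hd p z (hsub hz)).mono inter_subset_right) (fun _ _ => by simp)
      ⟨Metric.mem_ball_self hr, hmem p hp'⟩ ⟨hq, hmem q hq'⟩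
    rw [zero_mul, norm_le_zero_iff, sub_eq_zero, chartFun, chartFun,
      (extChartAt I p).left_inv hq', (extChartAt I p).left_inv hp'] at h1
    exact h1
  obtain ⟨p₀⟩ := (inferInstance : Nonempty S)
  exact ⟨f p₀, fun p => hloc.apply_eq_of_preconnectedSpace p p₀⟩

omit [IsManifold I ∞ S] in
theorem driftedLaplacian_const (g : BilinField I S) (ψ : S → ℝ) (a : ℝ) (p : S) :
    driftedLaplacian g ψ (fun _ => a) p = 0 := by
  have h1 : coordGrad (chartForm g p) (range I) (chartFun I (fun _ => a) p) = fun _ => 0 := by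
    funext z
    have : chartFun I (fun _ : S => a) p = fun _ => a := rfl
    rw [coordGrad, this]
    simp
  have h2 : grad g (fun _ => a) p = 0 := by
    rw [grad, mfderiv_const]
    exact map_zero _
  rw [driftedLaplacian, laplacian, h1, h2, map_zero, coordDiv]
  simp

end Constant

/-! ### Slices and boundary convexity of the cylinder. -/

section Cylinder

variable {E : Type*} [NormedAddCommGroup E] [NormedSpace ℝ E] [FiniteDimensional ℝ E]
  {H : Type*} [TopologicalSpace H] {I : ModelWithCorners ℝ E H} [hI : HalfSpaceModel I]
  {M : Type*} [TopologicalSpace M] [ChartedSpace H M] [IsManifold I ∞ M]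
  {H₀ : Type*} [TopologicalSpace H₀] {I₀ : ModelWithCorners ℝ E H₀} [hI₀ : HalfSpaceModel I₀]
  {S : Type*} [TopologicalSpace S] [ChartedSpace H₀ S] [IsManifold I₀ ∞ S]
  {F : S → M × ℝ} {N : ∀ p, TangentSpace (I.prod 𝓘(ℝ, ℝ)) (F p)} {g : BilinField I M}

omit hI hI₀ [FiniteDimensional ℝ E] in
/-- A hypersurface with vertical unit normal lies in a slice. -/
theorem exists_snd_eq_const [ConnectedSpace S] (hg : IsSmoothMetric g)
    (hF : IsSmoothImmersion I₀ (I.prod 𝓘(ℝ, ℝ)) F) (hN : IsGaussMap I₀ F (cylMetric g) N)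
    (h1 : ∀ p, angle g F N p ^ 2 = 1) : ∃ s : ℝ, ∀ p, (F p).2 = s := by
  refine exists_eq_const_of_mfderiv_eq_zero (I := I₀)
    ((contMDiff_snd.comp hF.1).mdifferentiable (by simp)) fun p u => ?_
  have h2 := horizontal_eq hN p
  rw [h1, sub_self] at h2
  -- The horizontal part of N has squared length 1 − θ² = 0. Orthogonality of N to dF u then says
  -- that θ times the vertical component of dF u is zero.
  have h3 : (N p).1 = (0 : E) := (hg.inner (F p).1).eq_zero h2
  have h4 : g (F p).1 (0 : TangentSpace I (F p).1) (mfderiv I₀ (I.prod 𝓘(ℝ, ℝ)) F p u).1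
      + angle g F N p * (mfderiv I₀ (I.prod 𝓘(ℝ, ℝ)) F p u).2 = 0 := by
    rw [angle_eq]
    exact (congrArg (fun w : E => g (F p).1 w (mfderiv I₀ (I.prod 𝓘(ℝ, ℝ)) F p u).1
      + ((N p).2 : ℝ) * (mfderiv I₀ (I.prod 𝓘(ℝ, ℝ)) F p u).2) h3).symm.trans
        ((cylMetric_apply g (F p) (N p) _).symm.trans (hN.normal p u))
  have h5 : angle g F N p ≠ 0 := fun h => by
    have := h1 p
    rw [h] at this
    norm_num at this
  rw [map_zero] at h4
  exact (mfderiv_snd_comp (hF.1.mdifferentiable (by simp)) p u).trans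
    ((mul_eq_zero.1 ((zero_add _).symm.trans h4)).resolve_left h5)

/-- The boundary of a cylinder over a manifold with convex boundary is convex. -/
theorem bdrySFF_cylMetric_nonneg (hg : IsSmoothMetric g) (hc : HasLocallyConvexBoundary g)
    {x : M × ℝ} (hx : x ∈ (I.prod 𝓘(ℝ, ℝ)).boundary (M × ℝ))
    {a : TangentSpace (I.prod 𝓘(ℝ, ℝ)) x} (ha : bdryForm x a = 0) :
    0 ≤ bdrySFF (cylMetric g) x a a := by
  have hx1 : x.1 ∈ I.boundary M := by
    rw [ModelWithCorners.boundary_of_boundaryless_right] at hx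
    exact hx.1
  obtain ⟨m, hm, hm1, -⟩ := innerNormal_spec (hg.inner x.1) hx1
  obtain ⟨k, hk, hk1, -⟩ := innerNormal_spec (hg.cylMetric.inner x) hx
  have h1 := hc x.1 hx1 a.1 ha
  -- Both second fundamental forms are positive multiples of ℓ(Γ(a', a')), where a' is the
  -- horizontal part of a: the boundary form of the cylinder is that of M on the first factor.
  have h2 : bdrySFF g x.1 a.1 a.1 = m * bdryForm x.1 (christoffelAt g x.1 a.1 a.1) :=
    ((hg.inner x.1).symm _ _).trans (hm1 _)
  have h3 : bdrySFF (cylMetric g) x a a = k * bdryForm x (christoffelAt (cylMetric g) x a a) :=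
    ((hg.cylMetric.inner x).symm _ _).trans (hk1 _)
  rw [h3, christoffelAt_cylMetric hg]
  rw [h2] at h1
  exact mul_nonneg hk.le (nonneg_of_mul_nonneg_right h1 hm)

theorem HasFreeBoundary.mfderiv_angle_cylMetric (hfree : HasFreeBoundary I₀ F (cylMetric g))
    (hg : IsSmoothMetric g) (hF : IsSmoothImmersion I₀ (I.prod 𝓘(ℝ, ℝ)) F)
    (hN : IsGaussMap I₀ F (cylMetric g) N) {p : S} (hp : p ∈ I₀.boundary S) :
    (mfderiv I₀ 𝓘(ℝ, ℝ) (angle g F N) p (innerNormal (pullback I₀ F (cylMetric g)) p) : ℝ)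
      = - angle g F N p * bdrySFF (cylMetric g) (F p) (N p) (N p) :=
  hfree.mfderiv_angle hg.cylMetric hF hN (by simp) (isParallelField_vertical hg)
    (map_zero hI.ℓ) (fun _ => rfl) ((contMDiff_angle hN).mdifferentiable (by simp)) hp

end Cylinder

end WeightedGeom

end

end

/-! ### The theorem: parabolicity applied to the angle, and the equality case. -/

theorem theorem4p2 (n : ℕ) [NeZero n]
    -- the base manifold `M`, of dimension `n`, with (possibly empty) locally convex boundary
    (M : Type*) [TopologicalSpace M] [T2Space M] [SecondCountableTopology M]
    [ChartedSpace (EuclideanHalfSpace n) M] [IsManifold (𝓡∂ n) ∞ M]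
    (g : Bundle.ContMDiffRiemannianMetric (𝓡∂ n) ∞ (EuclideanSpace ℝ (Fin n))
      (fun x : M => TangentSpace (𝓡∂ n) x))
    (hconvex : HasLocallyConvexBoundary (I := 𝓡∂ n) g.inner)
    -- the product weight `e^{h(p)} e^{v(t)}`, with `Ric_v ≤ c ≤ Ric_h`
    (h : M → ℝ) (hh : ContMDiff (𝓡∂ n) 𝓘(ℝ, ℝ) ∞ h) (v : ℝ → ℝ) (hv : ContDiff ℝ ∞ v) (c : ℝ)
    (hRicv : ∀ (t : ℝ) (w : TangentSpace 𝓘(ℝ, ℝ) t),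
      ricciBE lineMetric v t w w ≤ c * lineMetric t w w)
    (hRich : ∀ (x : M) (w : TangentSpace (𝓡∂ n) x),
      c * g.inner x w w ≤ ricciBE (I := 𝓡∂ n) g.inner h x w w)
    -- the connected two-sided hypersurface `F : S → M × ℝ`, with Gauss map `N` and `θ ≤ 0`
    (S : Type*) [TopologicalSpace S] [T2Space S] [SecondCountableTopology S] [ConnectedSpace S]
    [ChartedSpace (EuclideanHalfSpace n) S] [IsManifold (𝓡∂ n) ∞ S]
    (F : S → M × ℝ) (hF : IsSmoothImmersion (𝓡∂ n) ((𝓡∂ n).prod 𝓘(ℝ, ℝ)) F)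
    (N : ∀ p : S, TangentSpace ((𝓡∂ n).prod 𝓘(ℝ, ℝ)) (F p))
    (hN : IsGaussMap (𝓡∂ n) F (cylMetric (I := 𝓡∂ n) g.inner) N)
    (hθ : ∀ p, angle (I := 𝓡∂ n) g.inner F N p ≤ 0)
    -- it is `ψ`-parabolic, with constant `ψ`-mean curvature and free boundary
    (hpar : IsWeightedParabolic (pullback (𝓡∂ n) F (cylMetric (I := 𝓡∂ n) g.inner))
      (prodWeight h v ∘ F))
    (hH : ∃ a : ℝ, ∀ p, weightedMeanCurvature (𝓡∂ n) F (cylMetric (I := 𝓡∂ n) g.inner)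
      (prodWeight h v) N p = a)
    (hfree : HasFreeBoundary (𝓡∂ n) F (cylMetric (I := 𝓡∂ n) g.inner)) :
    (∃ a : ℝ, ∀ p, angle (I := 𝓡∂ n) g.inner F N p = a) ∧
    ((∀ p, angle (I := 𝓡∂ n) g.inner F N p = 0) ∨
     (∃ s : ℝ, ∀ p, (F p).2 = s) ∨
     (IsTotallyGeodesic (𝓡∂ n) F (cylMetric (I := 𝓡∂ n) g.inner) N ∧
      (∀ p, ricciBE (cylMetric (I := 𝓡∂ n) g.inner) (prodWeight h v) (F p) (N p) (N p) = c ∧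
        ricciBE (cylMetric (I := 𝓡∂ n) g.inner) (prodWeight h v) (F p)
          (vertical (𝓡∂ n) (F p)) (vertical (𝓡∂ n) (F p)) = c) ∧
      ∀ p ∈ (𝓡∂ n).boundary S,
        bdrySFF (cylMetric (I := 𝓡∂ n) g.inner) (F p) (N p) (N p) = 0)) := by 
  have hg : IsSmoothMetric (J := 𝓡∂ n) g.inner := isSmoothMetric_inner g
  obtain ⟨b, hb⟩ := hH
  obtain ⟨θ, hθdef⟩ : ∃ θ, θ = angle (I := 𝓡∂ n) g.inner F N := ⟨_, rfl⟩
  rw [← hθdef] at hθ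
  have hlap := driftedLaplacian_angle_cylMetric hg hF hN hh hv hb
  -- On the unit vector of ℝ, Ric_v is −v''.
  have hv2 : ∀ t, 0 ≤ c + fderiv ℝ (fderiv ℝ v) t 1 1 := by
    intro t
    have h1 := hRicv t (1 : ℝ)
    rw [ricciBE_lineMetric, lineMetric_apply] at h1
    linarith
  have hhor := horizontal_eq (g := g.inner) hN
  simp only [← hθdef, traceForm_apply] at hlap hhor
  have hhor0 : ∀ p, 0 ≤ 1 - θ p ^ 2 := fun p => by
    rw [← hhor]
    exact (hg.inner (F p).1).nonneg (N p).1
  have hric : ∀ p, c * (1 - θ p ^ 2)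
      ≤ ricciBE (I := 𝓡∂ n) g.inner h (F p).1 (N p).1 (N p).1 := fun p => by
    rw [← hhor]
    exact hRich (F p).1 (N p).1
  have hloc := hN.isLocalHypersurface hg.cylMetric hF (by simp)
  have htr := fun p => (hloc p).localMetric.innerForm.trace_comp_self_nonneg (hloc p).shapeOp_symm
  have hprod := fun p => mul_nonneg (hhor0 p) (hv2 (F p).2)
  have hbdry : ∀ p ∈ (𝓡∂ n).boundary S,
      0 ≤ bdrySFF (cylMetric (I := 𝓡∂ n) g.inner) (F p) (N p) (N p) := by
    intro p hp
    have hFp : F p ∈ ((𝓡∂ n).prod 𝓘(ℝ, ℝ)).boundary (M × ℝ) := by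
      rw [(hfree ⟨p, hp⟩).1] at hp
      exact hp
    exact bdrySFF_cylMetric_nonneg hg hconvex hFp (hfree.bdryForm_normal hg.cylMetric hN hp)
  -- Parabolicity for θ, bounded above by 0 because it is a multigraph.
  have hconst : ∃ a : ℝ, ∀ p, θ p = a := by
    refine hpar θ (hθdef ▸ (contMDiff_angle hN).of_le (by norm_cast))
      ⟨0, by rintro _ ⟨p, rfl⟩; exact hθ p⟩ (fun p _ => ?_) (fun p hp => ?_)
    · rw [hlap]
      refine mul_nonneg (neg_nonneg.2 (hθ p)) (add_nonneg ?_ (htr p))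
      linarith [hric p, hprod p]
    · rw [hθdef, hfree.mfderiv_angle_cylMetric hg hF hN hp, ← hθdef]
      exact mul_nonneg (neg_nonneg.2 (hθ p)) (hbdry p hp)
  rw [← hθdef]
  refine ⟨hconst, ?_⟩
  obtain ⟨a, ha⟩ := hconst
  have hθa : θ = fun _ => a := funext ha
  by_cases ha0 : a = 0
  · exact Or.inl fun p => (ha p).trans ha0
  right
  have hzero : ∀ p, driftedLaplacian (pullback (𝓡∂ n) F (cylMetric (I := 𝓡∂ n) g.inner))
      (prodWeight h v ∘ F) θ p = 0 := fun p => by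
    rw [hθa]
    exact driftedLaplacian_const _ _ a p
  -- θ is constant, so its drifted Laplacian is 0, and dividing by −θ = −a ≠ 0 the bracket vanishes.
  -- It is the sum of the nonnegative terms Ric_h(N', N') − c(1 − θ²), (1 − θ²)(c + v'') and tr S²,
  -- so each of them is zero.
  have hsum := fun p => (mul_eq_zero.1 ((hlap p).symm.trans (hzero p))).resolve_left
    (neg_ne_zero.2 ((ha p).trans_ne ha0))
  have htr0 := fun p => le_antisymm (by linarith [hsum p, hric p, hprod p]) (htr p)
  have hgeo := fun p => (hloc p).localMetric.innerForm.eq_zero_of_trace_comp_self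
    (hloc p).shapeOp_symm (htr0 p)
  by_cases ha1 : a ^ 2 = 1
  · exact Or.inl (exists_snd_eq_const hg hF hN fun p => by rw [← hθdef, ha, ha1])
  right
  -- Here 1 − a² ≠ 0 can be cancelled.
  have hv2c : ∀ p, fderiv ℝ (fderiv ℝ v) (F p).2 1 1 = -c := fun p => by
    have h1 : (1 - θ p ^ 2) * (c + fderiv ℝ (fderiv ℝ v) (F p).2 1 1) = 0 :=
      le_antisymm (by linarith [hsum p, hric p, htr p]) (hprod p)
    rw [ha] at h1
    linarith [(mul_eq_zero.1 h1).resolve_left (sub_ne_zero.2 (Ne.symm ha1))]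
  have hricc : ∀ p, ricciBE (I := 𝓡∂ n) g.inner h (F p).1 (N p).1 (N p).1
      = c * (1 - θ p ^ 2) := fun p =>
    le_antisymm (by linarith [hsum p, hprod p, htr p]) (hric p)
  refine ⟨fun p u w => secondFF_eq_zero hg.cylMetric hF hN (by simp) (hgeo p) u w,
    fun p => ⟨?_, ?_⟩, fun p hp => ?_⟩
  · rw [ricciBE_cylMetric_normal hg hh hv, hricc, hv2c, ← hθdef]
    ring
  · rw [ricciBE_cylMetric_vertical hg hh hv, hv2c, neg_neg]
  -- The conormal derivative −θ II(N, N) of the constant θ = a ≠ 0 is zero.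
  · have h1 := hfree.mfderiv_angle_cylMetric hg hF hN hp
    rw [← hθdef, hθa, mfderiv_const] at h1
    exact (mul_eq_zero.1 h1.symm).resolve_left (neg_ne_zero.2 ha0)
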